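/- Let $S$ be a smooth embedded surface in $\mathbb{RP}^3$ and let $g\in S$ be a godron, that is, a parabolic point (a point with exactly one asymptotic tangent line, i.e. tangent line with at least 3-point contact with $S$) at which the asymptotic line is tangent to the parabolic curve. Suppose that some projective transformation sends $g$ to the origin and a neighbourhood of $g$ in $S$ to the surface in Platonova's normal form $$z=\frac{y^2}{2}-x^2y+\lambda x^4+\varphi(x,y),\qquad \lambda\neq 0,\tfrac12,$$ where $\varphi$ is a $C^\infty$ function near the origin whose Taylor polynomial of degree $4$ at the origin is zero. Let $P$ be the parabolic curve of $S$, $F$ the flecnodal curve (the points at which some asymptotic line has at least 4-point contact with $S$) and $D$ the conodal curve (the closure of the set of points of contact with planes tangent at two distinct points at least) of a sufficiently small neighbourhood of $g$ in $S$. Then near $g$ the sets $F$, $P$, $D$ are smooth regular curves through $g$ with a common tangent at $g$. Let $\ell_F,\ell_P,\ell_D$ be the tangent lines, at the corresponding common contact element, to the Legendrian curves in $PT^*S$ formed by the contact elements tangent to $F$, $P$, $D$, and let $\ell_g$ be the tangent line to the fibre of $PT^*S\to S$ over $g$. These lines lie in the contact plane, and their cross-ratio $$\rho=(\ell_F,\ell_P,\ell_D,\ell_g),\qquad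 (\ell_1,\ell_2,\ell_3,\ell_4)=\frac{(s_1-s_3)(s_2-s_4)}{(s_2-s_3)(s_1-s_4)}\ \text{ for lines of slopes } s_i$$ (the cr-invariant of $g$) is defined and satisfies $\lambda=\rho/2$. -/

import Mathlib

open Set Filter Topology Asymptotics
open scoped ContDiff

/-- The plane of local parameters of a surface. -/
abbrev Plane : Type := ℝ × ℝ

/-- Homogeneous coordinates `(w : x : y : z)` of real projective three-space. -/
abbrev HomCoord : Type := Fin 4 → ℝ

/-- A map is smooth (of class `C^∞`) in a neighbourhood of the point `a`. -/
def SmoothNear {E F : Type*} [NormedAddCommGroup E] [NormedSpace ℝ E]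
    [NormedAddCommGroup F] [NormedSpace ℝ F] (f : E → F) (a : E) : Prop :=
  ∀ᶠ p in 𝓝 a, ContDiffAt ℝ ∞ f p

/-- A (parametrised piece of a) smooth surface in real projective three-space. The point with
parameter `u` is `[r u]`. The field `immersion` says that `u ↦ [r u]` is an immersion, the
last field that it is injective. A surface in affine space with parametrisation `(x, y, z)` is the case
`r = (1, x, y, z)`. -/
structure ProjSurface where
  dom : Set Plane
  isOpen_dom : IsOpen dom
  r : Plane → HomCoord
  smooth : ContDiffOn ℝ ∞ r dom
  immersion : ∀ u ∈ dom,
    LinearIndependent ℝ ![r u, fderiv ℝ r u (1, 0), fderiv ℝ r u (0, 1)]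
  injective : ∀ u ∈ dom, ∀ v ∈ dom, ∀ c : ℝ, r u = c • r v → u = v

namespace ProjSurface

variable (S : ProjSurface)

/-- The tangent plane at the point with parameter `u`, as a three-dimensional subspace of the
space of homogeneous coordinates. -/
noncomputable def tangentPlane (u : Plane) : Submodule ℝ HomCoord :=
  Submodule.span ℝ {S.r u} ⊔ LinearMap.range (fderiv ℝ S.r u).toLinearMap

/-- The tangent line at `[r u]` in the direction `w` has at least `k`-point contact with the
surface: some smooth curve of the surface that leaves `[r u]` with velocity `w` stays within
`O(t ^ k)` of that line, which is spanned by `r u` and `Dr(u) w`. -/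
def HasContact (u w : Plane) (k : ℕ) : Prop :=
  ∃ c : ℝ → Plane, SmoothNear c 0 ∧ c 0 = u ∧ deriv c 0 = w ∧
    ∃ a b : ℝ → ℝ,
      (fun t : ℝ => S.r (c t) - (a t • S.r u + b t • fderiv ℝ S.r u w)) =O[𝓝 0]
        (fun t : ℝ => t ^ k)

/-- `w` spans an asymptotic direction: its tangent line exceeds two-point contact. -/
def IsAsymptotic (u w : Plane) : Prop :=
  w ≠ 0 ∧ S.HasContact u w 3

/-- The parabolic curve: the points with exactly one asymptotic line. -/
def parabolicCurve : Set Plane :=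
  {u | u ∈ S.dom ∧ ∃ w, S.IsAsymptotic u w ∧
    ∀ w', S.IsAsymptotic u w' → w' ∈ Submodule.span ℝ {w}}

/-- The flecnodal curve: the points at which an asymptotic line exceeds three-point contact. -/
def flecnodalCurve : Set Plane :=
  {u | u ∈ S.dom ∧ ∃ w, S.IsAsymptotic u w ∧ S.HasContact u w 4}

/-- The conodal curve of the part of the surface with parameters in `V`: the closure of the locus
of points of contact with planes that are tangent at two distinct points at least. -/
def conodalCurve (V : Set Plane) : Set Plane :=
  closure {u | u ∈ V ∩ S.dom ∧ ∃ v ∈ V ∩ S.dom, v ≠ u ∧ S.tangentPlane u = S.tangentPlane v}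

end ProjSurface

/-- Near `g`, the set `C` is a smooth regular curve through `g`, and `γ` is a regular
parametrisation of it with `γ 0 = g`. -/
def ParametrisesGerm (γ : ℝ → Plane) (C : Set Plane) (g : Plane) : Prop :=
  SmoothNear γ 0 ∧ γ 0 = g ∧ deriv γ 0 ≠ 0 ∧
    ∀ᶠ ε in 𝓝[>] (0 : ℝ), ∀ᶠ u in 𝓝 g, (u ∈ C ↔ u ∈ γ '' Ioo (-ε) ε)

/-- A godron: a parabolic point at which the (unique) asymptotic direction is tangent to the
parabolic curve. -/
def ProjSurface.IsGodron (S : ProjSurface) (g : Plane) : Prop :=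
  g ∈ S.parabolicCurve ∧
    ∃ γ : ℝ → Plane, ParametrisesGerm γ S.parabolicCurve g ∧ S.IsAsymptotic g (deriv γ 0)

/-- A contact element of the surface at a point is given by a nonzero covector `α` (whose kernel
is the element) up to a factor. So the tangent space to the manifold of contact elements, at the
class of `α` over any point, is the space of pairs `(v, β)`, of a velocity `v` of the point and a
velocity `β` of the covector, modulo the direction `(0, α)` of rescaling. -/
abbrev ContactTangent (α : Plane →L[ℝ] ℝ) : Type :=
  (Plane × (Plane →L[ℝ] ℝ)) ⧸ Submodule.span ℝ {((0 : Plane), α)}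

/-- The class of a pair `(v, β)` in the tangent space. -/
noncomputable def ContactTangent.mk (α : Plane →L[ℝ] ℝ) : (Plane × (Plane →L[ℝ] ℝ)) →ₗ[ℝ] ContactTangent α :=
  Submodule.mkQ _

/-- The contact plane at the contact element `[α]`: the point moves in the direction of the
contact element. -/
noncomputable def contactPlane (α : Plane →L[ℝ] ℝ) : Submodule ℝ (ContactTangent α) :=
  Submodule.map (ContactTangent.mk α) (Submodule.prod (LinearMap.ker α.toLinearMap) ⊤)

/-- The tangent line to the fibre of the projection to the surface. -/
noncomputable def fibreLine (α : Plane →L[ℝ] ℝ) : Submodule ℝ (ContactTangent α) :=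
  Submodule.map (ContactTangent.mk α) (Submodule.prod ⊥ ⊤)

/-- `ℓ` is the tangent line, at the contact element `[α₀]`, to the Legendrian lift of `γ`, that is,
to the curve of the contact elements tangent to `γ`. The lift is represented by a smooth curve of
covectors `α t` with kernel spanned by the velocity of `γ` and with `α 0 = α₀`. -/
def IsLegendrianTangent (γ : ℝ → Plane) (α₀ : Plane →L[ℝ] ℝ)
    (ℓ : Submodule ℝ (ContactTangent α₀)) : Prop :=
  ∃ α : ℝ → (Plane →L[ℝ] ℝ), SmoothNear α 0 ∧ α 0 = α₀ ∧ (∀ᶠ t in 𝓝 0, α t (deriv γ t) = 0) ∧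
    ℓ = Submodule.span ℝ {ContactTangent.mk α₀ (deriv γ 0, deriv α 0)}

/-- `ρ` is the cross-ratio `(ℓ₁, ℓ₂, ℓ₃, ℓ₄)` of four lines of the plane `Q`, of slopes
`s₁, s₂, s₃, s₄` in some basis:
`ρ = (s₁ - s₃) (s₂ - s₄) / ((s₂ - s₃) (s₁ - s₄))`, written homogeneously. -/
def IsCrossRatio {V : Type*} [AddCommGroup V] [Module ℝ V] (Q ℓ₁ ℓ₂ ℓ₃ ℓ₄ : Submodule ℝ V)
    (ρ : ℝ) : Prop :=
  ∃ e f : V, LinearIndependent ℝ ![e, f] ∧ Q = Submodule.span ℝ {e, f} ∧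
    ∃ a₁ b₁ a₂ b₂ a₃ b₃ a₄ b₄ : ℝ,
      ℓ₁ = Submodule.span ℝ {a₁ • e + b₁ • f} ∧ ℓ₂ = Submodule.span ℝ {a₂ • e + b₂ • f} ∧
      ℓ₃ = Submodule.span ℝ {a₃ • e + b₃ • f} ∧ ℓ₄ = Submodule.span ℝ {a₄ • e + b₄ • f} ∧
      a₂ * b₃ - a₃ * b₂ ≠ 0 ∧ a₁ * b₄ - a₄ * b₁ ≠ 0 ∧
      ρ = ((a₁ * b₃ - a₃ * b₁) * (a₂ * b₄ - a₄ * b₂)) /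
        ((a₂ * b₃ - a₃ * b₂) * (a₁ * b₄ - a₄ * b₁))

/-- The cr-invariant of the surface at `g` is defined and equal to `ρ`: near `g` the flecnodal,
parabolic and conodal curves `F`, `P`, `D` are smooth and regular, with a common tangent at `g`,
and `ρ` is the cross-ratio, in the contact plane, of the tangent lines to the Legendrian lifts of
`F`, `P`, `D` and to the fibre over `g`. The conodal curve is that of any sufficiently small piece
of the surface around `g`. -/
def ProjSurface.HasCrInvariant (S : ProjSurface) (g : Plane) (ρ : ℝ) : Prop :=
  ∃ γF γP γD : ℝ → Plane,
    ParametrisesGerm γF S.flecnodalCurve g ∧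
    ParametrisesGerm γP S.parabolicCurve g ∧
    (∃ N ∈ 𝓝 g, ∀ V ∈ 𝓝 g, V ⊆ N → ParametrisesGerm γD (S.conodalCurve V) g) ∧
    ∃ α₀ : Plane →L[ℝ] ℝ, α₀ ≠ 0 ∧
      ∃ ℓF ℓP ℓD : Submodule ℝ (ContactTangent α₀),
        IsLegendrianTangent γF α₀ ℓF ∧ IsLegendrianTangent γP α₀ ℓP ∧
        IsLegendrianTangent γD α₀ ℓD ∧
        IsCrossRatio (contactPlane α₀) ℓF ℓP ℓD (fibreLine α₀) ρ

/-- The projective transformation with matrix `T` sends the point `[r g]` to the origin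
`(1 : 0 : 0 : 0)` and a neighbourhood of `[r g]` in the surface into the graph `z = f (x, y)`
(hence onto a neighbourhood of the origin in that graph, as the surface is immersed). -/
def ProjSurface.SentToGraph (S : ProjSurface) (g : Plane) (T : HomCoord ≃ₗ[ℝ] HomCoord)
    (f : Plane → ℝ) : Prop :=
  T (S.r g) 1 = 0 ∧ T (S.r g) 2 = 0 ∧ T (S.r g) 3 = 0 ∧
    ∀ᶠ u in 𝓝 g, T (S.r u) 0 ≠ 0 ∧
      T (S.r u) 3 / T (S.r u) 0 = f (T (S.r u) 1 / T (S.r u) 0, T (S.r u) 2 / T (S.r u) 0)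

/-! Contact with lines and tangency of planes are projective notions, so they can be read after `T`,
where the surface is the graph of f = y²/2 - x²y + λx⁴ + φ and the projection ψ to the (x, y)-plane
is a local chart. There each of the three curves is a graph y = s x² + o(x²), and only its
coefficient s matters.

The parabolic curve is the zero set of the Hessian determinant, which is -2y + (12λ - 4)x² up to
negligible terms: s_P = 6λ - 2 (`isParabolaGerm_hessianDet`). At a flecnodal point the quadratic and
cubic forms of f have a common root (1, m). The cubic form gives m = 4λx + o(x), and the quadratic
form then gives s_F = 8λ² - 2λ (`isParabolaGerm_flecnodal`).

For the conodal curve, replace y by q = f_y and f by the partial Legendre transform g = f - qy.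
Planes tangent to the graph at two points become lines tangent at two points to one function x ↦
g(x, q). In the model g = -q²/2 - qx² + (λ - 1/2)x⁴, so λ ≠ 1/2 makes this family of functions
generic. The contact abscissae u ± v and q satisfy equations that are divisible by v and v³; after
the division the implicit function theorem applies at v = 0 (`exists_bitangent_family`). This yields
s_D = 2λ (`exists_conodal_graph`).

Finally, differentiating α(γ') = 0 shows that the tangent line to the Legendrian lift of a curve
with coefficient s has a slope affine in s, with coefficients that do not depend on the curve, while
the fibre has infinite slope (`IsLegendrianTangent.eq_span`). An affine map preserves ratios of
differences, so the cross-ratio is (s_F - s_D)/(s_P - s_D) = (8λ² - 4λ)/(4λ - 2) = 2λ. That it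
depends neither on the basis (`IsCrossRatio.unique`) nor on the parametrisations gives the
equivalence. -/

/-! ### Smooth germs; implicit and inverse functions -/

section SmoothGerms

variable {E F G : Type*} [NormedAddCommGroup E] [NormedSpace ℝ E]
  [NormedAddCommGroup F] [NormedSpace ℝ F] [NormedAddCommGroup G] [NormedSpace ℝ G]

theorem ContDiff.smoothNear {f : E → F} (hf : ContDiff ℝ ∞ f) (a : E) : SmoothNear f a :=
  Eventually.of_forall fun p => hf.contDiffAt (x := p)

theorem SmoothNear.contDiffAt {f : E → F} {a : E} (hf : SmoothNear f a) : ContDiffAt ℝ ∞ f a :=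
  hf.self_of_nhds

theorem SmoothNear.continuousAt {f : E → F} {a : E} (hf : SmoothNear f a) : ContinuousAt f a :=
  hf.contDiffAt.continuousAt

theorem SmoothNear.differentiableAt {f : E → F} {a : E} (hf : SmoothNear f a) :
    DifferentiableAt ℝ f a :=
  hf.contDiffAt.differentiableAt (by simp)

theorem SmoothNear.eventually {f : E → F} {a : E} (hf : SmoothNear f a) :
    ∀ᶠ p in 𝓝 a, SmoothNear f p :=
  eventually_eventually_nhds.2 hf

theorem SmoothNear.comp {g : F → G} {f : E → F} (a : E) (hg : SmoothNear g (f a))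
    (hf : SmoothNear f a) : SmoothNear (fun p => g (f p)) a := by
  filter_upwards [hf, hf.continuousAt.eventually hg] with p hp hgp using hgp.comp p hp

theorem SmoothNear.prodMk {f : E → F} {g : E → G} {a : E} (hf : SmoothNear f a)
    (hg : SmoothNear g a) : SmoothNear (fun p => (f p, g p)) a := by
  filter_upwards [hf, hg] with p h₁ h₂ using h₁.prodMk h₂

theorem SmoothNear.add {f g : E → F} {a : E} (hf : SmoothNear f a) (hg : SmoothNear g a) :
    SmoothNear (fun p => f p + g p) a := by
  filter_upwards [hf, hg] with p h₁ h₂ using h₁.add h₂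

theorem SmoothNear.sub {f g : E → F} {a : E} (hf : SmoothNear f a) (hg : SmoothNear g a) :
    SmoothNear (fun p => f p - g p) a := by
  filter_upwards [hf, hg] with p h₁ h₂ using h₁.sub h₂

theorem SmoothNear.mul {f g : E → ℝ} {a : E} (hf : SmoothNear f a) (hg : SmoothNear g a) :
    SmoothNear (fun p => f p * g p) a := by
  filter_upwards [hf, hg] with p h₁ h₂ using h₁.mul h₂

theorem SmoothNear.smul {f : E → ℝ} {g : E → F} {a : E} (hf : SmoothNear f a)
    (hg : SmoothNear g a) : SmoothNear (fun p => f p • g p) a := by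
  filter_upwards [hf, hg] with p h₁ h₂ using h₁.smul h₂

protected theorem SmoothNear.fderiv {f : E → F} {a : E} (hf : SmoothNear f a) :
    SmoothNear (fderiv ℝ f) a := by
  filter_upwards [hf] with p hp using hp.fderiv_right (by simp)

protected theorem SmoothNear.deriv {f : ℝ → F} {a : ℝ} (hf : SmoothNear f a) :
    SmoothNear (deriv f) a := by
  filter_upwards [hf.fderiv] with p hp
  have : _root_.deriv f = fun t => _root_.fderiv ℝ f t 1 := by ext t; simp
  rw [this]
  exact hp.clm_apply contDiffAt_const

/-- A smooth germ is the germ of a globally smooth function. -/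
theorem SmoothNear.exists_contDiff [FiniteDimensional ℝ E] {f : E → F} {a : E}
    (hf : SmoothNear f a) : ∃ g : E → F, ContDiff ℝ ∞ g ∧ g =ᶠ[𝓝 a] f := by
  obtain ⟨ε, hε, hball⟩ := Metric.eventually_nhds_iff_ball.1 hf
  let χ : ContDiffBump a := ⟨ε / 4, ε / 2, by positivity, by linarith⟩
  refine ⟨fun p => χ p • f p, ?_, ?_⟩
  · rw [contDiff_iff_contDiffAt]
    intro p
    by_cases hp : p ∈ Metric.ball a ε
    · exact χ.contDiff.contDiffAt.smul (hball p hp)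
    · have hz : (fun p => χ p • f p) =ᶠ[𝓝 p] fun _ => 0 := by
        have hopen : IsOpen (Metric.closedBall a (ε / 2))ᶜ := Metric.isClosed_closedBall.isOpen_compl
        have hmem : p ∈ (Metric.closedBall a (ε / 2))ᶜ := by
          simp only [Metric.mem_ball, not_lt, mem_compl_iff, Metric.mem_closedBall, not_le] at hp ⊢
          linarith
        filter_upwards [hopen.mem_nhds hmem] with q hq
        have : χ q = 0 := χ.zero_of_le_dist (by
          simp only [mem_compl_iff, Metric.mem_closedBall, not_le] at hq
          exact hq.le)
        simp [this]
      exact contDiffAt_const.congr_of_eventuallyEq hz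
  · filter_upwards [χ.eventuallyEq_one] with p hp
    simp [hp]

theorem ContinuousLinearMap.isInvertible_of_injective [FiniteDimensional ℝ E]
    [FiniteDimensional ℝ F] (hdim : Module.finrank ℝ E = Module.finrank ℝ F)
    (L : E →L[ℝ] F) (hL : ∀ x, L x = 0 → x = 0) : L.IsInvertible := by
  have hinj : Function.Injective L.toLinearMap := (injective_iff_map_eq_zero _).2 hL
  refine ⟨(LinearEquiv.ofInjectiveOfFinrankEq L.toLinearMap hinj hdim).toContinuousLinearEquiv, ?_⟩
  ext x
  rfl

/-- The implicit function theorem for smooth germs. -/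
theorem SmoothNear.exists_implicit [FiniteDimensional ℝ E] [FiniteDimensional ℝ F]
    [FiniteDimensional ℝ G] (hdim : Module.finrank ℝ F = Module.finrank ℝ G)
    {f : E × F → G} {a : E} {b : F} (hf : SmoothNear f (a, b))
    (hinj : ∀ y, _root_.fderiv ℝ f (a, b) (0, y) = 0 → y = 0) :
    ∃ ψ : E → F, SmoothNear ψ a ∧ ψ a = b ∧
      ∀ᶠ p in 𝓝 (a, b), f p = f (a, b) ↔ p.2 = ψ p.1 := by
  have hne : (∞ : ℕ∞ω) ≠ 0 := by simp
  -- Being C^∞ at the base point provides a neighbourhood for each finite order, not a common one.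
  -- The theorem is therefore kept for every base point and reapplied along the graph, where
  -- uniqueness identifies the new implicit function with ψ.
  have key : ∀ p : E × F, (_root_.fderiv ℝ f p ∘L .inr ℝ E F).IsInvertible →
      ContDiffAt ℝ ∞ f p → ∃ ψ : E → F, ContDiffAt ℝ ∞ ψ p.1 ∧ ψ p.1 = p.2 ∧
        ∀ᶠ q in 𝓝 p, f q = f p ↔ ψ q.1 = q.2 := fun p hi hp =>
    ⟨hp.implicitFunction hne hi, hp.contDiffAt_implicitFunction hne hi,
      hp.implicitFunction_apply_self hne hi, hp.eventually_apply_eq_iff_implicitFunction hne hi⟩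
  have hinv : (_root_.fderiv ℝ f (a, b) ∘L .inr ℝ E F).IsInvertible :=
    ContinuousLinearMap.isInvertible_of_injective hdim _ fun y hy => hinj y (by simpa using hy)
  obtain ⟨ψ, hψ, hψa, hψf⟩ := key (a, b) hinv hf.contDiffAt
  simp only at hψ hψa
  have hcont : ContinuousAt (fun p => _root_.fderiv ℝ f p ∘L .inr ℝ E F) (a, b) := by
    exact hf.fderiv.continuousAt.clm_comp continuousAt_const
  have hnear : ∀ᶠ p in 𝓝 (a, b), (_root_.fderiv ℝ f p ∘L .inr ℝ E F).IsInvertible := by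
    obtain ⟨e, he⟩ := hinv
    have := e.nhds
    rw [he] at this
    exact hcont.eventually this
  have hgraph : Tendsto (fun x => (x, ψ x)) (𝓝 a) (𝓝 (a, b)) := by
    have := continuousAt_id.prodMk hψ.continuousAt
    simpa [ContinuousAt, hψa] using this
  refine ⟨ψ, ?_, hψa, hψf.mono fun p hp => hp.trans eq_comm⟩
  have hdiff : ∀ᶠ x in 𝓝 a, ContinuousAt ψ x :=
    ((hψ.of_le (m := 1) (by simp)).eventually (by simp)).mono fun x hx => hx.continuousAt
  filter_upwards [hgraph.eventually hnear, hgraph.eventually hf,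
    hgraph.eventually (eventually_eventually_nhds.2 hψf), hdiff] with x hx₁ hx₂ hx₃ hx₄
  obtain ⟨ψ', hψ', -, hψf'⟩ := key _ hx₁ hx₂
  have hfx : f (x, ψ x) = f (a, b) := (hx₃.self_of_nhds).2 rfl
  refine hψ'.congr_of_eventuallyEq ?_
  have ht : Tendsto (fun y => (y, ψ y)) (𝓝 x) (𝓝 (x, ψ x)) := continuousAt_id.prodMk hx₄
  filter_upwards [ht.eventually hx₃, ht.eventually hψf'] with y h₁ h₂
  exact (h₂.1 ((h₁.2 rfl).trans hfx.symm)).symm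

/-- The inverse function theorem for smooth germs. -/
theorem SmoothNear.exists_inverse [FiniteDimensional ℝ E] [FiniteDimensional ℝ F]
    (hdim : Module.finrank ℝ E = Module.finrank ℝ F) {f : E → F} {a : E} (hf : SmoothNear f a)
    (hinj : ∀ x, _root_.fderiv ℝ f a x = 0 → x = 0) :
    ∃ g : F → E, SmoothNear g (f a) ∧ g (f a) = a ∧ (∀ᶠ x in 𝓝 a, g (f x) = x) ∧
      ∀ᶠ y in 𝓝 (f a), f (g y) = y := by
  have hF : SmoothNear (fun p : F × E => f p.2 - p.1) (f a, a) :=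
    (SmoothNear.comp (f a, a) (f := Prod.snd) hf (contDiff_snd.smoothNear _)).sub
      (contDiff_fst.smoothNear _)
  have hd : HasFDerivAt (fun p : F × E => f p.2 - p.1)
      (_root_.fderiv ℝ f a ∘L .snd ℝ F E - .fst ℝ F E) (f a, a) :=
    (HasFDerivAt.comp (f a, a) hf.differentiableAt.hasFDerivAt hasFDerivAt_snd).sub hasFDerivAt_fst
  obtain ⟨g, hg, hga, hgf⟩ := hF.exists_implicit hdim (fun x hx => hinj x (by
    rw [hd.fderiv] at hx; simpa using hx))
  refine ⟨g, hg, hga, ?_, ?_⟩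
  · have ht : Tendsto (fun x => (f x, x)) (𝓝 a) (𝓝 (f a, a)) :=
      hf.continuousAt.prodMk continuousAt_id
    filter_upwards [ht.eventually hgf] with x hx
    exact (hx.1 (by simp)).symm
  · have ht : Tendsto (fun y => (y, g y)) (𝓝 (f a)) (𝓝 (f a, a)) := by
      have := continuousAt_id.prodMk hg.continuousAt
      simpa [ContinuousAt, hga] using this
    filter_upwards [ht.eventually hgf] with y hy
    have := hy.2 rfl
    simpa [sub_eq_zero] using this

end SmoothGerms

/-! ### Integrals with parameters, orders of vanishing, Taylor expansions -/

/-- The integral is the value at 0 of the convolution of the indicator of (-1, 1] with y ↦ χ(y) F(p,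
-y), and convolutions depend smoothly on parameters. The bump χ supplies the compact support and
equals 1 on [-1, 1], so it does not alter the integral. -/
theorem contDiff_intervalIntegral_param {E : Type*} [NormedAddCommGroup E] [NormedSpace ℝ E]
    {F : E × ℝ → ℝ} (hF : ContDiff ℝ ∞ F) :
    ContDiff ℝ ∞ fun p => ∫ s in (-1 : ℝ)..1, F (p, s) := by
  let χ : ContDiffBump (0 : ℝ) := ⟨1, 2, by norm_num, by norm_num⟩
  let g : E → ℝ → ℝ := fun p y => χ y * F (p, -y)
  let w : ℝ → ℝ := Set.indicator (Ioc (-1) 1) 1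
  have hw : MeasureTheory.LocallyIntegrable w := by
    refine MeasureTheory.Integrable.locallyIntegrable ?_
    refine MeasureTheory.IntegrableOn.integrable_indicator ?_ measurableSet_Ioc
    exact MeasureTheory.integrableOn_const (by simp)
  have hg : ContDiffOn ℝ ∞ (Function.uncurry g) (univ ×ˢ univ) := by
    have h₁ : ContDiff ℝ ∞ fun q : E × ℝ => χ q.2 := χ.contDiff.comp contDiff_snd
    have h₂ : ContDiff ℝ ∞ fun q : E × ℝ => F (q.1, -q.2) :=
      hF.comp (contDiff_fst.prodMk contDiff_snd.neg)
    exact (h₁.mul h₂).contDiffOn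
  have hsupp : ∀ p : E, ∀ x : ℝ, p ∈ (univ : Set E) → x ∉ Metric.closedBall (0 : ℝ) 2 →
      g p x = 0 := by
    intro p x _ hx
    have : χ x = 0 := χ.zero_of_le_dist (by
      simp only [Metric.mem_closedBall, not_le] at hx
      exact hx.le)
    simp [g, this]
  have hconv := MeasureTheory.contDiffOn_convolution_right_with_param (μ := MeasureTheory.volume)
    (ContinuousLinearMap.mul ℝ ℝ) isOpen_univ (isCompact_closedBall (0 : ℝ) 2) hsupp hw hg
  rw [univ_prod_univ, contDiffOn_univ] at hconv
  have hcomp := hconv.comp (contDiff_id.prodMk (contDiff_const (c := (0 : ℝ))) :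
    ContDiff ℝ ∞ fun p : E => (p, (0 : ℝ)))
  convert hcomp using 1
  ext p
  simp only [Function.comp, MeasureTheory.convolution, ContinuousLinearMap.mul_apply']
  rw [intervalIntegral.integral_of_le (by norm_num), ← MeasureTheory.integral_indicator
    measurableSet_Ioc]
  congr 1
  ext t
  by_cases ht : t ∈ Ioc (-1 : ℝ) 1
  · have hχ : χ (-t) = 1 := χ.one_of_mem_closedBall (by
      simp only [Metric.mem_closedBall, dist_zero_right, norm_neg, Real.norm_eq_abs]
      exact abs_le.2 ⟨ht.1.le, ht.2⟩)
    simp [w, g, ht, hχ]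
  · simp [w, ht]

/-- Mean value inequality on the closed ball of radius ‖x‖, where the derivative is bounded by
c‖x‖ⁿ. -/
theorem isLittleO_pow_succ_of_fderiv {E F : Type*} [NormedAddCommGroup E] [NormedSpace ℝ E]
    [NormedAddCommGroup F] [NormedSpace ℝ F] {f : E → F} {n : ℕ}
    (hd : ∀ᶠ x in 𝓝 0, DifferentiableAt ℝ f x) (h0 : f 0 = 0)
    (h : fderiv ℝ f =o[𝓝 0] fun x => ‖x‖ ^ n) : f =o[𝓝 0] fun x => ‖x‖ ^ (n + 1) := by
  rw [isLittleO_iff] at h ⊢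
  intro c hc
  obtain ⟨δ, hδ, hball⟩ := Metric.eventually_nhds_iff_ball.1 (hd.and (h hc))
  filter_upwards [Metric.ball_mem_nhds 0 hδ] with x hx
  have hsub : ∀ y ∈ Metric.closedBall (0 : E) ‖x‖, y ∈ Metric.ball (0 : E) δ := by
    intro y hy
    simp only [Metric.mem_ball, Metric.mem_closedBall, dist_zero_right] at *
    linarith
  have hb : ∀ y ∈ Metric.closedBall (0 : E) ‖x‖, ‖fderiv ℝ f y‖ ≤ c * ‖x‖ ^ n := by
    intro y hy
    refine (hball y (hsub y hy)).2.trans ?_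
    rw [norm_pow, norm_norm]
    have : ‖y‖ ≤ ‖x‖ := by simpa using hy
    gcongr
  have := (convex_closedBall (0 : E) ‖x‖).norm_image_sub_le_of_norm_fderiv_le
    (fun y hy => (hball y (hsub y hy)).1) hb (x := 0) (y := x) (by simp) (by simp)
  rw [h0, sub_zero, sub_zero] at this
  rw [norm_pow, norm_norm, pow_succ, ← mul_assoc]
  exact this

theorem isLittleO_pow_succ_of_deriv {F : Type*} [NormedAddCommGroup F] [NormedSpace ℝ F]
    {f : ℝ → F} {n : ℕ} (hd : ∀ᶠ x in 𝓝 0, DifferentiableAt ℝ f x) (h0 : f 0 = 0)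
    (h : deriv f =o[𝓝 0] fun x => x ^ n) : f =o[𝓝 0] fun x => x ^ (n + 1) := by
  have h' : fderiv ℝ f =o[𝓝 0] fun x : ℝ => ‖x‖ ^ n := by
    rw [← isLittleO_norm_left] at h ⊢
    simp_rw [← norm_deriv_eq_norm_fderiv, ← norm_pow]
    exact h.norm_right
  have := isLittleO_pow_succ_of_fderiv hd h0 h'
  simp_rw [← norm_pow] at this
  exact this.of_norm_right

/-- Induction on n through the derivative. The target space is quantified inside because it changes
to the space of linear maps at each step. -/
theorem isLittleO_of_iteratedFDeriv_eq_zero {E : Type} [NormedAddCommGroup E] [NormedSpace ℝ E]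
    (n : ℕ) : ∀ {F : Type} [NormedAddCommGroup F] [NormedSpace ℝ F] {f : E → F},
    ContDiff ℝ ∞ f → (∀ k ≤ n, iteratedFDeriv ℝ k f 0 = 0) →
    f =o[𝓝 0] fun x => ‖x‖ ^ n := by
  induction n with
  | zero =>
    intro F _ _ f hf h
    have h0 : f 0 = 0 := by
      have := h 0 le_rfl
      rw [← norm_eq_zero, norm_iteratedFDeriv_zero] at this
      exact norm_eq_zero.1 this
    simp only [pow_zero]
    rw [isLittleO_one_iff]
    simpa [h0] using hf.continuous.tendsto 0
  | succ n ih =>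
    intro F _ _ f hf h
    have h0 : f 0 = 0 := by
      have := h 0 (Nat.zero_le _)
      rw [← norm_eq_zero, norm_iteratedFDeriv_zero] at this
      exact norm_eq_zero.1 this
    refine isLittleO_pow_succ_of_fderiv (Eventually.of_forall fun x =>
      (hf.differentiable (by simp)) x) h0 (ih (hf.fderiv_right (by simp)) fun k hk => ?_)
    rw [← norm_eq_zero, norm_iteratedFDeriv_fderiv, h (k + 1) (by omega), norm_zero]

theorem SmoothNear.eventually_differentiableAt {E F : Type*} [NormedAddCommGroup E]
    [NormedSpace ℝ E] [NormedAddCommGroup F] [NormedSpace ℝ F] {f : E → F} {a : E}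
    (hf : SmoothNear f a) : ∀ᶠ p in 𝓝 a, DifferentiableAt ℝ f p :=
  hf.mono fun _ hp => hp.differentiableAt (by simp)

theorem SmoothNear.taylor_one {f : ℝ → ℝ} (hf : SmoothNear f 0) :
    (fun t => f t - f 0 - t * deriv f 0) =o[𝓝 0] fun t => t := by
  have := hasDerivAt_iff_isLittleO.1 hf.differentiableAt.hasDerivAt
  simpa using this

theorem SmoothNear.taylor_two {f : ℝ → ℝ} (hf : SmoothNear f 0) :
    (fun t => f t - f 0 - t * deriv f 0 - t ^ 2 / 2 * deriv (deriv f) 0) =o[𝓝 0]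
      fun t => t ^ 2 := by
  have hd : ∀ᶠ t in 𝓝 0, HasDerivAt
      (fun t => f t - f 0 - t * deriv f 0 - t ^ 2 / 2 * deriv (deriv f) 0)
      (deriv f t - deriv f 0 - t * deriv (deriv f) 0) t := by
    filter_upwards [hf.eventually_differentiableAt] with t ht
    have h₁ := ((ht.hasDerivAt.sub_const (f 0)).sub ((hasDerivAt_id t).mul_const (deriv f 0))).sub
      ((((hasDerivAt_id t).pow 2).div_const 2).mul_const (deriv (deriv f) 0))
    refine h₁.congr_deriv ?_
    simp
  refine isLittleO_pow_succ_of_deriv (n := 1) (hd.mono fun t ht => ht.differentiableAt)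
    (by simp) ?_
  simp only [pow_one]
  exact hf.deriv.taylor_one.congr' (hd.mono fun t ht => ht.deriv.symm) EventuallyEq.rfl

theorem SmoothNear.taylor_three {f : ℝ → ℝ} (hf : SmoothNear f 0) :
    (fun t => f t - f 0 - t * deriv f 0 - t ^ 2 / 2 * deriv (deriv f) 0
      - t ^ 3 / 6 * deriv (deriv (deriv f)) 0) =o[𝓝 0] fun t => t ^ 3 := by
  have hd : ∀ᶠ t in 𝓝 0, HasDerivAt
      (fun t => f t - f 0 - t * deriv f 0 - t ^ 2 / 2 * deriv (deriv f) 0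
        - t ^ 3 / 6 * deriv (deriv (deriv f)) 0)
      (deriv f t - deriv f 0 - t * deriv (deriv f) 0 - t ^ 2 / 2 * deriv (deriv (deriv f)) 0)
      t := by
    filter_upwards [hf.eventually_differentiableAt] with t ht
    have h₁ := (((ht.hasDerivAt.sub_const (f 0)).sub
      ((hasDerivAt_id t).mul_const (deriv f 0))).sub
      ((((hasDerivAt_id t).pow 2).div_const 2).mul_const (deriv (deriv f) 0))).sub
      ((((hasDerivAt_id t).pow 3).div_const 6).mul_const (deriv (deriv (deriv f)) 0))
    refine h₁.congr_deriv ?_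
    simp only [id_eq, Nat.cast_ofNat]
    ring
  refine isLittleO_pow_succ_of_deriv (n := 2) (hd.mono fun t ht => ht.differentiableAt)
    (by simp) ?_
  exact hf.deriv.taylor_two.congr' (hd.mono fun t ht => ht.deriv.symm) EventuallyEq.rfl

theorem eq_zero_of_isLittleO_self {a : ℝ} {f : ℝ → ℝ} {l : Filter ℝ} [l.NeBot]
    (hf : ∀ᶠ t in l, f t ≠ 0) (h : (fun t => a * f t) =o[l] f) : a = 0 := by
  by_contra ha
  have h' : f =o[l] f := by simpa [ha] using h.const_mul_left a⁻¹
  obtain ⟨t, h₁, h₂⟩ := (hf.and ((isLittleO_iff.1 h') (c := 1 / 2) (by norm_num))).exists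
  have := norm_pos_iff.2 h₁
  linarith

theorem quadratic_coeff_eq_zero {a b c : ℝ}
    (h : (fun t : ℝ => a + b * t + c * t ^ 2) =o[𝓝 0] fun t => t ^ 2) :
    a = 0 ∧ b = 0 ∧ c = 0 := by
  have hne : ∀ n : ℕ, ∀ᶠ t in 𝓝[≠] (0 : ℝ), t ^ n ≠ 0 := fun n => by
    filter_upwards [self_mem_nhdsWithin] with t ht using pow_ne_zero _ ht
  have ha : a = 0 := by
    have : Tendsto (fun t : ℝ => a + b * t + c * t ^ 2) (𝓝 0) (𝓝 0) :=
      h.trans_tendsto (by simpa using (continuous_pow 2).tendsto (0 : ℝ))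
    have h' : Tendsto (fun t : ℝ => a + b * t + c * t ^ 2) (𝓝 0) (𝓝 a) := by
      have : Continuous fun t : ℝ => a + b * t + c * t ^ 2 := by fun_prop
      simpa using this.tendsto 0
    exact tendsto_nhds_unique h' this
  have h21 : (fun t : ℝ => t ^ 2) =o[𝓝 0] fun t => t := by
    simpa using isLittleO_pow_pow (𝕜 := ℝ) (m := 1) (n := 2) (by norm_num)
  have hb : b = 0 := by
    have h₁ : (fun t : ℝ => b * t) =o[𝓝 0] fun t => t := by
      have := (h.trans h21).sub (h21.const_mul_left c)
      simpa [ha] using this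
    exact eq_zero_of_isLittleO_self (l := 𝓝[≠] 0) (by simpa using hne 1)
      (h₁.mono nhdsWithin_le_nhds)
  refine ⟨ha, hb, ?_⟩
  subst ha hb
  exact eq_zero_of_isLittleO_self (l := 𝓝[≠] 0) (hne 2)
    ((by simpa using h : _ =o[𝓝 (0 : ℝ)] _).mono nhdsWithin_le_nhds)

/-- Subtracting the Taylor expansion leaves a quadratic polynomial that is o(t²), hence zero. In
this way derivatives at 0 are read off from asymptotics, without differentiating implicit functions.
-/
theorem SmoothNear.derivs_of_isLittleO {f : ℝ → ℝ} (hf : SmoothNear f 0) {c : ℝ}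
    (h : (fun t => f t - c * t ^ 2) =o[𝓝 0] fun t => t ^ 2) :
    f 0 = 0 ∧ deriv f 0 = 0 ∧ deriv (deriv f) 0 = 2 * c := by
  have := h.sub hf.taylor_two
  obtain ⟨h₁, h₂, h₃⟩ := quadratic_coeff_eq_zero (a := f 0) (b := deriv f 0)
    (c := deriv (deriv f) 0 / 2 - c) (this.congr_left fun t => by ring)
  exact ⟨h₁, h₂, by linarith⟩

/-! ### Partial derivatives and flat functions in the plane -/

/-- The partial derivative in the first coordinate. -/
noncomputable def partialX (h : Plane → ℝ) : Plane → ℝ := fun p => fderiv ℝ h p (1, 0)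

/-- The partial derivative in the second coordinate. -/
noncomputable def partialY (h : Plane → ℝ) : Plane → ℝ := fun p => fderiv ℝ h p (0, 1)

theorem fderiv_apply_eq_partial (h : Plane → ℝ) (p w : Plane) :
    fderiv ℝ h p w = w.1 * partialX h p + w.2 * partialY h p := by
  have : w = w.1 • ((1, 0) : Plane) + w.2 • ((0, 1) : Plane) := by ext <;> simp
  conv_lhs => rw [this]
  simp only [map_add, map_smul, partialX, partialY, smul_eq_mul]

protected theorem ContDiff.partialX {h : Plane → ℝ} (hh : ContDiff ℝ ∞ h) : ContDiff ℝ ∞ (partialX h) :=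
  (hh.fderiv_right (by simp)).clm_apply contDiff_const

protected theorem ContDiff.partialY {h : Plane → ℝ} (hh : ContDiff ℝ ∞ h) : ContDiff ℝ ∞ (partialY h) :=
  (hh.fderiv_right (by simp)).clm_apply contDiff_const

theorem partialX_partialY_comm {h : Plane → ℝ} (hh : ContDiff ℝ ∞ h) :
    partialX (partialY h) = partialY (partialX h) := by
  have hd : Differentiable ℝ (fderiv ℝ h) := (hh.fderiv_right (m := ∞) (by simp)).differentiable (by simp)
  have key : ∀ (p v w : Plane),
      fderiv ℝ (fun q => fderiv ℝ h q v) p w = fderiv ℝ (fderiv ℝ h) p w v := by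
    intro p v w
    have := ((hd p).hasFDerivAt.clm_apply (hasFDerivAt_const v p)).fderiv
    rw [this]
    simp
  ext p
  have hs : IsSymmSndFDerivAt ℝ h p := (hh.contDiffAt (x := p)).isSymmSndFDerivAt
    (by simpa using (WithTop.coe_le_coe.2 le_top : ((2 : ℕ∞) : WithTop ℕ∞) ≤ _))
  change fderiv ℝ (fun q => fderiv ℝ h q (0, 1)) p (1, 0) =
    fderiv ℝ (fun q => fderiv ℝ h q (1, 0)) p (0, 1)
  rw [key, key]
  exact hs _ _

theorem partialX_eq {h : Plane → ℝ} {p : Plane} {d : ℝ} (hh : DifferentiableAt ℝ h p)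
    (hd : HasDerivAt (fun x => h (x, p.2)) d p.1) : partialX h p = d := by
  have h₁ : HasDerivAt (fun x : ℝ => ((x, p.2) : Plane)) (1, 0) p.1 :=
    (hasDerivAt_id p.1).prodMk (hasDerivAt_const p.1 p.2)
  exact (hh.hasFDerivAt.comp_hasDerivAt (f := fun x : ℝ => (x, p.2)) p.1 h₁).unique hd

theorem partialY_eq {h : Plane → ℝ} {p : Plane} {d : ℝ} (hh : DifferentiableAt ℝ h p)
    (hd : HasDerivAt (fun y => h (p.1, y)) d p.2) : partialY h p = d := by
  have h₁ : HasDerivAt (fun y : ℝ => ((p.1, y) : Plane)) (0, 1) p.2 :=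
    (hasDerivAt_const p.2 p.1).prodMk (hasDerivAt_id p.2)
  exact (hh.hasFDerivAt.comp_hasDerivAt (f := fun y : ℝ => (p.1, y)) p.2 h₁).unique hd

theorem hasDerivAt_partialX {h : Plane → ℝ} {p : Plane} (hh : DifferentiableAt ℝ h p) :
    HasDerivAt (fun x => h (x, p.2)) (partialX h p) p.1 := by
  have h₁ : HasDerivAt (fun x : ℝ => ((x, p.2) : Plane)) (1, 0) p.1 :=
    (hasDerivAt_id p.1).prodMk (hasDerivAt_const p.1 p.2)
  exact hh.hasFDerivAt.comp_hasDerivAt (f := fun x : ℝ => (x, p.2)) p.1 h₁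

theorem hasDerivAt_partialY {h : Plane → ℝ} {p : Plane} (hh : DifferentiableAt ℝ h p) :
    HasDerivAt (fun y => h (p.1, y)) (partialY h p) p.2 := by
  have h₁ : HasDerivAt (fun y : ℝ => ((p.1, y) : Plane)) (0, 1) p.2 :=
    (hasDerivAt_const p.2 p.1).prodMk (hasDerivAt_id p.2)
  exact hh.hasFDerivAt.comp_hasDerivAt (f := fun y : ℝ => (p.1, y)) p.2 h₁

/-- A smooth function whose Taylor polynomial of degree `n` at the origin is zero. -/
structure IsFlat (n : ℕ) (h : Plane → ℝ) : Prop where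
  contDiff : ContDiff ℝ ∞ h
  jet : ∀ k ≤ n, iteratedFDeriv ℝ k h 0 = 0

theorem IsFlat.isLittleO {n : ℕ} {h : Plane → ℝ} (hh : IsFlat n h) :
    h =o[𝓝 0] fun p => ‖p‖ ^ n :=
  isLittleO_of_iteratedFDeriv_eq_zero n hh.contDiff hh.jet

theorem IsFlat.fderiv_apply {n : ℕ} {h : Plane → ℝ} (hh : IsFlat (n + 1) h) (v : Plane) :
    IsFlat n fun p => fderiv ℝ h p v := by
  have hc : ContDiff ℝ ∞ (fderiv ℝ h) := hh.contDiff.fderiv_right (by simp)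
  refine ⟨hc.clm_apply contDiff_const, fun k hk => ?_⟩
  have h₁ : iteratedFDeriv ℝ k (fderiv ℝ h) 0 = 0 := by
    rw [← norm_eq_zero, norm_iteratedFDeriv_fderiv, hh.jet (k + 1) (by omega), norm_zero]
  have h₂ := (ContinuousLinearMap.apply ℝ ℝ v).iteratedFDeriv_comp_left
    (hc.contDiffAt (x := 0)) (i := k) (by exact_mod_cast le_top)
  have h₃ : (fun p => fderiv ℝ h p v) = (ContinuousLinearMap.apply ℝ ℝ v) ∘ fderiv ℝ h := rfl
  rw [h₃, h₂, h₁]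
  ext
  simp

protected theorem IsFlat.partialX {n : ℕ} {h : Plane → ℝ} (hh : IsFlat (n + 1) h) :
    IsFlat n (partialX h) := hh.fderiv_apply _

protected theorem IsFlat.partialY {n : ℕ} {h : Plane → ℝ} (hh : IsFlat (n + 1) h) :
    IsFlat n (partialY h) := hh.fderiv_apply _

theorem IsFlat.apply_zero {n : ℕ} {h : Plane → ℝ} (hh : IsFlat n h) : h 0 = 0 := by
  have := hh.jet 0 (Nat.zero_le _)
  rw [← norm_eq_zero, norm_iteratedFDeriv_zero] at this
  exact norm_eq_zero.1 this

theorem IsFlat.fderiv_zero {n : ℕ} {h : Plane → ℝ} (hh : IsFlat (n + 1) h) :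
    fderiv ℝ h 0 = 0 := by
  refine ContinuousLinearMap.ext fun v => ?_
  exact (hh.fderiv_apply v).apply_zero

/-! ### Derivatives of the normal form -/

/-- Platonova's normal form of a surface at a godron. -/
noncomputable def platonova (lam : ℝ) (φ : Plane → ℝ) : Plane → ℝ :=
  fun p => p.2 ^ 2 / 2 - p.1 ^ 2 * p.2 + lam * p.1 ^ 4 + φ p

section Platonova

variable {lam : ℝ} {φ : Plane → ℝ}

theorem contDiff_platonova (hφ : IsFlat 4 φ) : ContDiff ℝ ∞ (platonova lam φ) := by
  have := hφ.contDiff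
  unfold platonova
  fun_prop

theorem partialX_add_eq {f h k : Plane → ℝ} {d : Plane → ℝ} (hk : ContDiff ℝ ∞ k)
    (hh : ContDiff ℝ ∞ h) (hf : ∀ p, f p = h p + k p)
    (hd : ∀ p : Plane, HasDerivAt (fun x => h (x, p.2)) (d p) p.1) :
    partialX f = fun p => d p + partialX k p := by
  ext p
  obtain rfl : f = fun p => h p + k p := funext hf
  have hk' := (hk.differentiable (by simp)) p
  exact partialX_eq (((hh.differentiable (by simp)) p).add hk')
    ((hd p).add (hasDerivAt_partialX hk'))

theorem partialY_add_eq {f h k : Plane → ℝ} {d : Plane → ℝ} (hk : ContDiff ℝ ∞ k)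
    (hh : ContDiff ℝ ∞ h) (hf : ∀ p, f p = h p + k p)
    (hd : ∀ p : Plane, HasDerivAt (fun y => h (p.1, y)) (d p) p.2) :
    partialY f = fun p => d p + partialY k p := by
  ext p
  obtain rfl : f = fun p => h p + k p := funext hf
  have hk' := (hk.differentiable (by simp)) p
  exact partialY_eq (((hh.differentiable (by simp)) p).add hk')
    ((hd p).add (hasDerivAt_partialY hk'))

theorem partialX_platonova (hφ : IsFlat 4 φ) : partialX (platonova lam φ) =
    fun p => (-2 * p.1 * p.2 + 4 * lam * p.1 ^ 3) + partialX φ p := by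
  refine partialX_add_eq (h := fun p => p.2 ^ 2 / 2 - p.1 ^ 2 * p.2 + lam * p.1 ^ 4)
    hφ.contDiff (by fun_prop) (fun p => rfl) fun p => ?_
  refine (((((hasDerivAt_id p.1).pow 2).mul_const p.2).const_sub (p.2 ^ 2 / 2)).add
    (((hasDerivAt_id p.1).pow 4).const_mul lam)).congr_deriv ?_
  simp only [id_eq, Nat.cast_ofNat]
  ring

theorem partialY_platonova (hφ : IsFlat 4 φ) : partialY (platonova lam φ) =
    fun p => (p.2 - p.1 ^ 2) + partialY φ p := by
  refine partialY_add_eq (h := fun p => p.2 ^ 2 / 2 - p.1 ^ 2 * p.2 + lam * p.1 ^ 4)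
    hφ.contDiff (by fun_prop) (fun p => rfl) fun p => ?_
  refine (((((hasDerivAt_id p.2).pow 2).div_const 2).sub
    ((hasDerivAt_id p.2).const_mul (p.1 ^ 2))).add_const (lam * p.1 ^ 4)).congr_deriv ?_
  simp only [id_eq, Nat.cast_ofNat]
  ring

theorem partialXX_platonova (hφ : IsFlat 4 φ) : partialX (partialX (platonova lam φ)) =
    fun p => (-2 * p.2 + 12 * lam * p.1 ^ 2) + partialX (partialX φ) p := by
  rw [partialX_platonova hφ]
  refine partialX_add_eq (h := fun p => -2 * p.1 * p.2 + 4 * lam * p.1 ^ 3)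
    hφ.contDiff.partialX (by fun_prop) (fun p => rfl) fun p => ?_
  refine ((((hasDerivAt_id p.1).const_mul (-2)).mul_const p.2).add
    (((hasDerivAt_id p.1).pow 3).const_mul (4 * lam))).congr_deriv ?_
  simp only [id_eq, Nat.cast_ofNat]
  ring

theorem partialXY_platonova (hφ : IsFlat 4 φ) : partialY (partialX (platonova lam φ)) =
    fun p => -2 * p.1 + partialY (partialX φ) p := by
  rw [partialX_platonova hφ]
  refine partialY_add_eq (h := fun p => -2 * p.1 * p.2 + 4 * lam * p.1 ^ 3)
    hφ.contDiff.partialX (by fun_prop) (fun p => rfl) fun p => ?_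
  refine (((hasDerivAt_id p.2).const_mul (-2 * p.1)).add_const (4 * lam * p.1 ^ 3)).congr_deriv ?_
  ring

theorem partialYY_platonova (hφ : IsFlat 4 φ) : partialY (partialY (platonova lam φ)) =
    fun p => 1 + partialY (partialY φ) p := by
  rw [partialY_platonova hφ]
  exact partialY_add_eq (h := fun p => p.2 - p.1 ^ 2)
    hφ.contDiff.partialY (by fun_prop) (fun p => rfl) fun p =>
    (hasDerivAt_id p.2).sub_const (p.1 ^ 2)

theorem partialXXX_platonova (hφ : IsFlat 4 φ) :
    partialX (partialX (partialX (platonova lam φ))) =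
    fun p => 24 * lam * p.1 + partialX (partialX (partialX φ)) p := by
  rw [partialXX_platonova hφ]
  refine partialX_add_eq (h := fun p => -2 * p.2 + 12 * lam * p.1 ^ 2)
    hφ.contDiff.partialX.partialX (by fun_prop) (fun p => rfl) fun p => ?_
  refine ((((hasDerivAt_id p.1).pow 2).const_mul (12 * lam)).const_add (-2 * p.2)).congr_deriv ?_
  simp only [id_eq, Nat.cast_ofNat]
  ring

theorem partialXXY_platonova (hφ : IsFlat 4 φ) :
    partialY (partialX (partialX (platonova lam φ))) =
    fun p => -2 + partialY (partialX (partialX φ)) p := by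
  rw [partialXX_platonova hφ]
  refine partialY_add_eq (h := fun p => -2 * p.2 + 12 * lam * p.1 ^ 2)
    hφ.contDiff.partialX.partialX (by fun_prop) (fun p => rfl) fun p => ?_
  refine (((hasDerivAt_id p.2).const_mul (-2)).add_const (12 * lam * p.1 ^ 2)).congr_deriv ?_
  ring

theorem partialXYY_platonova (hφ : IsFlat 4 φ) :
    partialY (partialY (partialX (platonova lam φ))) = partialY (partialY (partialX φ)) := by
  rw [partialXY_platonova hφ]
  have := partialY_add_eq (f := fun p => -2 * p.1 + partialY (partialX φ) p)
    (h := fun p => -2 * p.1) (d := fun _ => 0)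
    hφ.contDiff.partialX.partialY (by fun_prop) (fun p => rfl) fun p => hasDerivAt_const p.2 (-2 * p.1)
  simpa using this

theorem partialYYY_platonova (hφ : IsFlat 4 φ) :
    partialY (partialY (partialY (platonova lam φ))) = partialY (partialY (partialY φ)) := by
  rw [partialYY_platonova hφ]
  have := partialY_add_eq (f := fun p => 1 + partialY (partialY φ) p)
    (h := fun _ => 1) (d := fun _ => 0)
    hφ.contDiff.partialY.partialY (by fun_prop) (fun p => rfl) fun p => hasDerivAt_const p.2 _
  simpa using this

end Platonova

/-! ### Parabolic and flecnodal curves of the normal form -/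

/-- Near the origin, `C` is the graph of a smooth function with `2`-jet `s x²`. -/
def IsParabolaGerm (C : Set Plane) (s : ℝ) : Prop :=
  ∃ h : ℝ → ℝ, SmoothNear h 0 ∧ ((fun x => h x - s * x ^ 2) =o[𝓝 0] fun x => x ^ 2) ∧
    ∀ᶠ p in 𝓝 (0 : Plane), p ∈ C ↔ p.2 = h p.1

theorem SmoothNear.isBigO_id {F : Type*} [NormedAddCommGroup F] [NormedSpace ℝ F] {f : ℝ → F}
    (hf : SmoothNear f 0) (h0 : f 0 = 0) : f =O[𝓝 0] fun x : ℝ => x := by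
  have := hf.differentiableAt.isBigO_sub
  simpa [h0] using this

theorem IsFlat.comp_isLittleO {n : ℕ} {ψ : Plane → ℝ} (hψ : IsFlat n ψ) {c : ℝ → Plane}
    (hc : c =O[𝓝 0] fun x : ℝ => x) : (fun x => ψ (c x)) =o[𝓝 0] fun x => x ^ n := by
  have ht : Tendsto c (𝓝 0) (𝓝 0) := hc.trans_tendsto tendsto_id
  exact (hψ.isLittleO.comp_tendsto ht).trans_isBigO (hc.norm_left.pow n)

theorem isBigO_one_of_pow {f : ℝ → ℝ} {n : ℕ} (hf : f =O[𝓝 0] fun x => x ^ n) :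
    f =O[𝓝 0] fun _ => (1 : ℝ) :=
  hf.trans (((continuous_pow n).tendsto (0 : ℝ)).isBigO_one ℝ)

theorem IsFlat.hasDerivAt_line {n : ℕ} {h : Plane → ℝ} (hh : IsFlat (n + 1) h) (w : Plane) :
    HasDerivAt (fun t : ℝ => h (t • w)) 0 0 := by
  have h₁ : HasDerivAt (fun t : ℝ => t • w) w 0 := by
    simpa using (hasDerivAt_id (0 : ℝ)).smul_const w
  have h₂ : HasFDerivAt h (0 : Plane →L[ℝ] ℝ) ((0 : ℝ) • w) := by
    rw [zero_smul, ← hh.fderiv_zero]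
    exact ((hh.contDiff.differentiable (by simp)) 0).hasFDerivAt
  exact h₂.comp_hasDerivAt (0 : ℝ) h₁

theorem SmoothNear.fderiv_eq_of_line {E F : Type*} [NormedAddCommGroup E] [NormedSpace ℝ E]
    [NormedAddCommGroup F] [NormedSpace ℝ F] {f : E → F} (hf : SmoothNear f 0) {w : E} {d : F}
    (hd : HasDerivAt (fun t : ℝ => f (t • w)) d 0) : _root_.fderiv ℝ f 0 w = d := by
  have h₁ : HasDerivAt (fun t : ℝ => t • w) w 0 := by
    simpa using (hasDerivAt_id (0 : ℝ)).smul_const w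
  have h₂ : HasFDerivAt f (_root_.fderiv ℝ f 0) ((0 : ℝ) • w) := by
    rw [zero_smul]
    exact hf.differentiableAt.hasFDerivAt
  exact (h₂.comp_hasDerivAt (0 : ℝ) h₁).unique hd

/-- The determinant of the Hessian. -/
noncomputable def hessianDet (f : Plane → ℝ) : Plane → ℝ :=
  fun p => partialX (partialX f) p * partialY (partialY f) p - partialY (partialX f) p ^ 2

/-- The determinant has y-derivative -2 at the origin, so its zero set is a graph y = h(x) with h(x)
= O(x). Along it the second derivatives of φ are o(x²), and what remains is -2y + 12λx² - 4x² =
o(x²). -/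
theorem isParabolaGerm_hessianDet {lam : ℝ} {φ : Plane → ℝ} (hφ : IsFlat 4 φ) :
    IsParabolaGerm {p | hessianDet (platonova lam φ) p = 0} (6 * lam - 2) := by
  have hf := contDiff_platonova (lam := lam) hφ
  have hφxx : IsFlat 2 (partialX (partialX φ)) := hφ.partialX.partialX
  have hφxy : IsFlat 2 (partialY (partialX φ)) := hφ.partialX.partialY
  have hφyy : IsFlat 2 (partialY (partialY φ)) := hφ.partialY.partialY
  have hK : SmoothNear (hessianDet (platonova lam φ)) 0 :=
    ((hf.partialX.partialX.mul hf.partialY.partialY).sub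
      (hf.partialX.partialY.pow 2)).smoothNear 0
  have hKeq : ∀ p, hessianDet (platonova lam φ) p =
      (-2 * p.2 + 12 * lam * p.1 ^ 2 + partialX (partialX φ) p) * (1 + partialY (partialY φ) p)
        - (-2 * p.1 + partialY (partialX φ) p) ^ 2 := fun p => by
    simp only [hessianDet, partialXX_platonova hφ, partialXY_platonova hφ, partialYY_platonova hφ]
  have hK0 : hessianDet (platonova lam φ) 0 = 0 := by
    simp [hKeq, hφxx.apply_zero, hφxy.apply_zero]
  obtain ⟨h, hh, hh0, hhK⟩ := SmoothNear.exists_implicit (E := ℝ) (F := ℝ) (a := 0) (b := 0) rfl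
    (f := hessianDet (platonova lam φ)) hK (fun y hy => by
      have h₁ : HasDerivAt (fun t : ℝ => hessianDet (platonova lam φ) (t • ((0, y) : Plane)))
          (-2 * y) 0 := by
        simp_rw [hKeq]
        have ht : HasDerivAt (fun t : ℝ => t * y) y 0 := by
          simpa using (hasDerivAt_id (0 : ℝ)).mul_const y
        have hxx := hφxx.hasDerivAt_line (0, y)
        have hxy := hφxy.hasDerivAt_line (0, y)
        have hyy := hφyy.hasDerivAt_line (0, y)
        refine HasDerivAt.congr_deriv ((((ht.const_mul (-2)).add_const (12 * lam * 0 ^ 2)).add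
          hxx |>.mul (hyy.const_add 1)).sub (((hasDerivAt_const (0 : ℝ) (-2 * 0 : ℝ)).add
          hxy).pow 2) |>.congr_of_eventuallyEq ?_) ?_
        · exact Eventually.of_forall fun t => by simp
        · simp [hφyy.apply_zero]
      have := hK.fderiv_eq_of_line h₁
      rw [show ((0, 0) : ℝ × ℝ) = 0 from rfl, this] at hy
      linarith)
  rw [show ((0, 0) : ℝ × ℝ) = 0 from rfl, hK0] at hhK
  refine ⟨h, hh, ?_, hhK⟩
  have hhO : h =O[𝓝 0] fun x : ℝ => x := hh.isBigO_id hh0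
  have hc : (fun x => ((x, h x) : Plane)) =O[𝓝 0] fun x : ℝ => x :=
    (isBigO_refl _ _).prod_left hhO
  have ht : Tendsto (fun x => ((x, h x) : Plane)) (𝓝 0) (𝓝 0) := hc.trans_tendsto tendsto_id
  have hxx := hφxx.comp_isLittleO hc
  have hxy := hφxy.comp_isLittleO hc
  have hyy := hφyy.comp_isLittleO hc
  have hb : ∀ {u v : ℝ → ℝ}, u =o[𝓝 0] (fun x => x ^ 2) → v =O[𝓝 0] (fun _ => (1 : ℝ)) →
      (fun x => u x * v x) =o[𝓝 0] fun x => x ^ 2 := fun hu hv => by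
    simpa using hu.mul_isBigO hv
  have hx1 : (fun x : ℝ => x) =O[𝓝 0] fun _ => (1 : ℝ) := tendsto_id.isBigO_one ℝ
  have hsum := (((((hb hyy (hhO.trans hx1)).const_mul_left (-2)).add
    ((hb hyy (isBigO_one_of_pow (isBigO_refl (fun x : ℝ => x ^ 2) _))).const_mul_left
      (12 * lam))).add (hxx.add (hb hxx (isBigO_one_of_pow hyy.isBigO)))).add
    ((hb hxy hx1).const_mul_left 4)).sub (hb hxy (isBigO_one_of_pow hxy.isBigO))
  -- `hsum` collects the terms of the expanded determinant that contain derivatives of φ; on the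
  -- curve they add up to 2(h(x) - (6λ - 2)x²).
  refine (hsum.const_mul_left (1 / 2)).congr' ?_ EventuallyEq.rfl
  filter_upwards [ht.eventually hhK] with x hx
  have := hx.2 rfl
  rw [hKeq] at this
  simp only at this
  linear_combination (1 / 2) * this

/-- The quadratic form of the second derivatives of `f` at `p`. -/
noncomputable def quadForm (f : Plane → ℝ) (p w : Plane) : ℝ :=
  w.1 ^ 2 * partialX (partialX f) p + 2 * w.1 * w.2 * partialY (partialX f) p
    + w.2 ^ 2 * partialY (partialY f) p

/-- The cubic form of the third derivatives of `f` at `p`. -/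
noncomputable def cubicForm (f : Plane → ℝ) (p w : Plane) : ℝ :=
  w.1 ^ 3 * partialX (partialX (partialX f)) p
    + 3 * w.1 ^ 2 * w.2 * partialY (partialX (partialX f)) p
    + 3 * w.1 * w.2 ^ 2 * partialY (partialY (partialX f)) p
    + w.2 ^ 3 * partialY (partialY (partialY f)) p

/-- At the origin the form is w₂², whose only null direction is the x-axis, and nearby forms have
null directions nearby. This brings every null direction into the region of small slopes where the
implicit function theorem gives uniqueness. -/
theorem eventually_abs_slope_lt {f : Plane → ℝ} (hf : ContDiff ℝ ∞ f)
    (hxx : partialX (partialX f) 0 = 0) (hxy : partialY (partialX f) 0 = 0)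
    (hyy : partialY (partialY f) 0 = 1) {δ : ℝ} (hδ : 0 < δ) :
    ∀ᶠ p in 𝓝 (0 : Plane), ∀ w, w ≠ 0 → quadForm f p w = 0 → w.1 ≠ 0 ∧ |w.2 / w.1| < δ := by
  have h₁ := hf.partialX.partialX.continuous.tendsto 0
  have h₂ := hf.partialX.partialY.continuous.tendsto 0
  have h₃ := hf.partialY.partialY.continuous.tendsto 0
  rw [hxx] at h₁
  rw [hxy] at h₂
  rw [hyy] at h₃
  -- For a slope m with |m| ≥ δ these bounds give |f_xx| < m²/8, |2m f_xy| ≤ m²/8 and m² f_yy ≥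
  -- m²/2, so the form cannot vanish.
  filter_upwards [h₁.eventually (Metric.ball_mem_nhds 0 (show 0 < δ ^ 2 / 8 by positivity)),
    h₂.eventually (Metric.ball_mem_nhds 0 (show 0 < δ / 16 by positivity)),
    h₃.eventually (lt_mem_nhds (show (1 / 2 : ℝ) < 1 by norm_num))] with p h₁ h₂ h₃ w hw hq
  simp only [Real.dist_eq, sub_zero] at h₁ h₂
  have hw1 : w.1 ≠ 0 := by
    intro h0
    have : w.2 ^ 2 * partialY (partialY f) p = 0 := by simpa [quadForm, h0] using hq
    have h2 : w.2 = 0 := by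
      rcases mul_eq_zero.1 this with h | h
      · exact pow_eq_zero_iff (two_ne_zero) |>.1 h
      · linarith
    exact hw (Prod.ext h0 h2)
  refine ⟨hw1, ?_⟩
  by_contra hm
  push Not at hm
  set m := w.2 / w.1 with hmdef
  have hqm : partialX (partialX f) p + 2 * m * partialY (partialX f) p
      + m ^ 2 * partialY (partialY f) p = 0 := by
    have : w.2 = m * w.1 := by rw [hmdef]; field_simp
    rw [quadForm, this] at hq
    have h' : w.1 ^ 2 * (partialX (partialX f) p + 2 * m * partialY (partialX f) p
      + m ^ 2 * partialY (partialY f) p) = 0 := by linear_combination hq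
    exact (mul_eq_zero.1 h').resolve_left (pow_ne_zero 2 hw1)
  have hm2 : m ^ 2 = |m| ^ 2 := (sq_abs m).symm
  have ha : |m * partialY (partialX f) p| ≤ |m| * (δ / 16) := by
    rw [abs_mul]
    gcongr
  have hb := neg_abs_le (m * partialY (partialX f) p)
  have hc := neg_abs_le (partialX (partialX f) p)
  have hδm : |m| * δ ≤ |m| ^ 2 := by rw [pow_two]; gcongr
  have hδ2 : δ ^ 2 ≤ |m| ^ 2 := by gcongr
  have hpos : 0 < δ ^ 2 := by positivity
  have hlow : |m| ^ 2 * (1 / 2) ≤ m ^ 2 * partialY (partialY f) p := by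
    rw [hm2]
    gcongr
  nlinarith

/-- With w = (1, m), the two forms are two equations for (y, m) as functions of x. Their Jacobian at
the origin is diagonal with entries -2 and -6, so the solution is a smooth curve. -/
theorem isParabolaGerm_flecnodal {lam : ℝ} {φ : Plane → ℝ} (hφ : IsFlat 4 φ) :
    IsParabolaGerm {p | ∃ w, w ≠ 0 ∧ quadForm (platonova lam φ) p w = 0 ∧
      cubicForm (platonova lam φ) p w = 0} (8 * lam ^ 2 - 2 * lam) := by
  set f := platonova lam φ with hfdef
  have hf : ContDiff ℝ ∞ f := contDiff_platonova (lam := lam) hφ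
  have hφxx : IsFlat 2 (partialX (partialX φ)) := hφ.partialX.partialX
  have hφxy : IsFlat 2 (partialY (partialX φ)) := hφ.partialX.partialY
  have hφyy : IsFlat 2 (partialY (partialY φ)) := hφ.partialY.partialY
  have hφxxx : IsFlat 1 (partialX (partialX (partialX φ))) := hφxx.partialX
  have hφxxy : IsFlat 1 (partialY (partialX (partialX φ))) := hφxx.partialY
  have hφxyy : IsFlat 1 (partialY (partialY (partialX φ))) := hφxy.partialY
  have hφyyy : IsFlat 1 (partialY (partialY (partialY φ))) := hφyy.partialY
  have hq : ∀ p w, quadForm f p w =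
      w.1 ^ 2 * (-2 * p.2 + 12 * lam * p.1 ^ 2 + partialX (partialX φ) p)
      + 2 * w.1 * w.2 * (-2 * p.1 + partialY (partialX φ) p)
      + w.2 ^ 2 * (1 + partialY (partialY φ) p) := fun p w => by
    simp only [quadForm, hfdef, partialXX_platonova hφ, partialXY_platonova hφ,
      partialYY_platonova hφ]
  have hcu : ∀ p w, cubicForm f p w =
      w.1 ^ 3 * (24 * lam * p.1 + partialX (partialX (partialX φ)) p)
      + 3 * w.1 ^ 2 * w.2 * (-2 + partialY (partialX (partialX φ)) p)
      + 3 * w.1 * w.2 ^ 2 * partialY (partialY (partialX φ)) p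
      + w.2 ^ 3 * partialY (partialY (partialY φ)) p := fun p w => by
    simp only [cubicForm, hfdef, partialXXX_platonova hφ, partialXXY_platonova hφ,
      partialXYY_platonova hφ, partialYYY_platonova hφ]
  let Ψ : ℝ × (ℝ × ℝ) → ℝ × ℝ := fun z =>
    (quadForm f (z.1, z.2.1) (1, z.2.2), cubicForm f (z.1, z.2.1) (1, z.2.2))
  have hΨ : SmoothNear Ψ 0 := by
    refine ContDiff.smoothNear ?_ 0
    have hp : ContDiff ℝ ∞ fun z : ℝ × (ℝ × ℝ) => ((z.1, z.2.1) : Plane) := by fun_prop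
    have h₁ := hf.partialX.partialX.comp hp
    have h₂ := hf.partialX.partialY.comp hp
    have h₃ := hf.partialY.partialY.comp hp
    have h₄ := hf.partialX.partialX.partialX.comp hp
    have h₅ := hf.partialX.partialX.partialY.comp hp
    have h₆ := hf.partialX.partialY.partialY.comp hp
    have h₇ := hf.partialY.partialY.partialY.comp hp
    simp only [Function.comp_def] at h₁ h₂ h₃ h₄ h₅ h₆ h₇
    simp only [Ψ, quadForm, cubicForm]
    fun_prop
  have hΨ0 : Ψ 0 = 0 := by
    ext <;> simp [Ψ, hq, hcu, Prod.mk_zero_zero, hφxx.apply_zero, hφxxx.apply_zero]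
  obtain ⟨ψ, hψ, hψ0, hψΨ⟩ := SmoothNear.exists_implicit (E := ℝ) (F := ℝ × ℝ) (a := 0) (b := 0)
    rfl (f := Ψ) hΨ (fun y hy => by
      have h₁ : HasDerivAt (fun t : ℝ => Ψ (t • ((0, y) : ℝ × (ℝ × ℝ))))
          (-2 * y.1, -6 * y.2) 0 := by
        have h1 : HasDerivAt (fun t : ℝ => t * y.1) y.1 0 := by
          simpa using (hasDerivAt_id (0 : ℝ)).mul_const y.1
        have h2 : HasDerivAt (fun t : ℝ => t * y.2) y.2 0 := by
          simpa using (hasDerivAt_id (0 : ℝ)).mul_const y.2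
        have hxx := hφxx.hasDerivAt_line (0, y.1)
        have hxy := hφxy.hasDerivAt_line (0, y.1)
        have hyy := hφyy.hasDerivAt_line (0, y.1)
        have hxxx := hφxxx.hasDerivAt_line (0, y.1)
        have hxxy := hφxxy.hasDerivAt_line (0, y.1)
        have hxyy := hφxyy.hasDerivAt_line (0, y.1)
        have hyyy := hφyyy.hasDerivAt_line (0, y.1)
        refine HasDerivAt.prodMk ?_ ?_
        · simp only [hq]
          refine HasDerivAt.congr_deriv ((((h1.const_mul (-2)).add hxx).add
            ((h2.const_mul 2).mul hxy)).add ((h2.pow 2).mul (hyy.const_add 1))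
            |>.congr_of_eventuallyEq ?_) ?_
          · exact Eventually.of_forall fun t => by simp
          · simp [hφxy.apply_zero]
        · simp only [hcu]
          refine HasDerivAt.congr_deriv (((hxxx.add
            ((h2.const_mul 3).mul (hxxy.const_add (-2)))).add
            (((h2.pow 2).const_mul 3).mul hxyy)).add ((h2.pow 3).mul hyyy)
            |>.congr_of_eventuallyEq ?_) ?_
          · exact Eventually.of_forall fun t => by simp
          · simp [hφxxy.apply_zero]
            ring
      have := hΨ.fderiv_eq_of_line h₁
      rw [show ((0, 0) : ℝ × (ℝ × ℝ)) = 0 from rfl, this] at hy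
      have h2 := Prod.ext_iff.1 hy
      simp at h2
      exact Prod.ext h2.1 h2.2)
  rw [show ((0, 0) : ℝ × (ℝ × ℝ)) = 0 from rfl, hΨ0] at hψΨ
  have hψO : ψ =O[𝓝 0] fun x : ℝ => x := hψ.isBigO_id hψ0
  have hyO : (fun x => (ψ x).1) =O[𝓝 0] fun x : ℝ => x := isBigO_fst_prod.trans hψO
  have hmO : (fun x => (ψ x).2) =O[𝓝 0] fun x : ℝ => x := isBigO_snd_prod.trans hψO
  have hgraph : ∀ᶠ x in 𝓝 0, Ψ (x, ψ x) = 0 := by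
    have ht : Tendsto (fun x => (x, ψ x)) (𝓝 0) (𝓝 0) :=
      ((isBigO_refl (fun x : ℝ => x) _).prod_left hψO).trans_tendsto tendsto_id
    filter_upwards [ht.eventually hψΨ] with x hx using hx.2 rfl
  refine ⟨fun x => (ψ x).1, (contDiff_fst.smoothNear _).comp 0 hψ, ?_, ?_⟩
  · have hc : (fun x => ((x, (ψ x).1) : Plane)) =O[𝓝 0] fun x : ℝ => x :=
      (isBigO_refl _ _).prod_left hyO
    have hxx := hφxx.comp_isLittleO hc
    have hxy := hφxy.comp_isLittleO hc
    have hyy := hφyy.comp_isLittleO hc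
    have hxxx := hφxxx.comp_isLittleO hc
    have hxxy := hφxxy.comp_isLittleO hc
    have hxyy := hφxyy.comp_isLittleO hc
    have hyyy := hφyyy.comp_isLittleO hc
    have hb : ∀ {n : ℕ} {u v : ℝ → ℝ}, u =o[𝓝 0] (fun x => x ^ n) →
        v =O[𝓝 0] (fun _ => (1 : ℝ)) → (fun x => u x * v x) =o[𝓝 0] fun x => x ^ n :=
      fun hu hv => by simpa using hu.mul_isBigO hv
    have hx1 : (fun x : ℝ => x) =O[𝓝 0] fun _ => (1 : ℝ) := tendsto_id.isBigO_one ℝ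
    have hm1 := hmO.trans hx1
    have hmm1 : ∀ n : ℕ, (fun x => (ψ x).2 ^ n) =O[𝓝 0] fun _ => (1 : ℝ) := fun n => by
      simpa using hm1.pow n
    -- The cubic form is 24λx - 6m up to o(x).
    have hn : (fun x => (ψ x).2 - 4 * lam * x) =o[𝓝 0] fun x : ℝ => x ^ 1 := by
      have hsum := ((hxxx.add ((hb hxxy hm1).const_mul_left 3)).add
        ((hb hxyy (hmm1 2)).const_mul_left 3)).add (hb hyyy (hmm1 3))
      refine (hsum.const_mul_left (1 / 6)).congr' ?_ EventuallyEq.rfl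
      filter_upwards [hgraph] with x hx
      have h2 : cubicForm f (x, (ψ x).1) (1, (ψ x).2) = 0 := congrArg Prod.snd hx
      rw [hcu] at h2
      simp only at h2
      linear_combination (1 / 6) * h2
    have hnx : (fun x => ((ψ x).2 - 4 * lam * x) * x) =o[𝓝 0] fun x : ℝ => x ^ 2 := by
      simpa [pow_two] using hn.mul_isBigO (isBigO_refl (fun x : ℝ => x) _)
    have hnn : (fun x => ((ψ x).2 - 4 * lam * x) * ((ψ x).2 - 4 * lam * x)) =o[𝓝 0]
        fun x : ℝ => x ^ 2 := by
      simpa [pow_two] using hn.mul hn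
    -- Put m = 4λx + n with n = o(x): then m² - 4xm = (16λ² - 16λ)x² + (8λ - 4)nx + n², and only the
    -- first term counts.
    have hsum := (((hnx.const_mul_left (8 * lam - 4)).add hnn).add hxx).add
      (((hb hxy hm1).const_mul_left 2).add (hb hyy (hmm1 2)))
    refine (hsum.const_mul_left (1 / 2)).congr' ?_ EventuallyEq.rfl
    filter_upwards [hgraph] with x hx
    have h2 : quadForm f (x, (ψ x).1) (1, (ψ x).2) = 0 := congrArg Prod.fst hx
    rw [hq] at h2
    simp only at h2
    linear_combination (1 / 2) * h2
  -- The radius δ of uniqueness for (x, y, m) is fixed first; then p is taken so close to the origin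
  -- that all null slopes at p are below δ.
  · obtain ⟨δ, hδ, hball⟩ := Metric.eventually_nhds_iff_ball.1 hψΨ
    have h0xx : partialX (partialX f) 0 = 0 := by
      simp [hfdef, partialXX_platonova hφ, hφxx.apply_zero]
    have h0xy : partialY (partialX f) 0 = 0 := by
      simp [hfdef, partialXY_platonova hφ, hφxy.apply_zero]
    have h0yy : partialY (partialY f) 0 = 1 := by
      simp [hfdef, partialYY_platonova hφ, hφyy.apply_zero]
    have hfst : Tendsto (Prod.fst : Plane → ℝ) (𝓝 0) (𝓝 0) := continuous_fst.tendsto 0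
    filter_upwards [eventually_abs_slope_lt hf h0xx h0xy h0yy hδ, hfst.eventually hgraph,
      Metric.ball_mem_nhds (0 : Plane) hδ] with p hs hg hpδ
    constructor
    · rintro ⟨w, hw, hw2, hw3⟩
      obtain ⟨hw1, hlt⟩ := hs w hw hw2
      set m := w.2 / w.1 with hm
      have hwm : w.2 = m * w.1 := by rw [hm]; field_simp
      have hz : Ψ (p.1, (p.2, m)) = 0 := by
        have h2 : w.1 ^ 2 * quadForm f p (1, m) = 0 := by
          rw [← hw2]; simp only [quadForm, hwm]; ring
        have h3 : w.1 ^ 3 * cubicForm f p (1, m) = 0 := by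
          rw [← hw3]; simp only [cubicForm, hwm]; ring
        exact Prod.ext ((mul_eq_zero.1 h2).resolve_left (pow_ne_zero 2 hw1))
          ((mul_eq_zero.1 h3).resolve_left (pow_ne_zero 3 hw1))
      have hmem : ((p.1, (p.2, m)) : ℝ × (ℝ × ℝ)) ∈ Metric.ball 0 δ := by
        simp only [mem_ball_zero_iff, Prod.norm_def, sup_lt_iff, Real.norm_eq_abs] at hpδ ⊢
        exact ⟨hpδ.1, hpδ.2, hlt⟩
      have := (hball _ hmem).1 hz
      exact congrArg Prod.fst this
    · intro hp
      refine ⟨(1, (ψ p.1).2), by simp, ?_, ?_⟩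
      · have := congrArg Prod.fst hg
        simp only [Ψ] at this
        rwa [← hp] at this
      · have := congrArg Prod.snd hg
        simp only [Ψ] at this
        rwa [← hp] at this

/-! ### Conodal curve of the normal form, by double tangents of a partial Legendre transform -/

theorem cubic_coeff_eq_zero {a b c d : ℝ}
    (h : (fun t : ℝ => a + b * t + c * t ^ 2 + d * t ^ 3) =o[𝓝 0] fun t => t ^ 3) :
    a = 0 ∧ b = 0 ∧ c = 0 ∧ d = 0 := by
  have h32 : (fun t : ℝ => t ^ 3) =o[𝓝 0] fun t => t ^ 2 :=
    isLittleO_pow_pow (by norm_num)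
  obtain ⟨rfl, rfl, rfl⟩ := quadratic_coeff_eq_zero (a := a) (b := b) (c := c)
    (((h.trans h32).sub (h32.const_mul_left d)).congr_left fun t => by ring)
  refine ⟨rfl, rfl, rfl, eq_zero_of_isLittleO_self (l := 𝓝[≠] 0) (f := fun t => t ^ 3) ?_
    ((h.congr_left fun t => by ring).mono nhdsWithin_le_nhds)⟩
  filter_upwards [self_mem_nhdsWithin] with t ht using pow_ne_zero _ ht

theorem SmoothNear.derivs_of_isLittleO_cube {f : ℝ → ℝ} (hf : SmoothNear f 0) {c : ℝ}
    (h : (fun t => f t - c * t ^ 3) =o[𝓝 0] fun t => t ^ 3) :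
    f 0 = 0 ∧ deriv f 0 = 0 ∧ deriv (deriv f) 0 = 0 ∧ deriv (deriv (deriv f)) 0 = 6 * c := by
  have := h.sub hf.taylor_three
  obtain ⟨h₁, h₂, h₃, h₄⟩ := cubic_coeff_eq_zero (a := f 0) (b := deriv f 0)
    (c := deriv (deriv f) 0 / 2) (d := deriv (deriv (deriv f)) 0 / 6 - c)
    (this.congr_left fun t => by ring)
  exact ⟨h₁, h₂, by linarith, by linarith⟩

theorem ContDiff.deriv_partialX {h : Plane → ℝ} (hh : ContDiff ℝ ∞ h) (y : ℝ) :
    deriv (fun x => h (x, y)) = fun x => _root_.partialX h (x, y) :=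
  funext fun x => (hasDerivAt_partialX (p := (x, y)) (hh.differentiable (by simp) _)).deriv

theorem hasDerivAt_comp_smul {h : Plane → ℝ} (hh : ContDiff ℝ ∞ h) (w : Plane) :
    HasDerivAt (fun t : ℝ => h (t • w)) (w.1 * partialX h 0 + w.2 * partialY h 0) 0 := by
  have h₁ : HasDerivAt (fun t : ℝ => t • w) w 0 := by
    simpa using (hasDerivAt_id (0 : ℝ)).smul_const w
  have h₂ : HasFDerivAt h (fderiv ℝ h 0) ((0 : ℝ) • w) := by
    rw [zero_smul]
    exact ((hh.differentiable (by simp)) 0).hasFDerivAt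
  rw [← fderiv_apply_eq_partial]
  exact h₂.comp_hasDerivAt (0 : ℝ) h₁

theorem hasDerivAt_along_first {h : Plane → ℝ} (hh : ContDiff ℝ ∞ h) (u v q s : ℝ) :
    HasDerivAt (fun s => h (u + s * v, q)) (v * partialX h (u + s * v, q)) s := by
  have h₁ : HasDerivAt (fun s => u + s * v) v s := by
    simpa using ((hasDerivAt_id s).mul_const v).const_add u
  have h₂ := hasDerivAt_partialX (p := (u + s * v, q)) (hh.differentiable (by simp) _)
  have := HasDerivAt.comp (h₂ := fun x => h (x, q)) s h₂ h₁
  rw [mul_comm]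
  exact this

theorem mul_integral_partialX {g : Plane → ℝ} (hg : ContDiff ℝ ∞ g) (u v q : ℝ) :
    v * ∫ s in (-1 : ℝ)..1, partialX (partialX g) (u + s * v, q) =
      partialX g (u + v, q) - partialX g (u - v, q) := by
  have hc := hg.partialX.partialX.continuous
  rw [← intervalIntegral.integral_const_mul, intervalIntegral.integral_eq_sub_of_hasDerivAt
    (fun s _ => hasDerivAt_along_first hg.partialX u v q s)
    (Continuous.intervalIntegrable (by fun_prop) _ _)]
  simp [sub_eq_add_neg]

/-- Two integrations by parts: the weight 1 - s² vanishes at both ends, so g_xx leaves no boundary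
term. The right-hand side is the second bitangency equation, now visibly divisible by v³. -/
theorem cube_mul_integral_partialX {g : Plane → ℝ} (hg : ContDiff ℝ ∞ g) (u v q : ℝ) :
    v ^ 3 * ∫ s in (-1 : ℝ)..1, (1 - s ^ 2) * partialX (partialX (partialX g)) (u + s * v, q) =
      2 * v * (partialX g (u + v, q) + partialX g (u - v, q))
        - 2 * (g (u + v, q) - g (u - v, q)) := by
  have hc := hg.partialX.partialX.partialX.continuous
  have hd : ∀ s : ℝ, HasDerivAt (fun s => v ^ 2 * (1 - s ^ 2) * partialX (partialX g) (u + s * v, q)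
      + 2 * v * s * partialX g (u + s * v, q) - 2 * g (u + s * v, q))
      (v ^ 3 * ((1 - s ^ 2) * partialX (partialX (partialX g)) (u + s * v, q))) s := by
    intro s
    refine (((((((hasDerivAt_id s).pow 2).const_sub 1).const_mul (v ^ 2)).mul
      (hasDerivAt_along_first hg.partialX.partialX u v q s)).add
      (((hasDerivAt_id s).const_mul (2 * v)).mul (hasDerivAt_along_first hg.partialX u v q s))).sub
      ((hasDerivAt_along_first hg u v q s).const_mul 2)).congr_deriv ?_
    simp only [id_eq, Nat.cast_ofNat, Pi.pow_apply]
    ring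
  rw [← intervalIntegral.integral_const_mul, intervalIntegral.integral_eq_sub_of_hasDerivAt
    (fun s _ => hd s) (Continuous.intervalIntegrable (by fun_prop) _ _)]
  simp [sub_eq_add_neg]
  ring

/-- The double tangents of a generic one-parameter family `x ↦ g (x, q)` of functions in which two
inflection points are born: `u ± v` are the abscissae of the points of contact. -/
theorem exists_bitangent_family {g : Plane → ℝ} (hg : ContDiff ℝ ∞ g)
    (h2 : partialX (partialX g) 0 = 0) (h3 : partialX (partialX (partialX g)) 0 = 0)
    (h4 : partialX (partialX (partialX (partialX g))) 0 ≠ 0)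
    (h2q : partialY (partialX (partialX g)) 0 ≠ 0) :
    ∃ U Q : ℝ → ℝ, SmoothNear U 0 ∧ SmoothNear Q 0 ∧ U 0 = 0 ∧ Q 0 = 0 ∧ deriv U 0 = 0 ∧
      ∀ᶠ z : ℝ × (ℝ × ℝ) in 𝓝 0, z.1 ≠ 0 →
        ((partialX g (z.2.1 + z.1, z.2.2) = partialX g (z.2.1 - z.1, z.2.2) ∧
          g (z.2.1 + z.1, z.2.2) - g (z.2.1 - z.1, z.2.2) =
            2 * z.1 * partialX g (z.2.1 + z.1, z.2.2)) ↔ z.2.1 = U z.1 ∧ z.2.2 = Q z.1) := by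
  -- A and B are the bitangency equations divided by v and v³. They extend smoothly to v = 0 as 2
  -- g_xx and (4/3) g_xxx, which removes the trivial solutions on the diagonal.
  let A : ℝ × (ℝ × ℝ) → ℝ := fun z =>
    ∫ s in (-1 : ℝ)..1, partialX (partialX g) (z.2.1 + s * z.1, z.2.2)
  let B : ℝ × (ℝ × ℝ) → ℝ := fun z =>
    ∫ s in (-1 : ℝ)..1, (1 - s ^ 2) * partialX (partialX (partialX g)) (z.2.1 + s * z.1, z.2.2)
  have hp : ContDiff ℝ ∞ fun r : (ℝ × (ℝ × ℝ)) × ℝ =>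
      ((r.1.2.1 + r.2 * r.1.1, r.1.2.2) : Plane) := by fun_prop
  have hA : ContDiff ℝ ∞ A := contDiff_intervalIntegral_param (hg.partialX.partialX.comp hp)
  have hB : ContDiff ℝ ∞ B := contDiff_intervalIntegral_param
    ((contDiff_const.sub (contDiff_snd.pow 2)).mul (hg.partialX.partialX.partialX.comp hp))
  have hweight : ∫ s in (-1 : ℝ)..1, (1 - s ^ 2) = 4 / 3 := by
    rw [intervalIntegral.integral_sub (by simp) (Continuous.intervalIntegrable (by fun_prop) _ _)]
    simp
    norm_num
  have hA0 : ∀ u q, A (0, (u, q)) = 2 * partialX (partialX g) (u, q) := fun u q => by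
    simp [A]
    norm_num
  have hB0 : ∀ u q, B (0, (u, q)) = 4 / 3 * partialX (partialX (partialX g)) (u, q) :=
    fun u q => by
    simp only [B, mul_zero, add_zero]
    rw [intervalIntegral.integral_mul_const, hweight]
  have hΨ : SmoothNear (fun z => (A z, B z)) 0 := (hA.prodMk hB).smoothNear 0
  have hz : (A 0, B 0) = 0 := by
    ext
    · simpa [h2, Prod.mk_zero_zero] using hA0 0 0
    · simpa [h3, Prod.mk_zero_zero] using hB0 0 0
  obtain ⟨ψ, hψ, hψ0, hψΨ⟩ := SmoothNear.exists_implicit (E := ℝ) (F := ℝ × ℝ) (a := 0) (b := 0)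
    rfl (f := fun z => (A z, B z)) hΨ (fun y hy => by
      have h₁ : HasDerivAt (fun t : ℝ => (A (t • ((0, y) : ℝ × (ℝ × ℝ))),
          B (t • ((0, y) : ℝ × (ℝ × ℝ)))))
          (2 * (y.1 * partialX (partialX (partialX g)) 0 + y.2 * partialY (partialX (partialX g)) 0),
           4 / 3 * (y.1 * partialX (partialX (partialX (partialX g))) 0 +
            y.2 * partialY (partialX (partialX (partialX g))) 0)) 0 := by
        refine HasDerivAt.prodMk ?_ ?_
        · refine ((hasDerivAt_comp_smul hg.partialX.partialX y).const_mul 2).congr_of_eventuallyEq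
            (Eventually.of_forall fun t => ?_)
          have e : t • ((0, y) : ℝ × (ℝ × ℝ)) = (0, (t * y.1, t * y.2)) := by ext <;> simp
          beta_reduce
          rw [e]
          exact hA0 _ _
        · refine ((hasDerivAt_comp_smul hg.partialX.partialX.partialX y).const_mul
            (4 / 3)).congr_of_eventuallyEq (Eventually.of_forall fun t => ?_)
          have e : t • ((0, y) : ℝ × (ℝ × ℝ)) = (0, (t * y.1, t * y.2)) := by ext <;> simp
          beta_reduce
          rw [e]
          exact hB0 _ _
      have := hΨ.fderiv_eq_of_line h₁
      rw [show ((0, 0) : ℝ × (ℝ × ℝ)) = 0 from rfl, this] at hy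
      obtain ⟨e1, e2⟩ := Prod.ext_iff.1 hy
      -- The linear system is triangular because g_xxx vanishes at the origin: g_xxq ≠ 0 gives y.2 =
      -- 0, then g_xxxx ≠ 0 gives y.1 = 0.
      simp only [h3, mul_zero, zero_add, Prod.fst_zero, Prod.snd_zero] at e1 e2
      have hy2 : y.2 = 0 := by simpa [h2q] using e1
      have hy1 : y.1 = 0 := by simpa [hy2, h4] using e2
      exact Prod.ext hy1 hy2)
  rw [show ((0, 0) : ℝ × (ℝ × ℝ)) = 0 from rfl, hz] at hψΨ
  -- Replacing v by -v only exchanges the points of contact. By uniqueness the solution (U, Q) is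
  -- even in v, whence U'(0) = 0.
  have heven : ∀ v y, (A (-v, y), B (-v, y)) = (A (v, y), B (v, y)) := by
    intro v y
    ext
    · simpa [A] using intervalIntegral.integral_comp_neg (a := -1) (b := 1)
        (fun s => partialX (partialX g) (y.1 + s * v, y.2))
    · have h := intervalIntegral.integral_comp_neg (a := -1) (b := 1)
        (fun s => (1 - s ^ 2) * partialX (partialX (partialX g)) (y.1 + s * v, y.2))
      rw [neg_neg] at h
      refine Eq.trans (intervalIntegral.integral_congr fun s _ => ?_) h
      simp only [mul_neg, neg_mul]
      ring
  have hψeven : ∀ᶠ v in 𝓝 0, ψ (-v) = ψ v := by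
    have hc : Tendsto ψ (𝓝 0) (𝓝 0) := by
      have := hψ.continuousAt.tendsto
      rwa [hψ0] at this
    have ht₁ : Tendsto (fun v => (v, ψ v)) (𝓝 0) (𝓝 (0, 0)) := tendsto_id.prodMk_nhds hc
    have ht₂ : Tendsto (fun v => (-v, ψ v)) (𝓝 0) (𝓝 (0, 0)) :=
      Tendsto.prodMk_nhds (by simpa using (continuous_neg.tendsto (0 : ℝ))) hc
    filter_upwards [ht₁.eventually hψΨ, ht₂.eventually hψΨ] with v hv₁ hv₂
    exact (hv₂.1 ((heven v _).trans (hv₁.2 rfl))).symm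
  have hUd : deriv (fun v => (ψ v).1) 0 = 0 := by
    have hd : HasDerivAt (fun v => (ψ v).1) (deriv (fun v => (ψ v).1) 0) 0 :=
      (hψ.differentiableAt.fst).hasDerivAt
    have hd' : HasDerivAt (fun v => (ψ v).1) (deriv (fun v => (ψ v).1) 0) (-0) := by
      simpa using hd
    have h₁ := HasDerivAt.comp (0 : ℝ) hd' (hasDerivAt_neg (0 : ℝ))
    have h₂ := h₁.congr_of_eventuallyEq (f₁ := fun v => (ψ v).1)
      (hψeven.mono fun v hv => by simp [hv])
    have := hd.unique h₂
    linarith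
  refine ⟨fun v => (ψ v).1, fun v => (ψ v).2, (contDiff_fst.smoothNear _).comp 0 hψ,
    (contDiff_snd.smoothNear _).comp 0 hψ, by simp [hψ0], by simp [hψ0], hUd, ?_⟩
  filter_upwards [hψΨ] with z hz hz1
  have e₁ := mul_integral_partialX hg z.2.1 z.1 z.2.2
  have e₂ := cube_mul_integral_partialX hg z.2.1 z.1 z.2.2
  have hAz : A z = 0 ↔ partialX g (z.2.1 + z.1, z.2.2) = partialX g (z.2.1 - z.1, z.2.2) := by
    rw [← sub_eq_zero (b := partialX g (z.2.1 - z.1, z.2.2)), ← e₁, mul_eq_zero]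
    simp [hz1, A]
  have hBz : B z = 0 ↔ 2 * z.1 * (partialX g (z.2.1 + z.1, z.2.2) +
      partialX g (z.2.1 - z.1, z.2.2)) -
      2 * (g (z.2.1 + z.1, z.2.2) - g (z.2.1 - z.1, z.2.2)) = 0 := by
    rw [← e₂, mul_eq_zero]
    simp [hz1, B]
  have hpair : (A z, B z) = 0 ↔ A z = 0 ∧ B z = 0 := Prod.ext_iff
  rw [← Prod.ext_iff, ← hz, hpair, hAz, hBz]
  constructor
  · rintro ⟨h₁, h₂⟩
    exact ⟨h₁, by rw [← h₁, h₂]; ring⟩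
  · rintro ⟨h₁, h₂⟩
    refine ⟨h₁, ?_⟩
    rw [← h₁] at h₂
    linarith

/-- Y solves f_y(x, Y) = q, and because f_y = q there, the derivatives of Y cancel in those of g = f
- qY. Two points with a common tangent plane share the value q, so they become two points on the
graph of one function g(·, q) with a common tangent line. The germ g is replaced by a global smooth
function, hence the identities near 0 only. -/
theorem exists_partial_legendre {f : Plane → ℝ} (hf : ContDiff ℝ ∞ f) (hy : partialY f 0 = 0)
    (hyy : partialY (partialY f) 0 ≠ 0) :
    ∃ Y g : Plane → ℝ, SmoothNear Y 0 ∧ Y 0 = 0 ∧ ContDiff ℝ ∞ g ∧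
      (∀ᶠ z : Plane × ℝ in 𝓝 0, partialY f (z.1.1, z.2) = z.1.2 ↔ z.2 = Y z.1) ∧
      ∀ᶠ w in 𝓝 (0 : Plane), partialY f (w.1, Y w) = w.2 ∧ g w = f (w.1, Y w) - w.2 * Y w ∧
        partialX g w = partialX f (w.1, Y w) ∧ partialY g w = -Y w := by
  let Θ : Plane × ℝ → ℝ := fun z => partialY f (z.1.1, z.2) - z.1.2
  have hp : ContDiff ℝ ∞ fun z : Plane × ℝ => ((z.1.1, z.2) : Plane) := by fun_prop
  have hΘ : SmoothNear Θ 0 := by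
    have h₁ := hf.partialY.comp hp
    simp only [Function.comp_def] at h₁
    exact (h₁.sub (by fun_prop)).smoothNear 0
  have hΘ0 : Θ 0 = 0 := by simp [Θ, Prod.mk_zero_zero, hy]
  obtain ⟨Y, hY, hY0, hYΘ⟩ := SmoothNear.exists_implicit (E := Plane) (F := ℝ) (a := 0) (b := 0)
    rfl (f := Θ) hΘ (fun y h0 => by
      have h₁ : HasDerivAt (fun t : ℝ => Θ (t • ((0, y) : Plane × ℝ)))
          (y * partialY (partialY f) 0) 0 := by
        have := hasDerivAt_comp_smul hf.partialY (0, y)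
        simpa [Θ] using this
      rw [show ((0, 0) : Plane × ℝ) = 0 from rfl, hΘ.fderiv_eq_of_line h₁] at h0
      exact (mul_eq_zero.1 h0).resolve_right hyy)
  rw [show ((0, 0) : Plane × ℝ) = 0 from rfl, hΘ0] at hYΘ
  have hΦ : SmoothNear (fun w : Plane => ((w.1, Y w) : Plane)) 0 :=
    (contDiff_fst.smoothNear 0).prodMk hY
  have hG : SmoothNear (fun w : Plane => f (w.1, Y w) - w.2 * Y w) 0 :=
    ((hf.smoothNear _).comp 0 hΦ).sub ((contDiff_snd.smoothNear 0).mul hY)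
  obtain ⟨g, hg, hgG⟩ := hG.exists_contDiff
  refine ⟨Y, g, hY, hY0, hg, hYΘ.mono fun z hz => by rw [← hz]; simp [Θ, sub_eq_zero], ?_⟩
  have ht : Tendsto (fun w => (w, Y w)) (𝓝 (0 : Plane)) (𝓝 0) := by
    have := continuousAt_id.prodMk hY.continuousAt
    simpa [ContinuousAt, hY0, Prod.mk_zero_zero] using this
  filter_upwards [ht.eventually hYΘ, hgG.eventuallyEq_nhds, hY.eventually_differentiableAt,
    hG.eventually_differentiableAt] with w hw hgw hYw hGw
  have hfy : partialY f (w.1, Y w) = w.2 := by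
    have : Θ (w, Y w) = 0 := hw.2 rfl
    simpa [Θ, sub_eq_zero] using this
  have hfw := (hf.differentiable (by simp) (w.1, Y w)).hasFDerivAt
  refine ⟨hfy, hgw.self_of_nhds, ?_, ?_⟩
  · have h₁ : partialX g w = partialX (fun w : Plane => f (w.1, Y w) - w.2 * Y w) w := by
      simp only [partialX, hgw.fderiv_eq]
    rw [h₁]
    refine partialX_eq hGw ?_
    have hYx := hasDerivAt_partialX hYw
    have h₂ := hfw.comp_hasDerivAt (f := fun x : ℝ => ((x, Y (x, w.2)) : Plane)) w.1
      ((hasDerivAt_id w.1).prodMk hYx)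
    rw [fderiv_apply_eq_partial, hfy] at h₂
    refine (h₂.sub (hYx.const_mul w.2)).congr_deriv ?_
    ring
  · have h₁ : partialY g w = partialY (fun w : Plane => f (w.1, Y w) - w.2 * Y w) w := by
      simp only [partialY, hgw.fderiv_eq]
    rw [h₁]
    refine partialY_eq hGw ?_
    have hYy := hasDerivAt_partialY hYw
    have h₂ := hfw.comp_hasDerivAt (f := fun y : ℝ => ((w.1, Y (w.1, y)) : Plane)) w.2
      ((hasDerivAt_const w.2 w.1).prodMk hYy)
    rw [fderiv_apply_eq_partial, hfy] at h₂
    refine (h₂.sub ((hasDerivAt_id w.2).mul hYy)).congr_deriv ?_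
    simp
    ring

/-- The graph of `f` has the same tangent plane over `p` and over `q`. -/
def SameTangentPlane (f : Plane → ℝ) (p q : Plane) : Prop :=
  partialX f p = partialX f q ∧ partialY f p = partialY f q ∧
    f p - p.1 * partialX f p - p.2 * partialY f p = f q - q.1 * partialX f q - q.2 * partialY f q

/-- All four derivatives can be found along q = 0. There Y = x² + o(x³), hence g_x = -2xY + 4λx³ +
o(x³) = (4λ - 2)x³ + o(x³), and g_q = -Y. -/
theorem legendre_jet {lam : ℝ} {φ : Plane → ℝ} (hφ : IsFlat 4 φ) {Y g : Plane → ℝ}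
    (hY : SmoothNear Y 0) (hY0 : Y 0 = 0) (hg : ContDiff ℝ ∞ g)
    (hYg : ∀ᶠ w in 𝓝 (0 : Plane), partialY (platonova lam φ) (w.1, Y w) = w.2 ∧
      partialX g w = partialX (platonova lam φ) (w.1, Y w) ∧ partialY g w = -Y w) :
    partialX (partialX g) 0 = 0 ∧ partialX (partialX (partialX g)) 0 = 0 ∧
      partialX (partialX (partialX (partialX g))) 0 = 24 * (lam - 1 / 2) ∧
      partialY (partialX (partialX g)) 0 = -2 := by
  have hl : SmoothNear (fun x : ℝ => ((x, 0) : Plane)) 0 := ContDiff.smoothNear (by fun_prop) 0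
  have hlt : Tendsto (fun x : ℝ => ((x, 0) : Plane)) (𝓝 0) (𝓝 0) := hl.continuousAt
  have hYl : SmoothNear (fun x : ℝ => Y (x, 0)) 0 := SmoothNear.comp 0 (g := Y) hY hl
  have hYO : (fun x : ℝ => Y (x, 0)) =O[𝓝 0] fun x => x := hYl.isBigO_id hY0
  have hc : (fun x : ℝ => ((x, Y (x, 0)) : Plane)) =O[𝓝 0] fun x : ℝ => x :=
    (isBigO_refl _ _).prod_left hYO
  have hYx : (fun x : ℝ => Y (x, 0) - x ^ 2) =o[𝓝 0] fun x => x ^ 3 := by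
    refine ((hφ.partialY.comp_isLittleO hc).const_mul_left (-1)).congr' ?_ EventuallyEq.rfl
    filter_upwards [hlt.eventually hYg] with x hx
    have := hx.1
    rw [partialY_platonova hφ] at this
    simp only at this
    linear_combination -this
  have h32 : (fun t : ℝ => t ^ 3) =o[𝓝 0] fun t => t ^ 2 := isLittleO_pow_pow (by norm_num)
  have hgy : SmoothNear (fun x : ℝ => partialY g (x, 0)) 0 :=
    SmoothNear.comp 0 (g := partialY g) (hg.partialY.smoothNear _) hl
  have hgx : SmoothNear (fun x : ℝ => partialX g (x, 0)) 0 :=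
    SmoothNear.comp 0 (g := partialX g) (hg.partialX.smoothNear _) hl
  have e₁ := (hgy.derivs_of_isLittleO (c := -1) (by
    refine ((hYx.trans h32).const_mul_left (-1)).congr' ?_ EventuallyEq.rfl
    filter_upwards [hlt.eventually hYg] with x hx
    rw [hx.2.2]
    ring)).2.2
  obtain ⟨-, e₂, e₃, e₄⟩ := hgx.derivs_of_isLittleO_cube (c := 4 * lam - 2) (by
    have h₁ : (fun x : ℝ => (Y (x, 0) - x ^ 2) * x) =o[𝓝 0] fun x => x ^ 3 := by
      simpa using hYx.mul_isBigO (tendsto_id.isBigO_one ℝ : (fun x : ℝ => x) =O[𝓝 0] _)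
    refine ((h₁.const_mul_left (-2)).add (hφ.partialX.comp_isLittleO hc)).congr' ?_
      EventuallyEq.rfl
    filter_upwards [hlt.eventually hYg] with x hx
    rw [hx.2.1, partialX_platonova hφ]
    ring)
  rw [hg.partialY.deriv_partialX, hg.partialY.partialX.deriv_partialX] at e₁
  rw [hg.partialX.deriv_partialX] at e₂ e₃ e₄
  rw [hg.partialX.partialX.deriv_partialX] at e₃ e₄
  rw [hg.partialX.partialX.partialX.deriv_partialX] at e₄
  refine ⟨e₂, e₃, e₄.trans (by ring), ?_⟩
  rw [← partialX_partialY_comm hg.partialX, ← partialX_partialY_comm hg]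
  exact e₁.trans (by ring)

/-- Equality of f_y gives y₁ - y₂ = 4Uv + o(v³). Eliminating y₂ from the equality of f_x leaves 4vy₁
= 8λv³ plus terms with a factor U²v or Uv(U - v), which are o(v³) since U = o(v). The factor v is
kept so that v = 0 needs no exception. -/
theorem contact_abscissa_asymptotics {lam : ℝ} {φ : Plane → ℝ} (hφ : IsFlat 4 φ)
    {U y₁ y₂ : ℝ → ℝ} (hU : U =o[𝓝 0] fun v : ℝ => v) (hy₁ : y₁ =O[𝓝 0] fun v : ℝ => v)
    (hy₂ : y₂ =O[𝓝 0] fun v : ℝ => v)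
    (hx : ∀ᶠ v in 𝓝 0, partialX (platonova lam φ) (U v + v, y₁ v) =
      partialX (platonova lam φ) (U v - v, y₂ v))
    (hy : ∀ᶠ v in 𝓝 0, partialY (platonova lam φ) (U v + v, y₁ v) =
      partialY (platonova lam φ) (U v - v, y₂ v)) :
    (fun v => v * (y₁ v - 2 * lam * v ^ 2)) =o[𝓝 0] fun v : ℝ => v ^ 3 := by
  have hx₁ : (fun v => U v + v) =O[𝓝 0] fun v : ℝ => v := hU.isBigO.add (isBigO_refl _ _)
  have hx₂ : (fun v => U v - v) =O[𝓝 0] fun v : ℝ => v := hU.isBigO.sub (isBigO_refl _ _)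
  have hc₁ : (fun v => ((U v + v, y₁ v) : Plane)) =O[𝓝 0] fun v : ℝ => v := hx₁.prod_left hy₁
  have hc₂ : (fun v => ((U v - v, y₂ v) : Plane)) =O[𝓝 0] fun v : ℝ => v := hx₂.prod_left hy₂
  have hEx := (hφ.partialX.comp_isLittleO hc₁).sub (hφ.partialX.comp_isLittleO hc₂)
  have hEy := (hφ.partialY.comp_isLittleO hc₁).sub (hφ.partialY.comp_isLittleO hc₂)
  have h₁ : (fun v => v * (U v * U v)) =o[𝓝 0] fun v : ℝ => v ^ 3 := by
    refine ((isBigO_refl (fun v : ℝ => v) _).mul_isLittleO (hU.mul hU)).congr_right fun v => ?_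
    ring
  have h₂ : (fun v => (U v - v) * (U v * v)) =o[𝓝 0] fun v : ℝ => v ^ 3 := by
    refine (hx₂.mul_isLittleO (hU.mul_isBigO (isBigO_refl (fun v : ℝ => v) _))).congr_right
      fun v => ?_
    ring
  have hx₂' : (fun v => U v - v) =O[𝓝 0] fun _ : ℝ => (1 : ℝ) :=
    hx₂.trans (tendsto_id.isBigO_one ℝ)
  have h₃ := hEy.mul_isBigO hx₂'
  simp only [mul_one] at h₃
  have hsum := (((h₁.const_mul_left (24 * lam)).sub (h₂.const_mul_left 8)).add
    (h₃.const_mul_left 2)).add hEx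
  refine (hsum.const_mul_left (1 / 4)).congr' ?_ EventuallyEq.rfl
  filter_upwards [hx, hy] with v hxv hyv
  rw [partialX_platonova hφ] at hxv
  rw [partialY_platonova hφ] at hyv
  simp only at hxv hyv
  linear_combination (1 / 4) * hxv + (1 / 2) * (U v - v) * hyv

/-- The contact points lie over U(v) ± v, and negative v exchanges the two, so x = U(v) + v covers
both of them. Since U'(0) = 0 this is invertible, with inverse V, and the curve is y = Y(x,
Q(V(x))). The other contact point σ(x) tends to the origin with x, so these pairs occur in every
small piece of the surface. -/
theorem exists_conodal_graph {lam : ℝ} {φ : Plane → ℝ} (hφ : IsFlat 4 φ) (hlam : lam ≠ 1 / 2) :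
    ∃ h : ℝ → ℝ, SmoothNear h 0 ∧ ((fun x => h x - 2 * lam * x ^ 2) =o[𝓝 0] fun x => x ^ 2) ∧
      (∀ᶠ z : Plane × Plane in 𝓝 0, z.1 ≠ z.2 → SameTangentPlane (platonova lam φ) z.1 z.2 →
        z.1.2 = h z.1.1) ∧
      ∃ σ : ℝ → Plane, Tendsto σ (𝓝 0) (𝓝 0) ∧ ∀ᶠ x in 𝓝 0, x ≠ 0 →
        σ x ≠ (x, h x) ∧ SameTangentPlane (platonova lam φ) (x, h x) (σ x) := by
  set f := platonova lam φ with hfdef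
  have hf : ContDiff ℝ ∞ f := contDiff_platonova hφ
  have hfy0 : partialY f 0 = 0 := by
    simp [hfdef, partialY_platonova hφ, (hφ.partialY : IsFlat 3 _).apply_zero]
  have hfyy0 : partialY (partialY f) 0 ≠ 0 := by
    simp [hfdef, partialYY_platonova hφ, (hφ.partialY.partialY : IsFlat 2 _).apply_zero]
  obtain ⟨Y, g, hY, hY0, hg, hYiff, hYg⟩ := exists_partial_legendre hf hfy0 hfyy0
  obtain ⟨h2, h3, h4, h2q⟩ := legendre_jet hφ hY hY0 hg
    (hYg.mono fun w hw => ⟨hw.1, hw.2.2.1, hw.2.2.2⟩)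
  obtain ⟨U, Q, hU, hQ, hU0, hQ0, hUd, hUQ⟩ := exists_bitangent_family hg h2 h3
    (by rw [h4]; exact mul_ne_zero (by norm_num) (sub_ne_zero.2 hlam)) (by rw [h2q]; norm_num)
  have hid : SmoothNear (fun v : ℝ => v) 0 := contDiff_id.smoothNear 0
  have hX : SmoothNear (fun v => U v + v) 0 := hU.add hid
  have hXd : HasDerivAt (fun v => U v + v) 1 0 := by
    have := hU.differentiableAt.hasDerivAt.add (hasDerivAt_id (0 : ℝ))
    rw [hUd, zero_add] at this
    exact this
  obtain ⟨V, hV, hV0, hVX, hXV⟩ := hX.exists_inverse rfl (fun x hx => by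
    rw [hXd.hasFDerivAt.fderiv] at hx
    simpa using hx)
  simp only [hU0, add_zero] at hV hV0 hXV
  have hUo : U =o[𝓝 0] fun v : ℝ => v := by
    simpa [hU0, hUd] using hU.taylor_one
  have hVt : Tendsto V (𝓝 0) (𝓝 0) := by
    have := hV.continuousAt.tendsto
    rwa [hV0] at this
  have hVO : V =O[𝓝 0] fun x : ℝ => x := hV.isBigO_id hV0
  -- The values ε = 1 and ε = -1 treat the two contact points at once.
  have hsm : ∀ ε : ℝ, SmoothNear (fun v => ((U v + ε * v, Q v) : Plane)) 0 := fun ε =>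
    (hU.add ((contDiff_const (c := ε)).smoothNear (0 : ℝ) |>.mul hid)).prodMk hQ
  have hYsm : ∀ ε : ℝ, SmoothNear (fun v => Y (U v + ε * v, Q v)) 0 := fun ε =>
    SmoothNear.comp 0 (g := Y) (by simpa [hU0, hQ0, Prod.mk_zero_zero] using hY) (hsm ε)
  have hYO : ∀ ε : ℝ, (fun v => Y (U v + ε * v, Q v)) =O[𝓝 0] fun v : ℝ => v := fun ε =>
    (hYsm ε).isBigO_id (by simp [hU0, hQ0, Prod.mk_zero_zero, hY0])
  have hwt : ∀ ε : ℝ, Tendsto (fun v => ((U v + ε * v, Q v) : Plane)) (𝓝 0) (𝓝 0) := fun ε => by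
    have := (hsm ε).continuousAt.tendsto
    simpa [hU0, hQ0, Prod.mk_zero_zero] using this
  have hvt : Tendsto (fun v => (v, (U v, Q v))) (𝓝 0) (𝓝 (0 : ℝ × (ℝ × ℝ))) := by
    have := (hid.prodMk (hU.prodMk hQ)).continuousAt.tendsto
    simpa [hU0, hQ0, Prod.mk_zero_zero] using this
  have hsame : ∀ᶠ v in 𝓝 0, v ≠ 0 → SameTangentPlane f (U v + 1 * v, Y (U v + 1 * v, Q v))
      (U v + (-1) * v, Y (U v + (-1) * v, Q v)) := by
    filter_upwards [(hwt 1).eventually hYg, (hwt (-1)).eventually hYg, hvt.eventually hUQ]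
      with v h₁ h₂ h₃ hv
    obtain ⟨b₁, b₂⟩ := (h₃ hv).2 ⟨rfl, rfl⟩
    simp only [sub_eq_add_neg, one_mul, neg_mul] at h₁ h₂ b₁ b₂ ⊢
    obtain ⟨p₁, p₂, p₃, -⟩ := h₁
    obtain ⟨q₁, q₂, q₃, -⟩ := h₂
    refine ⟨by rw [← p₃, ← q₃, b₁], by rw [p₁, q₁], ?_⟩
    rw [p₁, q₁, ← p₃, ← q₃, ← b₁]
    linear_combination b₂ - p₂ + q₂
  have hsame' : ∀ᶠ v in 𝓝 0, partialX f (U v + 1 * v, Y (U v + 1 * v, Q v)) =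
        partialX f (U v + (-1) * v, Y (U v + (-1) * v, Q v)) ∧
      partialY f (U v + 1 * v, Y (U v + 1 * v, Q v)) =
        partialY f (U v + (-1) * v, Y (U v + (-1) * v, Q v)) := by
    filter_upwards [hsame] with v hv
    by_cases h0 : v = 0
    · simp [h0]
    · exact ⟨(hv h0).1, (hv h0).2.1⟩
  have has := contact_abscissa_asymptotics hφ hUo (hYO 1) (hYO (-1))
    (hsame'.mono fun v hv => by simpa [sub_eq_add_neg] using hv.1)
    (hsame'.mono fun v hv => by simpa [sub_eq_add_neg] using hv.2)
  refine ⟨fun x => Y (x, Q (V x)), ?_, ?_, ?_, fun x => (U (V x) + (-1) * V x,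
    Y (U (V x) + (-1) * V x, Q (V x))), ?_, ?_⟩
  · have hQV : SmoothNear (fun x => Q (V x)) 0 := SmoothNear.comp 0 (by rwa [hV0]) hV
    exact SmoothNear.comp 0 (g := Y) (by simpa [hV0, hQ0, Prod.mk_zero_zero] using hY)
      (hid.prodMk hQV)
  · have hv2 : (fun v => Y (U v + 1 * v, Q v) - 2 * lam * v ^ 2) =o[𝓝 0] fun v : ℝ => v ^ 2 := by
      rw [isLittleO_iff] at has ⊢
      intro c hc
      filter_upwards [has hc] with v hv
      rcases eq_or_ne v 0 with rfl | h0
      · simp [hU0, hQ0, Prod.mk_zero_zero, hY0]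
      · have hpos : 0 < ‖v‖ := norm_pos_iff.2 h0
        rw [norm_mul, norm_pow, pow_succ' ‖v‖ 2] at hv
        rw [norm_pow]
        refine le_of_mul_le_mul_left ?_ hpos
        linarith
    have h₁ := (hv2.comp_tendsto hVt).trans_isBigO (hVO.pow 2)
    have hUV : (fun x => U (V x)) =o[𝓝 0] fun x : ℝ => x :=
      (hUo.comp_tendsto hVt).trans_isBigO hVO
    -- As U(V) + V = x, the difference V² - x² is -U(V)(V + x), so V may be replaced by x in 2λV².
    have h₂ : (fun x => U (V x) * (V x + x)) =o[𝓝 0] fun x : ℝ => x ^ 2 := by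
      refine (hUV.mul_isBigO (hVO.add (isBigO_refl _ _))).congr_right fun x => by ring
    refine (h₁.sub (h₂.const_mul_left (2 * lam))).congr' ?_ EventuallyEq.rfl
    filter_upwards [hXV] with x hx
    simp only [Function.comp, one_mul, hx]
    linear_combination 2 * lam * (-V x - x) * hx
  · have hz1 : Tendsto (Prod.fst : Plane × Plane → Plane) (𝓝 0) (𝓝 0) := continuous_fst.tendsto 0
    have hz2 : Tendsto (Prod.snd : Plane × Plane → Plane) (𝓝 0) (𝓝 0) := continuous_snd.tendsto 0
    have hfyc := hf.partialY.continuous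
    have hq1 : Tendsto (fun z : Plane × Plane => (((z.1.1, partialY f z.1), z.1.2) : Plane × ℝ))
        (𝓝 0) (𝓝 0) := by
      have : Continuous fun z : Plane × Plane =>
        (((z.1.1, partialY f z.1), z.1.2) : Plane × ℝ) := by fun_prop
      simpa [hfy0, Prod.mk_zero_zero] using this.tendsto 0
    have hq2 : Tendsto (fun z : Plane × Plane => (((z.2.1, partialY f z.2), z.2.2) : Plane × ℝ))
        (𝓝 0) (𝓝 0) := by
      have : Continuous fun z : Plane × Plane =>
        (((z.2.1, partialY f z.2), z.2.2) : Plane × ℝ) := by fun_prop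
      simpa [hfy0, Prod.mk_zero_zero] using this.tendsto 0
    have hw1 : Tendsto (fun z : Plane × Plane => ((z.1.1, partialY f z.1) : Plane)) (𝓝 0) (𝓝 0) :=
      (continuous_fst.tendsto (0 : Plane × ℝ)).comp hq1
    have hw2 : Tendsto (fun z : Plane × Plane => ((z.2.1, partialY f z.2) : Plane)) (𝓝 0) (𝓝 0) :=
      (continuous_fst.tendsto (0 : Plane × ℝ)).comp hq2
    -- Half difference and midpoint of the two abscissae are the parameters v and u of the bitangent
    -- family.
    have hv : Tendsto (fun z : Plane × Plane => (((z.1.1 - z.2.1) / 2,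
        ((z.1.1 + z.2.1) / 2, partialY f z.1)) : ℝ × (ℝ × ℝ))) (𝓝 0) (𝓝 0) := by
      have : Continuous fun z : Plane × Plane => (((z.1.1 - z.2.1) / 2,
        ((z.1.1 + z.2.1) / 2, partialY f z.1)) : ℝ × (ℝ × ℝ)) := by fun_prop
      simpa [hfy0, Prod.mk_zero_zero] using this.tendsto 0
    filter_upwards [hq1.eventually hYiff, hq2.eventually hYiff, hw1.eventually hYg,
      hw2.eventually hYg, hv.eventually hUQ,
      ((continuous_fst.tendsto (0 : ℝ × (ℝ × ℝ))).comp hv).eventually hVX]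
      with z a₁ a₂ b₁ b₂ c₁ c₂ hne hs
    obtain ⟨s₁, s₂, s₃⟩ := hs
    have y₁ : z.1.2 = Y (z.1.1, partialY f z.1) := a₁.1 rfl
    have y₂ : z.2.2 = Y (z.2.1, partialY f z.1) := by rw [s₂]; exact a₂.1 rfl
    -- Both points have the form (x, Y(x, q)) with the same q, so distinct points have distinct
    -- abscissae.
    have hx : z.1.1 - z.2.1 ≠ 0 := by
      intro h0
      have h1 : z.1.1 = z.2.1 := sub_eq_zero.1 h0
      exact hne (Prod.ext h1 (by rw [y₁, y₂, h1]))
    rw [← s₂] at b₂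
    obtain ⟨-, p₂, p₃, -⟩ := b₁
    obtain ⟨-, q₂, q₃, -⟩ := b₂
    simp only [← y₁, ← y₂] at p₂ p₃ q₂ q₃
    have e₁ : (z.1.1 + z.2.1) / 2 + (z.1.1 - z.2.1) / 2 = z.1.1 := by ring
    have e₂ : (z.1.1 + z.2.1) / 2 - (z.1.1 - z.2.1) / 2 = z.2.1 := by ring
    have hc := c₁ (div_ne_zero hx two_ne_zero)
    simp only [e₁, e₂] at hc
    obtain ⟨hu, hq⟩ := hc.1 ⟨by rw [p₃, q₃]; exact s₁, by
      rw [p₂, q₂, p₃]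
      change f z.1 - _ - (f z.2 - _) = _ * partialX f z.1
      rw [← s₂, ← s₁] at s₃
      linear_combination s₃⟩
    have hVv : V z.1.1 = (z.1.1 - z.2.1) / 2 := by
      simp only [Function.comp] at c₂
      rw [← hu, e₁] at c₂
      exact c₂
    rw [hVv, ← hq]
    exact y₁
  · have : Tendsto (fun v => ((U v + (-1) * v, Y (U v + (-1) * v, Q v)) : Plane)) (𝓝 0) (𝓝 0) := by
      have h₁ := ((hU.add ((contDiff_const (c := (-1 : ℝ))).smoothNear (0 : ℝ) |>.mul hid)).prodMk
        (hYsm (-1))).continuousAt.tendsto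
      simpa [hU0, hQ0, Prod.mk_zero_zero, hY0] using h₁
    exact this.comp hVt
  · filter_upwards [hVt.eventually hsame, hXV] with x h₁ hx hx0
    have hv0 : V x ≠ 0 := by
      intro h0
      rw [h0, hU0] at hx
      exact hx0 (by linarith)
    have hs := h₁ hv0
    simp only [one_mul, hx] at hs
    refine ⟨fun he => ?_, hs⟩
    have : U (V x) + -1 * V x = x := congrArg Prod.fst he
    exact hv0 (by linarith)

/-! ### Contact and tangent planes in a graph chart -/

theorem SmoothNear.taylor_four {f : ℝ → ℝ} (hf : SmoothNear f 0) :
    (fun t => f t - f 0 - t * deriv f 0 - t ^ 2 / 2 * deriv (deriv f) 0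
      - t ^ 3 / 6 * deriv (deriv (deriv f)) 0 - t ^ 4 / 24 * deriv (deriv (deriv (deriv f))) 0)
      =o[𝓝 0] fun t => t ^ 4 := by
  have hd : ∀ᶠ t in 𝓝 0, HasDerivAt
      (fun t => f t - f 0 - t * deriv f 0 - t ^ 2 / 2 * deriv (deriv f) 0
        - t ^ 3 / 6 * deriv (deriv (deriv f)) 0 - t ^ 4 / 24 * deriv (deriv (deriv (deriv f))) 0)
      (deriv f t - deriv f 0 - t * deriv (deriv f) 0 - t ^ 2 / 2 * deriv (deriv (deriv f)) 0
        - t ^ 3 / 6 * deriv (deriv (deriv (deriv f))) 0) t := by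
    filter_upwards [hf.eventually_differentiableAt] with t ht
    have h₁ := ((((ht.hasDerivAt.sub_const (f 0)).sub
      ((hasDerivAt_id t).mul_const (deriv f 0))).sub
      ((((hasDerivAt_id t).pow 2).div_const 2).mul_const (deriv (deriv f) 0))).sub
      ((((hasDerivAt_id t).pow 3).div_const 6).mul_const (deriv (deriv (deriv f)) 0))).sub
      ((((hasDerivAt_id t).pow 4).div_const 24).mul_const (deriv (deriv (deriv (deriv f))) 0))
    refine h₁.congr_deriv ?_
    simp only [id_eq, Nat.cast_ofNat]
    ring
  refine isLittleO_pow_succ_of_deriv (n := 3) (hd.mono fun t ht => ht.differentiableAt)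
    (by simp) ?_
  exact hf.deriv.taylor_three.congr' (hd.mono fun t ht => ht.deriv.symm) EventuallyEq.rfl

/-- The derivative of `h` in the constant direction `w`. -/
noncomputable def directional (w : Plane) (h : Plane → ℝ) : Plane → ℝ :=
  fun p => w.1 * partialX h p + w.2 * partialY h p

protected theorem ContDiff.directional {h : Plane → ℝ} (hh : ContDiff ℝ ∞ h) (w : Plane) :
    ContDiff ℝ ∞ (directional w h) :=
  (contDiff_const.mul hh.partialX).add (contDiff_const.mul hh.partialY)

theorem ContDiff.deriv_line {h : Plane → ℝ} (hh : ContDiff ℝ ∞ h) (p w : Plane) :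
    deriv (fun s : ℝ => h (p + s • w)) = fun s => _root_.directional w h (p + s • w) := by
  funext s
  have h₁ : HasDerivAt (fun t : ℝ => p + t • w) w s := by
    simpa using ((hasDerivAt_id s).smul_const w).const_add p
  have h₂ := ((hh.differentiable (by simp)) (p + s • w)).hasFDerivAt.comp_hasDerivAt s h₁
  rw [fderiv_apply_eq_partial] at h₂
  exact h₂.deriv

theorem partialX_directional {h : Plane → ℝ} (hh : ContDiff ℝ ∞ h) (w : Plane) :
    partialX (directional w h) = directional w (partialX h) := by
  ext p
  have h₁ := (hh.partialX.differentiable (by simp)) p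
  have h₂ := (hh.partialY.differentiable (by simp)) p
  refine (partialX_eq (((hh.directional w).differentiable (by simp)) p)
    (((hasDerivAt_partialX h₁).const_mul w.1).add
      ((hasDerivAt_partialX h₂).const_mul w.2))).trans ?_
  rw [partialX_partialY_comm hh]
  rfl

theorem partialY_directional {h : Plane → ℝ} (hh : ContDiff ℝ ∞ h) (w : Plane) :
    partialY (directional w h) = directional w (partialY h) := by
  ext p
  have h₁ := (hh.partialX.differentiable (by simp)) p
  have h₂ := (hh.partialY.differentiable (by simp)) p
  refine (partialY_eq (((hh.directional w).differentiable (by simp)) p)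
    (((hasDerivAt_partialY h₁).const_mul w.1).add
      ((hasDerivAt_partialY h₂).const_mul w.2))).trans ?_
  rw [← partialX_partialY_comm hh]
  rfl

theorem directional_directional {f : Plane → ℝ} (hf : ContDiff ℝ ∞ f) (w p : Plane) :
    directional w (directional w f) p = quadForm f p w := by
  rw [directional, partialX_directional hf, partialY_directional hf]
  simp only [directional, quadForm, partialX_partialY_comm hf]
  ring

theorem directional_directional_directional {f : Plane → ℝ} (hf : ContDiff ℝ ∞ f) (w p : Plane) :
    directional w (directional w (directional w f)) p = cubicForm f p w := by
  rw [directional_directional (hf.directional w)]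
  simp only [quadForm, partialX_directional hf, partialY_directional hf,
    partialX_directional hf.partialX, partialY_directional hf.partialX,
    partialY_directional hf.partialY]
  simp only [directional, cubicForm, partialX_partialY_comm hf,
    partialX_partialY_comm hf.partialX, partialX_partialY_comm hf.partialY]
  ring

/-- The second and third derivatives of `f` along a line vanish as soon as the second order Taylor
remainder is small along points that go to the origin at unit speed. -/
theorem taylor_coeff_eq_zero {F β : ℝ → ℝ} (hF : SmoothNear F 0)
    (hβ : (fun t => β t - t) =o[𝓝 0] fun t : ℝ => t) {k : ℕ}
    (h : (fun t => F (β t) - F 0 - β t * deriv F 0) =O[𝓝 0] fun t : ℝ => t ^ k) :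
    (3 ≤ k → deriv (deriv F) 0 = 0) ∧ (4 ≤ k → deriv (deriv (deriv F)) 0 = 0) := by
  -- Since β is equivalent to t, powers of t and of β are interchangeable, and the Taylor expansion
  -- of F at β(t) can be compared term by term.
  have heq : IsEquivalent (𝓝 0) β (fun t : ℝ => t) := hβ
  have hβO := heq.isBigO
  have hβΩ := heq.symm.isBigO
  have hβt : Tendsto β (𝓝 0) (𝓝 0) := hβO.trans_tendsto tendsto_id
  have hne : ∀ n : ℕ, ∀ᶠ t in 𝓝[≠] (0 : ℝ), β t ^ n ≠ 0 := fun n => by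
    filter_upwards [(nhdsWithin_le_nhds (s := {0}ᶜ)) hβΩ.eq_zero_imp, self_mem_nhdsWithin]
      with t h₁ h₂ using pow_ne_zero _ fun h0 => h₂ (h₁ h0)
  have hpow : ∀ {m n : ℕ}, m < n → (fun t : ℝ => t ^ n) =o[𝓝 0] fun t => β t ^ m :=
    fun hmn => (isLittleO_pow_pow hmn).trans_isBigO (hβΩ.pow _)
  have h2 : 3 ≤ k → deriv (deriv F) 0 = 0 := fun hk => by
    have h₁ := (h.trans_isLittleO (hpow (m := 2) (by omega))).sub (hF.taylor_two.comp_tendsto hβt)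
    have h₂ : (fun t => deriv (deriv F) 0 * β t ^ 2) =o[𝓝 0] fun t => β t ^ 2 :=
      (h₁.const_mul_left 2).congr_left fun t => by simp only [Function.comp]; ring
    exact eq_zero_of_isLittleO_self (hne 2) (h₂.mono nhdsWithin_le_nhds)
  refine ⟨h2, fun hk => ?_⟩
  have h₁ := (h.trans_isLittleO (hpow (m := 3) (by omega))).sub (hF.taylor_three.comp_tendsto hβt)
  have h₂ : (fun t => deriv (deriv (deriv F)) 0 * β t ^ 3) =o[𝓝 0] fun t => β t ^ 3 :=
    (h₁.const_mul_left 6).congr_left fun t => by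
      simp only [Function.comp, h2 (by omega)]; ring
  exact eq_zero_of_isLittleO_self (hne 3) (h₂.mono nhdsWithin_le_nhds)

/-- Homogeneous coordinates of the point of the graph of `f` over `p`. -/
def graphPoint (f : Plane → ℝ) (p : Plane) : HomCoord := ![1, p.1, p.2, f p]

theorem hasFDerivAt_graphPoint {f : Plane → ℝ} (hf : ContDiff ℝ ∞ f) (p : Plane) :
    HasFDerivAt (graphPoint f) (ContinuousLinearMap.pi
      ![0, .fst ℝ ℝ ℝ, .snd ℝ ℝ ℝ, fderiv ℝ f p]) p := by
  rw [hasFDerivAt_pi']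
  intro i
  fin_cases i
  · exact hasFDerivAt_const (1 : ℝ) p
  · exact hasFDerivAt_fst
  · exact hasFDerivAt_snd
  · exact ((hf.differentiable (by simp)) p).hasFDerivAt

/-- After the projective transformation `T`, the surface is near `u` the graph of `f` over the
plane, to which it is projected diffeomorphically by `ψ`; the function `κ` is the factor between
the homogeneous coordinates. -/
structure IsGraphChart (S : ProjSurface) (T : HomCoord ≃ₗ[ℝ] HomCoord) (f : Plane → ℝ)
    (ψ : Plane → Plane) (κ : Plane → ℝ) (u : Plane) : Prop where
  mem : u ∈ S.dom
  contDiff : ContDiff ℝ ∞ f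
  smooth : SmoothNear ψ u
  smooth_factor : SmoothNear κ u
  factor_ne_zero : κ u ≠ 0
  eq_graph : ∀ᶠ v in 𝓝 u, T (S.r v) = κ v • graphPoint f (ψ v)
  injective : ∀ w, fderiv ℝ ψ u w = 0 → w = 0

namespace IsGraphChart

variable {S : ProjSurface} {T : HomCoord ≃ₗ[ℝ] HomCoord} {f : Plane → ℝ} {ψ : Plane → Plane}
  {κ : Plane → ℝ} {u : Plane}

theorem surjective (hu : IsGraphChart S T f ψ κ u) (W : Plane) : ∃ w, fderiv ℝ ψ u w = W :=
  (LinearMap.injective_iff_surjective (f := (fderiv ℝ ψ u).toLinearMap)).1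
    ((injective_iff_map_eq_zero _).2 hu.injective) W

theorem map_r (hu : IsGraphChart S T f ψ κ u) : T (S.r u) = κ u • graphPoint f (ψ u) :=
  hu.eq_graph.self_of_nhds

theorem differentiableAt_r (hu : u ∈ S.dom) : DifferentiableAt ℝ S.r u :=
  (S.smooth.contDiffAt (S.isOpen_dom.mem_nhds hu)).differentiableAt (by simp)

theorem map_fderiv (hu : IsGraphChart S T f ψ κ u) (w : Plane) :
    T (fderiv ℝ S.r u w) = fderiv ℝ κ u w • graphPoint f (ψ u) +
      κ u • ![0, (fderiv ℝ ψ u w).1, (fderiv ℝ ψ u w).2, fderiv ℝ f (ψ u) (fderiv ℝ ψ u w)] := by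
  have h₁ : HasFDerivAt (fun v => T (S.r v))
      ((T.toContinuousLinearEquiv : HomCoord →L[ℝ] HomCoord) ∘L fderiv ℝ S.r u) u :=
    (T.toContinuousLinearEquiv : HomCoord →L[ℝ] HomCoord).hasFDerivAt.comp u
      (differentiableAt_r hu.mem).hasFDerivAt
  have h₂ := hu.smooth_factor.differentiableAt.hasFDerivAt.smul
    ((hasFDerivAt_graphPoint hu.contDiff (ψ u)).comp u hu.smooth.differentiableAt.hasFDerivAt)
  have h₃ := h₁.unique (h₂.congr_of_eventuallyEq hu.eq_graph)
  have h₄ := congrArg (fun L : Plane →L[ℝ] HomCoord => L w) h₃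
  refine Eq.trans h₄ ?_
  rw [add_comm]
  ext i
  fin_cases i <;> simp [graphPoint]

/-- An arbitrary curve on the surface is replaced by the straight line in the chart. Its projection
is ψ(u) + βW + O(tᵏ), where β = t + o(t) because k ≥ 2 makes the error negligible at first order; f
is locally Lipschitz, so the projection may be moved onto the line. -/
theorem contact_remainder (hu : IsGraphChart S T f ψ κ u) {w : Plane} (hw : w ≠ 0) {k : ℕ}
    (hk : 2 ≤ k) (h : S.HasContact u w k) :
    ∃ β : ℝ → ℝ, ((fun t => β t - t) =o[𝓝 0] fun t : ℝ => t) ∧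
      (fun t => f (ψ u + β t • fderiv ℝ ψ u w) - f (ψ u) -
        β t * fderiv ℝ f (ψ u) (fderiv ℝ ψ u w)) =O[𝓝 0] fun t : ℝ => t ^ k := by
  obtain ⟨c, hc, hc0, hcd, a, b, hab⟩ := h
  set W := fderiv ℝ ψ u w with hW
  have hW0 : W ≠ 0 := fun h0 => hw (hu.injective w h0)
  have hct : Tendsto c (𝓝 0) (𝓝 u) := by
    have := hc.continuousAt.tendsto
    rwa [hc0] at this
  have hcomp : ∀ i, (fun t => T (S.r (c t) - (a t • S.r u + b t • fderiv ℝ S.r u w)) i)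
      =O[𝓝 0] fun t : ℝ => t ^ k := fun i =>
    (((ContinuousLinearMap.proj (R := ℝ) (φ := fun _ : Fin 4 => ℝ) i) ∘L
      (T.toContinuousLinearEquiv : HomCoord →L[ℝ] HomCoord)).isBigO_comp _ _).trans hab
  let A : ℝ → ℝ := fun t => a t * κ u + b t * fderiv ℝ κ u w
  let β : ℝ → ℝ := fun t => b t * κ u / κ (c t)
  have hκt : Tendsto (fun t => κ (c t)) (𝓝 0) (𝓝 (κ u)) :=
    hu.smooth_factor.continuousAt.tendsto.comp hct
  have hinv : (fun t => (κ (c t))⁻¹) =O[𝓝 0] fun _ => (1 : ℝ) :=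
    (hκt.inv₀ hu.factor_ne_zero).isBigO_one ℝ
  have hne : ∀ᶠ t in 𝓝 0, κ (c t) ≠ 0 := hκt.eventually_ne hu.factor_ne_zero
  have key : ∀ (i : Fin 4) (d : ℝ), ![0, W.1, W.2, fderiv ℝ f (ψ u) W] i = d →
      (fun t => graphPoint f (ψ (c t)) i - graphPoint f (ψ u) i - β t * d)
        =O[𝓝 0] fun t : ℝ => t ^ k := by
    intro i d hd
    -- Subtracting a multiple of the zeroth coordinate eliminates a(t); dividing by κ(c t) passes to
    -- affine coordinates.
    have h₁ := ((hcomp i).sub ((hcomp 0).const_mul_left (graphPoint f (ψ u) i))).mul hinv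
    simp only [mul_one] at h₁
    refine h₁.congr' ?_ EventuallyEq.rfl
    filter_upwards [hne, hct.eventually hu.eq_graph] with t h₀ ht
    simp only [map_sub, map_add, map_smul, ht, hu.map_r, hu.map_fderiv w, ← hW, Pi.sub_apply,
      Pi.add_apply, Pi.smul_apply, smul_eq_mul, hd, β]
    simp only [graphPoint, Matrix.cons_val_zero]
    field_simp
    ring
  have hx := key 1 W.1 rfl
  have hy := key 2 W.2 rfl
  have hf := key 3 _ rfl
  simp only [graphPoint, Matrix.cons_val] at hx hy hf
  have hdiff : (fun t => ψ (c t) - (ψ u + β t • W)) =O[𝓝 0] fun t : ℝ => t ^ k := by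
    refine (hx.prod_left hy).congr_left fun t => ?_
    ext <;> simp <;> ring
  have hk1 : (fun t : ℝ => t ^ k) =o[𝓝 0] fun t => t := by
    simpa using isLittleO_pow_pow (𝕜 := ℝ) (m := 1) (n := k) (by omega)
  have hψc : (fun t => ψ (c t) - ψ u - t • W) =o[𝓝 0] fun t : ℝ => t := by
    have hcd' : HasDerivAt c w 0 := by
      rw [← hcd]; exact hc.differentiableAt.hasDerivAt
    have hψ' : HasFDerivAt ψ (fderiv ℝ ψ u) (c 0) := by
      rw [hc0]; exact hu.smooth.differentiableAt.hasFDerivAt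
    have := hasDerivAt_iff_isLittleO.1 (hψ'.comp_hasDerivAt (0 : ℝ) hcd')
    simpa [hc0] using this
  have hβW : (fun t => (β t - t) • W) =o[𝓝 0] fun t : ℝ => t := by
    refine (hψc.sub (hdiff.trans_isLittleO hk1)).congr_left fun t => ?_
    rw [sub_smul]
    abel
  have hβ : (fun t => β t - t) =o[𝓝 0] fun t : ℝ => t := by
    have hWn : ‖W‖ ≠ 0 := norm_ne_zero_iff.2 hW0
    have h₁ : (fun t => ‖W‖ * (β t - t)) =o[𝓝 0] fun t : ℝ => t := by
      refine IsLittleO.of_norm_left (hβW.norm_left.congr_left fun t => ?_)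
      rw [norm_smul, norm_mul, norm_norm, mul_comm]
    exact (isLittleO_const_mul_left_iff hWn).1 h₁
  refine ⟨β, hβ, ?_⟩
  have hβt : Tendsto β (𝓝 0) (𝓝 0) := by
    have h₁ : Tendsto (fun t => β t - t) (𝓝 0) (𝓝 0) := hβ.trans_tendsto tendsto_id
    simpa using h₁.add tendsto_id
  have hlip : (fun t => f (ψ (c t)) - f (ψ u + β t • W)) =O[𝓝 0] fun t : ℝ => t ^ k := by
    have h₁ := ((hu.contDiff.contDiffAt (x := ψ u)).hasStrictFDerivAt (by simp)).isBigO_sub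
    have h₂ : Tendsto (fun t => (ψ (c t), ψ u + β t • W)) (𝓝 0) (𝓝 (ψ u, ψ u)) := by
      refine (hu.smooth.continuousAt.tendsto.comp hct).prodMk_nhds ?_
      simpa using (hβt.smul_const W).const_add (ψ u)
    exact (h₁.comp_tendsto h₂).trans hdiff
  exact (hf.sub hlip).congr_left fun t => by ring

/-- The curve is the lift to the surface of the straight line ψ(u) + tW of the chart. -/
theorem hasContact_of_remainder (hu : IsGraphChart S T f ψ κ u) (w : Plane) {k : ℕ}
    (h : (fun t : ℝ => f (ψ u + t • fderiv ℝ ψ u w) - f (ψ u) -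
        t * fderiv ℝ f (ψ u) (fderiv ℝ ψ u w)) =O[𝓝 0] fun t : ℝ => t ^ k) :
    S.HasContact u w k := by
  obtain ⟨θ, hθ, hθu, -, hψθ⟩ := hu.smooth.exists_inverse rfl hu.injective
  set W := fderiv ℝ ψ u w with hW
  have hline : SmoothNear (fun t : ℝ => ψ u + t • W) 0 := ContDiff.smoothNear (by fun_prop) 0
  have hc : SmoothNear (fun t : ℝ => θ (ψ u + t • W)) 0 :=
    SmoothNear.comp 0 (g := θ) (by simpa using hθ) hline
  have hlt : Tendsto (fun t : ℝ => ψ u + t • W) (𝓝 0) (𝓝 (ψ u)) := by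
    simpa using hline.continuousAt.tendsto
  have hct : Tendsto (fun t : ℝ => θ (ψ u + t • W)) (𝓝 0) (𝓝 u) := by
    simpa [hθu] using hc.continuousAt.tendsto
  have hψc : ∀ᶠ t in 𝓝 (0 : ℝ), ψ (θ (ψ u + t • W)) = ψ u + t • W := hlt.eventually hψθ
  let c : ℝ → Plane := fun t => θ (ψ u + t • W)
  -- With these a and b the first three homogeneous coordinates agree exactly; the last one differs
  -- by κ(c t) times the remainder in the hypothesis.
  let b : ℝ → ℝ := fun t => t * κ (c t) / κ u
  let a : ℝ → ℝ := fun t => (κ (c t) - b t * fderiv ℝ κ u w) / κ u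
  have hc0 : c 0 = u := by simp [c, hθu]
  refine ⟨c, hc, hc0, ?_, a, b, ?_⟩
  · have h₁ : HasDerivAt (fun t => ψ (c t)) (fderiv ℝ ψ u (deriv c 0)) 0 := by
      have hψ' : HasFDerivAt ψ (fderiv ℝ ψ u) (c 0) := by
        rw [hc0]; exact hu.smooth.differentiableAt.hasFDerivAt
      exact hψ'.comp_hasDerivAt (0 : ℝ) hc.differentiableAt.hasDerivAt
    have h₂ : HasDerivAt (fun t : ℝ => ψ u + t • W) W 0 := by
      simpa using ((hasDerivAt_id (0 : ℝ)).smul_const W).const_add (ψ u)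
    have h₃ := h₁.unique (h₂.congr_of_eventuallyEq hψc)
    refine sub_eq_zero.1 (hu.injective _ ?_)
    rw [map_sub, h₃, ← hW, sub_self]
  · have hκ : (fun t => κ (c t)) =O[𝓝 0] fun _ => (1 : ℝ) :=
      (hu.smooth_factor.continuousAt.tendsto.comp hct).isBigO_one ℝ
    have hR := hκ.mul h
    simp only [one_mul] at hR
    have hR' := hR.smul (isBigO_refl (fun _ : ℝ => T.symm ![0, 0, 0, 1]) (𝓝 0))
    have hR'' := hR'.trans ((isBigO_refl (fun t : ℝ => t ^ k) (𝓝 0)).smul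
      ((tendsto_const_nhds (x := T.symm ![0, 0, 0, 1])).isBigO_one ℝ))
    simp only [smul_eq_mul, mul_one] at hR''
    refine hR''.congr' ?_ EventuallyEq.rfl
    filter_upwards [hψc, hct.eventually hu.eq_graph] with t ht hgt
    apply T.injective
    have hu0 := hu.factor_ne_zero
    rw [map_smul, LinearEquiv.apply_symm_apply]
    change _ = T (S.r (c t) - (a t • S.r u + b t • fderiv ℝ S.r u w))
    rw [map_sub, map_add, map_smul, map_smul, hu.map_r, hu.map_fderiv w, ← hW]
    change T (S.r (c t)) = κ (c t) • graphPoint f (ψ (c t)) at hgt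
    change ψ (c t) = ψ u + t • W at ht
    rw [hgt, ht]
    ext i
    fin_cases i <;> simp [graphPoint, a, b] <;> field_simp <;> ring

/-- The quadratic and cubic forms are the second and third derivatives of f along the line ψ(u) +
sW. One direction reads them off from the remainder; the other is Taylor's formula, in which the
first surviving term has order k. -/
theorem hasContact_iff (hu : IsGraphChart S T f ψ κ u) {w : Plane} (hw : w ≠ 0) :
    (S.HasContact u w 3 ↔ quadForm f (ψ u) (fderiv ℝ ψ u w) = 0) ∧
    (S.HasContact u w 4 ↔ quadForm f (ψ u) (fderiv ℝ ψ u w) = 0 ∧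
      cubicForm f (ψ u) (fderiv ℝ ψ u w) = 0) := by
  set W := fderiv ℝ ψ u w with hW
  have hf := hu.contDiff
  let F : ℝ → ℝ := fun s => f (ψ u + s • W)
  have hF : SmoothNear F 0 := (hf.comp (by fun_prop :
    ContDiff ℝ ∞ fun s : ℝ => ψ u + s • W)).smoothNear 0
  have hF0 : F 0 = f (ψ u) := by simp [F]
  have d₁ : deriv F = fun s => directional W f (ψ u + s • W) := hf.deriv_line _ _
  have d₂ : deriv (deriv F) = fun s => directional W (directional W f) (ψ u + s • W) := by
    rw [d₁]; exact (hf.directional W).deriv_line _ _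
  have d₃ : deriv (deriv (deriv F)) =
      fun s => directional W (directional W (directional W f)) (ψ u + s • W) := by
    rw [d₂]; exact ((hf.directional W).directional W).deriv_line _ _
  have e₁ : deriv F 0 = fderiv ℝ f (ψ u) W := by
    rw [d₁, fderiv_apply_eq_partial]; simp [directional]
  have e₂ : deriv (deriv F) 0 = quadForm f (ψ u) W := by
    rw [d₂, ← directional_directional hf]; simp
  have e₃ : deriv (deriv (deriv F)) 0 = cubicForm f (ψ u) W := by
    rw [d₃, ← directional_directional_directional hf]; simp
  have forward : ∀ k, 2 ≤ k → S.HasContact u w k →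
      (3 ≤ k → quadForm f (ψ u) W = 0) ∧ (4 ≤ k → cubicForm f (ψ u) W = 0) := by
    intro k hk hcon
    obtain ⟨β, hβ, hR⟩ := hu.contact_remainder hw hk hcon
    have := taylor_coeff_eq_zero hF hβ (k := k) (by rw [hF0, e₁]; exact hR)
    rwa [e₂, e₃] at this
  have hT3 := hF.taylor_three
  have hT4 := hF.taylor_four
  rw [hF0, e₁, e₂, e₃] at hT3 hT4
  refine ⟨⟨fun h => (forward 3 (by norm_num) h).1 le_rfl, fun h => ?_⟩,
    ⟨fun h => ⟨(forward 4 (by norm_num) h).1 (by norm_num),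
      (forward 4 (by norm_num) h).2 le_rfl⟩, fun ⟨h, h'⟩ => ?_⟩⟩
  · refine hu.hasContact_of_remainder w ?_
    rw [← hW]
    refine (hT3.isBigO.add ((isBigO_refl (fun t : ℝ => t ^ 3) _).const_mul_left
      (cubicForm f (ψ u) W / 6))).congr_left fun t => ?_
    simp only [h, F]
    ring
  · refine hu.hasContact_of_remainder w ?_
    rw [← hW]
    refine (hT4.isBigO.add ((isBigO_refl (fun t : ℝ => t ^ 4) _).const_mul_left
      (deriv (deriv (deriv (deriv F))) 0 / 24))).congr_left fun t => ?_
    simp only [h, h', F]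
    ring

/-- This is the affine equation of the tangent plane of the graph, made homogeneous. The factor κ
only moves multiples of `r u` around; conversely, invertibility of dψ supplies the tangent vector
with the required x and y coordinates. -/
theorem mem_tangentPlane_iff (hu : IsGraphChart S T f ψ κ u) (h : HomCoord) :
    h ∈ S.tangentPlane u ↔ T h 3 =
      (f (ψ u) - (ψ u).1 * partialX f (ψ u) - (ψ u).2 * partialY f (ψ u)) * T h 0 +
        partialX f (ψ u) * T h 1 + partialY f (ψ u) * T h 2 := by
  rw [ProjSurface.tangentPlane, Submodule.mem_sup]
  constructor
  · rintro ⟨y, hy, z, ⟨w, rfl⟩, rfl⟩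
    obtain ⟨a, rfl⟩ := Submodule.mem_span_singleton.1 hy
    change T (a • S.r u + fderiv ℝ S.r u w) 3 = _ * T (a • S.r u + fderiv ℝ S.r u w) 0 +
      _ * T (a • S.r u + fderiv ℝ S.r u w) 1 + _ * T (a • S.r u + fderiv ℝ S.r u w) 2
    rw [map_add, map_smul, hu.map_r, hu.map_fderiv, fderiv_apply_eq_partial f]
    simp [graphPoint]
    ring
  · intro hh
    have hu0 := hu.factor_ne_zero
    obtain ⟨w, hw⟩ := hu.surjective ((κ u)⁻¹ • (T h 1 - T h 0 * (ψ u).1, T h 2 - T h 0 * (ψ u).2))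
    refine ⟨((T h 0 - fderiv ℝ κ u w) / κ u) • S.r u, Submodule.smul_mem _ _
      (Submodule.mem_span_singleton_self _), fderiv ℝ S.r u w, ⟨w, rfl⟩, T.injective ?_⟩
    rw [map_add, map_smul, hu.map_r, hu.map_fderiv, fderiv_apply_eq_partial f, hw]
    ext i
    fin_cases i
    · simp [graphPoint]; field_simp; ring
    · simp [graphPoint]; field_simp; ring
    · simp [graphPoint]; field_simp; ring
    · simp [graphPoint, hh]; field_simp; ring

theorem tangentPlane_eq_iff {v : Plane} (hu : IsGraphChart S T f ψ κ u)
    (hv : IsGraphChart S T f ψ κ v) :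
    S.tangentPlane u = S.tangentPlane v ↔ SameTangentPlane f (ψ u) (ψ v) := by
  constructor
  · intro h
    have key : ∀ y : HomCoord, y 3 =
        (f (ψ u) - (ψ u).1 * partialX f (ψ u) - (ψ u).2 * partialY f (ψ u)) * y 0 +
          partialX f (ψ u) * y 1 + partialY f (ψ u) * y 2 → y 3 =
        (f (ψ v) - (ψ v).1 * partialX f (ψ v) - (ψ v).2 * partialY f (ψ v)) * y 0 +
          partialX f (ψ v) * y 1 + partialY f (ψ v) * y 2 := by
      intro y hy
      have := (hv.mem_tangentPlane_iff (T.symm y)).1 (h ▸ (hu.mem_tangentPlane_iff (T.symm y)).2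
        (by simpa using hy))
      simpa using this
    have k₀ := key ![1, 0, 0, f (ψ u) - (ψ u).1 * partialX f (ψ u) - (ψ u).2 * partialY f (ψ u)]
      (by simp)
    have k₁ := key ![0, 1, 0, partialX f (ψ u)] (by simp)
    have k₂ := key ![0, 0, 1, partialY f (ψ u)] (by simp)
    simp at k₀ k₁ k₂
    exact ⟨k₁, k₂, k₀⟩
  · rintro ⟨h₁, h₂, h₃⟩
    ext y
    rw [hu.mem_tangentPlane_iff, hv.mem_tangentPlane_iff, h₃, h₁, h₂]

theorem isAsymptotic_iff (hu : IsGraphChart S T f ψ κ u) (w : Plane) :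
    S.IsAsymptotic u w ↔ w ≠ 0 ∧ quadForm f (ψ u) (fderiv ℝ ψ u w) = 0 :=
  and_congr_right fun hw => (hu.hasContact_iff hw).1

theorem mem_flecnodalCurve_iff (hu : IsGraphChart S T f ψ κ u) :
    u ∈ S.flecnodalCurve ↔ ∃ W, W ≠ 0 ∧ quadForm f (ψ u) W = 0 ∧ cubicForm f (ψ u) W = 0 := by
  constructor
  · rintro ⟨-, w, ⟨hw, -⟩, h⟩
    exact ⟨fderiv ℝ ψ u w, fun h0 => hw (hu.injective w h0), ((hu.hasContact_iff hw).2).1 h⟩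
  · rintro ⟨W, hW, h⟩
    obtain ⟨w, rfl⟩ := hu.surjective W
    have hw : w ≠ 0 := by rintro rfl; simp at hW
    exact ⟨hu.mem, w, (hu.isAsymptotic_iff w).2 ⟨hw, h.1⟩, ((hu.hasContact_iff hw).2).2 h⟩

/-- For f_yy ≠ 0 no null direction is vertical, so the form is a genuine quadratic in the slope, and
it has exactly one root when its discriminant vanishes. -/
theorem mem_parabolicCurve_iff (hu : IsGraphChart S T f ψ κ u)
    (hyy : partialY (partialY f) (ψ u) ≠ 0) :
    u ∈ S.parabolicCurve ↔ hessianDet f (ψ u) = 0 := by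
  set A := partialX (partialX f) (ψ u) with hA
  set B := partialY (partialX f) (ψ u) with hB
  set C := partialY (partialY f) (ψ u) with hC
  have hq : ∀ W : Plane, quadForm f (ψ u) W = W.1 ^ 2 * A + 2 * W.1 * W.2 * B + W.2 ^ 2 * C :=
    fun W => rfl
  have hdet : hessianDet f (ψ u) = A * C - B ^ 2 := rfl
  rw [hdet]
  constructor
  · rintro ⟨-, w, hw, huniq⟩
    obtain ⟨hw0, hwq⟩ := (hu.isAsymptotic_iff w).1 hw
    set W := fderiv ℝ ψ u w with hW
    rw [hq] at hwq
    have hW1 : W.1 ≠ 0 := by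
      intro h0
      have h2 : W.2 = 0 := by simpa [h0, hyy] using hwq
      exact hw0 (hu.injective w (Prod.ext h0 h2))
    -- The second root by Vieta, m' = -2B/C - m, with denominators cleared. Uniqueness makes it
    -- proportional to W, so the root is double.
    obtain ⟨w', hw'⟩ := hu.surjective (C * W.1, -2 * B * W.1 - C * W.2)
    have hw'0 : w' ≠ 0 := by
      rintro rfl
      rw [map_zero] at hw'
      exact mul_ne_zero hyy hW1 (congrArg Prod.fst hw').symm
    have hmem := huniq w' ((hu.isAsymptotic_iff w').2 ⟨hw'0, by
      rw [hw', hq]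
      linear_combination C ^ 2 * hwq⟩)
    obtain ⟨k, rfl⟩ := Submodule.mem_span_singleton.1 hmem
    rw [map_smul, ← hW] at hw'
    have e₁ : k * W.1 = C * W.1 := congrArg Prod.fst hw'
    have e₂ : k * W.2 = -2 * B * W.1 - C * W.2 := congrArg Prod.snd hw'
    have hk : k = C := mul_right_cancel₀ hW1 e₁
    rw [hk] at e₂
    have e₃ : C * W.2 + B * W.1 = 0 := by linarith
    have : W.1 ^ 2 * (A * C - B ^ 2) = 0 := by
      linear_combination C * hwq - (C * W.2 + B * W.1) * e₃
    exact (mul_eq_zero.1 this).resolve_left (pow_ne_zero 2 hW1)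
  · intro h
    -- The double root has slope -B/C.
    obtain ⟨w, hw⟩ := hu.surjective (C, -B)
    have hw0 : w ≠ 0 := by
      rintro rfl
      rw [map_zero] at hw
      exact hyy (congrArg Prod.fst hw).symm
    refine ⟨hu.mem, w, (hu.isAsymptotic_iff w).2 ⟨hw0, by
      rw [hw, hq]; linear_combination C * h⟩, fun w' hw' => ?_⟩
    obtain ⟨-, hq'⟩ := (hu.isAsymptotic_iff w').1 hw'
    rw [hq] at hq'
    set W := fderiv ℝ ψ u w' with hW
    have e : C * W.2 + B * W.1 = 0 := by
      have : (C * W.2 + B * W.1) ^ 2 = 0 := by linear_combination C * hq' - W.1 ^ 2 * h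
      exact pow_eq_zero_iff two_ne_zero |>.1 this
    refine Submodule.mem_span_singleton.2 ⟨W.1 / C, sub_eq_zero.1 (hu.injective _ ?_)⟩
    rw [map_sub, map_smul, hw, ← hW]
    ext
    · simp; field_simp; ring
    · simp; field_simp; linarith

end IsGraphChart

/-! ### From the projective surface to the chart; germs of curves -/

theorem exists_isFlat_representative {n : ℕ} {φ : Plane → ℝ} (hφ : SmoothNear φ 0)
    (hjet : ∀ k ≤ n, iteratedFDeriv ℝ k φ 0 = 0) :
    ∃ φ' : Plane → ℝ, IsFlat n φ' ∧ φ' =ᶠ[𝓝 0] φ := by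
  obtain ⟨φ', hφ', heq⟩ := hφ.exists_contDiff
  exact ⟨φ', ⟨hφ', fun k hk => ((heq.iteratedFDeriv ℝ k).self_of_nhds).trans (hjet k hk)⟩, heq⟩

/-- The projection of a surface to the plane of the affine coordinates `x, y`, after the projective
transformation `T`. -/
noncomputable def ProjSurface.affineProjection (S : ProjSurface) (T : HomCoord ≃ₗ[ℝ] HomCoord) :
    Plane → Plane :=
  fun u => (T (S.r u) 1 / T (S.r u) 0, T (S.r u) 2 / T (S.r u) 0)

/-- If dψ(w) = 0, differentiating T r = κ · graphPoint(ψ) makes Dr(w) a multiple of r, and the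
immersion condition forces w = 0. -/
theorem ProjSurface.SentToGraph.eventually_isGraphChart {S : ProjSurface} {g : Plane}
    {T : HomCoord ≃ₗ[ℝ] HomCoord} {f : Plane → ℝ} (hT : S.SentToGraph g T f) (hg : g ∈ S.dom)
    (hf : ContDiff ℝ ∞ f) :
    ∀ᶠ u in 𝓝 g, IsGraphChart S T f (S.affineProjection T) (fun v => T (S.r v) 0) u := by
  have hr : SmoothNear S.r g := by
    filter_upwards [S.isOpen_dom.mem_nhds hg] with u hu
    exact S.smooth.contDiffAt (S.isOpen_dom.mem_nhds hu)
  have hcoord : ∀ i, SmoothNear (fun v => T (S.r v) i) g := fun i =>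
    SmoothNear.comp g (((ContinuousLinearMap.proj (R := ℝ) (φ := fun _ : Fin 4 => ℝ) i) ∘L
      (T.toContinuousLinearEquiv : HomCoord →L[ℝ] HomCoord)).contDiff.smoothNear _) hr
  have h0 : ∀ᶠ u in 𝓝 g, T (S.r u) 0 ≠ 0 := hT.2.2.2.mono fun u hu => hu.1
  have hψ : SmoothNear (S.affineProjection T) g := by
    filter_upwards [hcoord 0, hcoord 1, hcoord 2, h0] with u c₀ c₁ c₂ hu
    exact (c₁.div c₀ hu).prodMk (c₂.div c₀ hu)
  filter_upwards [S.isOpen_dom.mem_nhds hg, hψ.eventually, (hcoord 0).eventually,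
    eventually_eventually_nhds.2 hT.2.2.2] with u hu hψu hκu hTu
  have hgraph : ∀ᶠ v in 𝓝 u, T (S.r v) = T (S.r v) 0 • graphPoint f (S.affineProjection T v) := by
    filter_upwards [hTu] with v hv
    obtain ⟨hv0, hv3⟩ := hv
    ext i
    fin_cases i
    · simp [graphPoint]
    · simp [graphPoint, ProjSurface.affineProjection]; field_simp
    · simp [graphPoint, ProjSurface.affineProjection]; field_simp
    · simp only [graphPoint, ProjSurface.affineProjection, ← hv3]
      simp; field_simp
  refine ⟨hu, hf, hψu, hκu, hTu.self_of_nhds.1, hgraph, fun w hw => ?_⟩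
  have hr' : HasFDerivAt S.r (fderiv ℝ S.r u) u :=
    ((S.smooth.contDiffAt (S.isOpen_dom.mem_nhds hu)).differentiableAt (by simp)).hasFDerivAt
  have h₁ : HasFDerivAt (fun v => T (S.r v))
      ((T.toContinuousLinearEquiv : HomCoord →L[ℝ] HomCoord) ∘L fderiv ℝ S.r u) u :=
    (T.toContinuousLinearEquiv : HomCoord →L[ℝ] HomCoord).hasFDerivAt.comp u hr'
  have h₂ := hκu.differentiableAt.hasFDerivAt.smul
    ((hasFDerivAt_graphPoint hf _).comp u hψu.differentiableAt.hasFDerivAt)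
  have h₃ := congrArg (fun L : Plane →L[ℝ] HomCoord => L w)
    (h₁.unique (h₂.congr_of_eventuallyEq hgraph))
  have h₄ : T (fderiv ℝ S.r u w) =
      fderiv ℝ (fun v => T (S.r v) 0) u w • graphPoint f (S.affineProjection T u) := by
    refine Eq.trans h₃ ?_
    simp [hw]
    exact Or.inr rfl
  have hκ0 := hTu.self_of_nhds.1
  have h₅ : fderiv ℝ S.r u w =
      (fderiv ℝ (fun v => T (S.r v) 0) u w / T (S.r u) 0) • S.r u := by
    apply T.injective
    rw [h₄, map_smul]
    refine Eq.trans ?_ (congrArg (fun y => (fderiv ℝ (fun v => T (S.r v) 0) u w / T (S.r u) 0) • y)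
      hgraph.self_of_nhds).symm
    rw [smul_smul, div_mul_cancel₀ _ hκ0]
  have hw' : w = w.1 • ((1, 0) : Plane) + w.2 • ((0, 1) : Plane) := by ext <;> simp
  have h₆ := S.immersion u hu
  rw [Fintype.linearIndependent_iff] at h₆
  have h₇ := h₆ ![-(fderiv ℝ (fun v => T (S.r v) 0) u w / T (S.r u) 0), w.1, w.2] (by
    have h₈ : fderiv ℝ S.r u w =
        w.1 • fderiv ℝ S.r u (1, 0) + w.2 • fderiv ℝ S.r u (0, 1) := by
      conv_lhs => rw [hw']
      rw [map_add, map_smul, map_smul]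
    simp only [Fin.sum_univ_three, Matrix.cons_val_zero, Matrix.cons_val_one, Matrix.cons_val]
    rw [add_assoc, ← h₈, neg_smul, ← h₅, neg_add_cancel])
  exact Prod.ext (h₇ 1) (h₇ 2)

theorem parametrisesGerm_of_graph {ψ θ : Plane → Plane} {g : Plane} {h : ℝ → ℝ} {C : Set Plane}
    (hψ : SmoothNear ψ g) (hψg : ψ g = 0) (hθ : SmoothNear θ 0) (hθ0 : θ 0 = g)
    (hθψ : ∀ᶠ u in 𝓝 g, θ (ψ u) = u) (hψθ : ∀ᶠ p in 𝓝 0, ψ (θ p) = p)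
    (hh : SmoothNear h 0) (hh0 : h 0 = 0)
    (hC : ∀ᶠ u in 𝓝 g, u ∈ C ↔ (ψ u).2 = h (ψ u).1) :
    ParametrisesGerm (fun t => θ (t, h t)) C g ∧ ∀ᶠ t in 𝓝 0, ψ (θ (t, h t)) = (t, h t) := by
  have hl : SmoothNear (fun t : ℝ => ((t, h t) : Plane)) 0 := (contDiff_id.smoothNear 0).prodMk hh
  have hlt : Tendsto (fun t : ℝ => ((t, h t) : Plane)) (𝓝 0) (𝓝 0) := by
    simpa [hh0, Prod.mk_zero_zero] using hl.continuousAt.tendsto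
  have hγ : SmoothNear (fun t : ℝ => θ (t, h t)) 0 :=
    SmoothNear.comp 0 (g := θ) (by simpa [hh0, Prod.mk_zero_zero] using hθ) hl
  have hγ0 : θ (0, h 0) = g := by rw [hh0, Prod.mk_zero_zero, hθ0]
  have hψγ := hlt.eventually hψθ
  refine ⟨⟨hγ, hγ0, fun h0 => ?_, ?_⟩, hψγ⟩
  · have h₁ : HasDerivAt (fun t => ψ (θ (t, h t))) (fderiv ℝ ψ g 0) 0 := by
      have hψ' : HasFDerivAt ψ (fderiv ℝ ψ g) (θ (0, h 0)) := by
        rw [hγ0]; exact hψ.differentiableAt.hasFDerivAt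
      have := hψ'.comp_hasDerivAt (0 : ℝ) hγ.differentiableAt.hasDerivAt
      rwa [h0] at this
    have h₂ : HasDerivAt (fun t : ℝ => ((t, h t) : Plane)) (1, deriv h 0) 0 :=
      (hasDerivAt_id (0 : ℝ)).prodMk hh.differentiableAt.hasDerivAt
    have h₃ := h₁.unique (h₂.congr_of_eventuallyEq hψγ)
    rw [map_zero] at h₃
    exact zero_ne_one (congrArg Prod.fst h₃)
  · have hψ1 : Tendsto (fun u => (ψ u).1) (𝓝 g) (𝓝 0) := by
      have := (continuous_fst.continuousAt.tendsto.comp hψ.continuousAt.tendsto)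
      rw [hψg] at this
      exact this
    obtain ⟨δ, hδ, hball⟩ := Metric.eventually_nhds_iff_ball.1 hψγ
    -- For ε < δ the whole arc is parametrised by its own first chart coordinate; the neighbourhood
    -- of g then depends on ε, to make that coordinate less than ε in absolute value.
    filter_upwards [Ioo_mem_nhdsGT hδ] with ε hε
    filter_upwards [hC, hθψ, hψ1.eventually (Ioo_mem_nhds (neg_lt_zero.2 hε.1) hε.1)]
      with u hu hθu hu1
    rw [hu]
    constructor
    · intro hu2
      refine ⟨(ψ u).1, hu1, ?_⟩
      simp only [← hu2]
      exact hθu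
    · rintro ⟨t, ht, rfl⟩
      have : t ∈ Metric.ball (0 : ℝ) δ := by
        rw [mem_ball_zero_iff, Real.norm_eq_abs, abs_lt]
        exact ⟨by linarith [ht.1, hε.2], by linarith [ht.2, hε.2]⟩
      rw [hball t this]

theorem ParametrisesGerm.eventually_mem {γ : ℝ → Plane} {C : Set Plane} {g : Plane}
    (h : ParametrisesGerm γ C g) : ∀ᶠ t in 𝓝 0, γ t ∈ C := by
  obtain ⟨hγ, hγ0, -, hC⟩ := h
  obtain ⟨ε, hε, hεpos⟩ := (hC.and self_mem_nhdsWithin).exists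
  have hεpos : 0 < ε := hεpos
  have hγt : Tendsto γ (𝓝 0) (𝓝 g) := hγ0 ▸ hγ.continuousAt.tendsto
  filter_upwards [hγt.eventually hε, Ioo_mem_nhds (neg_lt_zero.2 hεpos) hεpos] with t h₁ h₂
  exact h₁.2 ⟨t, h₂, rfl⟩

/-- The conodal curve near `g` is the graph of `h` in the chart, for all small pieces of surface. -/
theorem conodalCurve_eq_graph {S : ProjSurface} {T : HomCoord ≃ₗ[ℝ] HomCoord} {f : Plane → ℝ}
    {ψ θ : Plane → Plane} {κ : Plane → ℝ} {g : Plane} {h : ℝ → ℝ} {σ : ℝ → Plane}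
    (hchart : ∀ᶠ u in 𝓝 g, IsGraphChart S T f ψ κ u) (hψg : ψ g = 0)
    (hθ : SmoothNear θ 0) (hθ0 : θ 0 = g) (hθψ : ∀ᶠ u in 𝓝 g, θ (ψ u) = u)
    (hψθ : ∀ᶠ p in 𝓝 0, ψ (θ p) = p) (hh : SmoothNear h 0) (hh0 : h 0 = 0)
    (hcon : ∀ᶠ z : Plane × Plane in 𝓝 0, z.1 ≠ z.2 → SameTangentPlane f z.1 z.2 →
      z.1.2 = h z.1.1)
    (hσ : Tendsto σ (𝓝 0) (𝓝 0))
    (hmate : ∀ᶠ x in 𝓝 0, x ≠ 0 → σ x ≠ (x, h x) ∧ SameTangentPlane f (x, h x) (σ x)) :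
    ∃ N ∈ 𝓝 g, ∀ V ∈ 𝓝 g, V ⊆ N →
      ∀ᶠ u in 𝓝 g, u ∈ S.conodalCurve V ↔ (ψ u).2 = h (ψ u).1 := by
  have hψ := hchart.self_of_nhds.smooth
  have hψt : Tendsto ψ (𝓝 g) (𝓝 0) := hψg ▸ hψ.continuousAt.tendsto
  have hψ1 : Tendsto (fun u => (ψ u).1) (𝓝 g) (𝓝 0) := (continuous_fst.tendsto (0 : Plane)).comp hψt
  have hθt : Tendsto θ (𝓝 0) (𝓝 g) := hθ0 ▸ hθ.continuousAt.tendsto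
  have hlt : Tendsto (fun t : ℝ => ((t, h t) : Plane)) (𝓝 0) (𝓝 0) := by
    have := (continuousAt_id.prodMk hh.continuousAt).tendsto
    simpa [hh0, Prod.mk_zero_zero] using this
  -- A single neighbourhood O of the origin must serve both points of a pair. It determines N, on
  -- which ψ is also injective because θ is a left inverse.
  rw [← Prod.mk_zero_zero, nhds_prod_eq] at hcon
  obtain ⟨O, hO, hcon⟩ := (eventually_prod_self_iff (r := fun p q =>
    p ≠ q → SameTangentPlane f p q → p.2 = h p.1)).1 hcon
  refine ⟨{u | u ∈ S.dom ∧ IsGraphChart S T f ψ κ u ∧ θ (ψ u) = u ∧ ψ u ∈ O}, ?_, ?_⟩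
  · filter_upwards [hchart, hθψ, hψt.eventually hO] with u h₁ h₂ h₃ using ⟨h₁.mem, h₁, h₂, h₃⟩
  intro V hV hVN
  set D : Set Plane := {u | u ∈ V ∩ S.dom ∧ ∃ v ∈ V ∩ S.dom, v ≠ u ∧
    S.tangentPlane u = S.tangentPlane v} with hD
  have hsub : ∀ u ∈ D, (ψ u).2 = h (ψ u).1 := by
    rintro u ⟨⟨huV, -⟩, v, ⟨hvV, -⟩, hne, heq⟩
    obtain ⟨-, hu, hθu, huO⟩ := hVN huV
    obtain ⟨-, hv, hθv, hvO⟩ := hVN hvV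
    refine hcon _ huO _ hvO (fun he => hne ?_) ((hu.tangentPlane_eq_iff hv).1 heq)
    rw [← hθu, ← hθv, he]
  have hmem : ∀ᶠ x in 𝓝 0, x ≠ 0 → θ (x, h x) ∈ D := by
    filter_upwards [hmate, (hθt.comp hlt).eventually hV, (hθt.comp hσ).eventually hV,
      (hθt.comp hlt).eventually hchart, (hθt.comp hσ).eventually hchart,
      hlt.eventually hψθ, hσ.eventually hψθ] with x h₁ h₂ h₃ h₄ h₅ h₆ h₇ hx
    simp only [Function.comp] at h₂ h₃ h₄ h₅
    obtain ⟨hne, hs⟩ := h₁ hx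
    refine ⟨⟨h₂, h₄.mem⟩, θ (σ x), ⟨h₃, h₅.mem⟩, fun he => hne ?_, ?_⟩
    · rw [← h₆, ← h₇, he]
    · rw [h₄.tangentPlane_eq_iff h₅, h₆, h₇]
      exact hs
  filter_upwards [hchart, hθψ, hψ1.eventually hmem, hψ1.eventually hh.eventually]
    with u hu hθu hmu hhu
  constructor
  · intro huD
    by_contra hne
    -- The graph equation is a closed condition near u, so taking the closure adds no point off the
    -- graph.
    have hc : ContinuousAt (fun v => (ψ v).2 - h (ψ v).1) u :=
      hu.smooth.continuousAt.snd.sub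
        (ContinuousAt.comp (g := h) hhu.continuousAt hu.smooth.continuousAt.fst)
    have hev := hc.eventually_ne (sub_ne_zero.2 hne)
    obtain ⟨v, hv₁, hv₂⟩ := ((mem_closure_iff_frequently.1 huD).and_eventually hev).exists
    exact hv₂ (sub_eq_zero.2 (hsub v hv₁))
  · intro hu2
    by_cases hx : (ψ u).1 = 0
    -- The point over x = 0 is g, for which no partner was constructed; it is a limit of the contact
    -- points over x ≠ 0.
    · have hug : u = g := by
        rw [← hθu, ← hθ0]
        congr 1
        exact Prod.ext hx (by rw [hu2, hx, hh0]; rfl)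
      rw [hug]
      have ht : Tendsto (fun x => θ (x, h x)) (𝓝[≠] 0) (𝓝 g) :=
        (hθt.comp hlt).mono_left nhdsWithin_le_nhds
      refine mem_closure_of_tendsto ht ?_
      filter_upwards [nhdsWithin_le_nhds hmem, self_mem_nhdsWithin] with x h₁ h₂ using h₁ h₂
    · have := hmu hx
      rw [← hu2] at this
      exact subset_closure (by rw [← hθu]; exact this)

/-! ### Cross-ratios and tangent lines to Legendrian lifts -/

/-- A change of basis multiplies all 2 × 2 minors by its determinant, and a change of generator of
the i-th line by a scalar cᵢ. Each line occurs once in the numerator and once in the denominator, so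
every factor cancels. -/
theorem IsCrossRatio.unique {V : Type*} [AddCommGroup V] [Module ℝ V]
    {Q ℓ₁ ℓ₂ ℓ₃ ℓ₄ : Submodule ℝ V} {ρ ρ' : ℝ} (h : IsCrossRatio Q ℓ₁ ℓ₂ ℓ₃ ℓ₄ ρ)
    (h' : IsCrossRatio Q ℓ₁ ℓ₂ ℓ₃ ℓ₄ ρ') : ρ = ρ' := by
  obtain ⟨e, f, hef, hQ, a₁, b₁, a₂, b₂, a₃, b₃, a₄, b₄, h₁, h₂, h₃, h₄, n₂₃, n₁₄, rfl⟩ := h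
  obtain ⟨e', f', hef', hQ', a₁', b₁', a₂', b₂', a₃', b₃', a₄', b₄', h₁', h₂', h₃', h₄', n₂₃', n₁₄',
    rfl⟩ := h'
  have hmem : ∀ x ∈ Q, ∃ p q : ℝ, p • e + q • f = x := fun x hx => by
    rw [hQ] at hx
    exact Submodule.mem_span_pair.1 hx
  obtain ⟨A, B, he'⟩ := hmem e' (hQ' ▸ Submodule.subset_span (by simp))
  obtain ⟨C, D, hf'⟩ := hmem f' (hQ' ▸ Submodule.subset_span (by simp))
  have hli : ∀ p q : ℝ, p • e + q • f = 0 → p = 0 ∧ q = 0 :=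
    LinearIndependent.pair_iff.1 hef
  have hscale : ∀ (ℓ : Submodule ℝ V) (a b a' b' : ℝ), ℓ = Submodule.span ℝ {a • e + b • f} →
      ℓ = Submodule.span ℝ {a' • e' + b' • f'} →
      ∃ c : ℝ, a' * A + b' * C = c * a ∧ a' * B + b' * D = c * b := by
    intro ℓ a b a' b' hℓ hℓ'
    have hm : a' • e' + b' • f' ∈ ℓ := by
      rw [hℓ']; exact Submodule.mem_span_singleton_self _
    rw [hℓ] at hm
    obtain ⟨c, hc⟩ := Submodule.mem_span_singleton.1 hm
    refine ⟨c, ?_⟩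
    obtain ⟨k₁, k₂⟩ := hli (a' * A + b' * C - c * a) (a' * B + b' * D - c * b) (by
      rw [← he', ← hf'] at hc
      rw [← sub_eq_zero] at hc
      have : -(c • (a • e + b • f) - (a' • (A • e + B • f) + b' • (C • e + D • f))) = 0 := by
        rw [hc, neg_zero]
      rw [← this]
      module)
    exact ⟨sub_eq_zero.1 k₁, sub_eq_zero.1 k₂⟩
  have hdet : A * D - B * C ≠ 0 := by
    intro h0
    have hne := LinearIndependent.pair_iff.1 hef'
    have k₁ := hne D (-B) (by
      rw [← he', ← hf']
      have : D • (A • e + B • f) + (-B) • (C • e + D • f) = (A * D - B * C) • e := by module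
      rw [this, h0, zero_smul])
    have k₂ := hne C (-A) (by
      rw [← he', ← hf']
      have : C • (A • e + B • f) + (-A) • (C • e + D • f) = -((A * D - B * C) • f) := by module
      rw [this, h0, zero_smul, neg_zero])
    have hA : A = 0 := neg_eq_zero.1 k₂.2
    have hB : B = 0 := neg_eq_zero.1 k₁.2
    have he0 : e' = 0 := by rw [← he', hA, hB]; simp
    exact one_ne_zero (hne 1 0 (by simp [he0])).1
  obtain ⟨c₁, p₁, q₁⟩ := hscale _ _ _ _ _ h₁ h₁'
  obtain ⟨c₂, p₂, q₂⟩ := hscale _ _ _ _ _ h₂ h₂'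
  obtain ⟨c₃, p₃, q₃⟩ := hscale _ _ _ _ _ h₃ h₃'
  obtain ⟨c₄, p₄, q₄⟩ := hscale _ _ _ _ _ h₄ h₄'
  have minor : ∀ {a b a' b' x y x' y' c d : ℝ}, a' * A + b' * C = c * a → a' * B + b' * D = c * b →
      x' * A + y' * C = d * x → x' * B + y' * D = d * y →
      (A * D - B * C) * (a' * y' - x' * b') = c * d * (a * y - x * b) := by
    intro a b a' b' x y x' y' c d e₁ e₂ e₃ e₄
    linear_combination d * y * e₁ - d * x * e₂ - (a' * B + b' * D) * e₃ + (a' * A + b' * C) * e₄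
  have m₁₃ := minor p₁ q₁ p₃ q₃
  have m₂₄ := minor p₂ q₂ p₄ q₄
  have m₂₃ := minor p₂ q₂ p₃ q₃
  have m₁₄ := minor p₁ q₁ p₄ q₄
  have l₁ := mul_ne_zero hdet n₂₃'
  have l₂ := mul_ne_zero hdet n₁₄'
  rw [m₂₃] at l₁
  rw [m₁₄] at l₂
  have hc₂₃ : c₂ * c₃ ≠ 0 := left_ne_zero_of_mul l₁
  have hc₁₄ : c₁ * c₄ ≠ 0 := left_ne_zero_of_mul l₂
  rw [div_eq_div_iff (mul_ne_zero n₂₃ n₁₄) (mul_ne_zero n₂₃' n₁₄')]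
  have hfac : (A * D - B * C) ^ 2 * (c₂ * c₃) * (c₁ * c₄) ≠ 0 :=
    mul_ne_zero (mul_ne_zero (pow_ne_zero 2 hdet) hc₂₃) hc₁₄
  refine mul_left_cancel₀ hfac ?_
  set Δ := A * D - B * C
  calc Δ ^ 2 * (c₂ * c₃) * (c₁ * c₄) * ((a₁ * b₃ - a₃ * b₁) * (a₂ * b₄ - a₄ * b₂) *
        ((a₂' * b₃' - a₃' * b₂') * (a₁' * b₄' - a₄' * b₁')))
      = (c₁ * c₃ * (a₁ * b₃ - a₃ * b₁)) * (c₂ * c₄ * (a₂ * b₄ - a₄ * b₂)) *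
        ((Δ * (a₂' * b₃' - a₃' * b₂')) * (Δ * (a₁' * b₄' - a₄' * b₁'))) := by ring
    _ = (Δ * (a₁' * b₃' - a₃' * b₁')) * (Δ * (a₂' * b₄' - a₄' * b₂')) *
        ((c₂ * c₃ * (a₂ * b₃ - a₃ * b₂)) * (c₁ * c₄ * (a₁ * b₄ - a₄ * b₁))) := by
      rw [m₁₃, m₂₄, m₂₃, m₁₄]
    _ = _ := by ring

/-- Vectors `v₀, v₁` that are mapped to the standard basis by the linear map `L`. -/
structure IsDualFrame (L : Plane →L[ℝ] Plane) (v₀ v₁ : Plane) : Prop where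
  map_fst : L v₀ = (1, 0)
  map_snd : L v₁ = (0, 1)
  injective : ∀ w, L w = 0 → w = 0

namespace IsDualFrame

variable {L : Plane →L[ℝ] Plane} {v₀ v₁ : Plane}

theorem decompose (hL : IsDualFrame L v₀ v₁) (w : Plane) :
    w = (L w).1 • v₀ + (L w).2 • v₁ := by
  refine sub_eq_zero.1 (hL.injective _ ?_)
  rw [map_sub, map_add, map_smul, map_smul, hL.map_fst, hL.map_snd]
  ext <;> simp

theorem eq_smul_of_apply_eq_zero (hL : IsDualFrame L v₀ v₁) {δ : Plane →L[ℝ] ℝ} (h : δ v₀ = 0)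
    (w : Plane) : δ w = δ v₁ * (L w).2 := by
  conv_lhs => rw [hL.decompose w]
  rw [map_add, map_smul, map_smul, h]
  simp [mul_comm]

/-- The first coordinate covector of the frame. -/
noncomputable def covector (L : Plane →L[ℝ] Plane) : Plane →L[ℝ] ℝ :=
  ContinuousLinearMap.fst ℝ ℝ ℝ ∘L L

theorem covector_apply (hL : IsDualFrame L v₀ v₁) : covector L v₀ = 1 := by
  simp [covector, hL.map_fst]

/-- A velocity β of the covector matters only modulo α, and the multiples of α are exactly the
covectors that kill v₀. So β(v₀) is all that is left of β. -/
theorem mk_eq (hL : IsDualFrame L v₀ v₁) {α : Plane →L[ℝ] ℝ} (hα : α v₀ = 0) (hα1 : α v₁ ≠ 0)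
    (k : ℝ) (β : Plane →L[ℝ] ℝ) :
    ContactTangent.mk α (k • v₀, β) =
      k • ContactTangent.mk α (v₀, 0) + β v₀ • ContactTangent.mk α (0, covector L) := by
  rw [← map_smul, ← map_smul, ← map_add, ← sub_eq_zero, ← map_sub]
  refine (Submodule.Quotient.mk_eq_zero _).2 (Submodule.mem_span_singleton.2
    ⟨(β v₁ - β v₀ * covector L v₁) / α v₁, ?_⟩)
  have hδ : ∀ w, (β - β v₀ • covector L) w = (β v₁ - β v₀ * covector L v₁) * (L w).2 := fun w => by
    rw [hL.eq_smul_of_apply_eq_zero (δ := β - β v₀ • covector L)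
      (by simp [hL.covector_apply]) w]
    simp
  refine Prod.ext (by simp) (ContinuousLinearMap.ext fun w => ?_)
  have h₁ := hδ w
  have h₂ := hL.eq_smul_of_apply_eq_zero hα w
  simp at h₁ ⊢
  rw [h₁, h₂]
  field_simp

theorem contactPlane_eq (hL : IsDualFrame L v₀ v₁) {α : Plane →L[ℝ] ℝ} (hα : α v₀ = 0)
    (hα1 : α v₁ ≠ 0) : contactPlane α = Submodule.span ℝ
      {ContactTangent.mk α (v₀, 0), ContactTangent.mk α (0, covector L)} := by
  apply le_antisymm
  · rintro _ ⟨⟨v, β⟩, ⟨hv, -⟩, rfl⟩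
    have hv' : α v = 0 := hv
    rw [hL.eq_smul_of_apply_eq_zero hα v] at hv'
    have h2 := (mul_eq_zero.1 hv').resolve_left hα1
    have hd := hL.decompose v
    rw [h2, zero_smul, add_zero] at hd
    rw [hd, hL.mk_eq hα hα1]
    exact Submodule.mem_span_pair.2 ⟨_, _, rfl⟩
  · rw [Submodule.span_le]
    rintro _ (rfl | rfl)
    · exact ⟨(v₀, 0), ⟨hα, trivial⟩, rfl⟩
    · exact ⟨(0, covector L), ⟨map_zero α, trivial⟩, rfl⟩

theorem fibreLine_eq (hL : IsDualFrame L v₀ v₁) {α : Plane →L[ℝ] ℝ} (hα : α v₀ = 0)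
    (hα1 : α v₁ ≠ 0) :
    fibreLine α = Submodule.span ℝ {ContactTangent.mk α (0, covector L)} := by
  apply le_antisymm
  · rintro _ ⟨⟨v, β⟩, ⟨hv, -⟩, rfl⟩
    have hv' : v = 0 := hv
    have := hL.mk_eq hα hα1 0 β
    rw [zero_smul, zero_smul, zero_add] at this
    rw [hv', this]
    exact Submodule.mem_span_singleton.2 ⟨_, rfl⟩
  · rw [Submodule.span_le]
    rintro _ rfl
    exact ⟨(0, covector L), ⟨rfl, trivial⟩, rfl⟩

theorem linearIndependent (hL : IsDualFrame L v₀ v₁) {α : Plane →L[ℝ] ℝ} (hα : α v₀ = 0) :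
    LinearIndependent ℝ ![ContactTangent.mk α (v₀, 0), ContactTangent.mk α (0, covector L)] := by
  rw [LinearIndependent.pair_iff]
  intro a b h
  rw [← map_smul, ← map_smul, ← map_add] at h
  obtain ⟨t, ht⟩ := Submodule.mem_span_singleton.1 ((Submodule.Quotient.mk_eq_zero _).1 h)
  have h₁ := congrArg Prod.fst ht
  have h₂ := congrArg (fun z : Plane × (Plane →L[ℝ] ℝ) => z.2 v₀) ht
  simp [hα, hL.covector_apply] at h₁ h₂
  have hv₀ : v₀ ≠ 0 := by
    rintro rfl
    have := hL.map_fst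
    rw [map_zero] at this
    exact zero_ne_one (congrArg Prod.fst this)
  exact ⟨(smul_eq_zero.1 h₁.symm).resolve_right hv₀, h₂.symm⟩

/-- The fibre is the line of infinite slope, with coordinates (0, 1), so the cross-ratio degenerates
to a ratio of differences of slopes. -/
theorem isCrossRatio (hL : IsDualFrame L v₀ v₁) {α : Plane →L[ℝ] ℝ} (hα : α v₀ = 0)
    (hα1 : α v₁ ≠ 0) {ℓ₁ ℓ₂ ℓ₃ : Submodule ℝ (ContactTangent α)} {σ₁ σ₂ σ₃ : ℝ} (h23 : σ₂ ≠ σ₃)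
    (h₁ : ℓ₁ = Submodule.span ℝ
      {ContactTangent.mk α (v₀, 0) + σ₁ • ContactTangent.mk α (0, covector L)})
    (h₂ : ℓ₂ = Submodule.span ℝ
      {ContactTangent.mk α (v₀, 0) + σ₂ • ContactTangent.mk α (0, covector L)})
    (h₃ : ℓ₃ = Submodule.span ℝ
      {ContactTangent.mk α (v₀, 0) + σ₃ • ContactTangent.mk α (0, covector L)}) :
    IsCrossRatio (contactPlane α) ℓ₁ ℓ₂ ℓ₃ (fibreLine α) ((σ₁ - σ₃) / (σ₂ - σ₃)) := by
  refine ⟨_, _, hL.linearIndependent hα, hL.contactPlane_eq hα hα1, 1, σ₁, 1, σ₂, 1, σ₃, 0, 1,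
    by simpa using h₁, by simpa using h₂, by simpa using h₃,
    by simpa using hL.fibreLine_eq hα hα1, ?_, by simp, ?_⟩
  · intro h
    exact h23 (by linarith)
  · rw [← neg_div_neg_eq]
    simp

end IsDualFrame

theorem HasDerivAt.plane_fst {f : ℝ → Plane} {d : Plane} {t : ℝ} (hf : HasDerivAt f d t) :
    HasDerivAt (fun t => (f t).1) d.1 t :=
  (ContinuousLinearMap.fst ℝ ℝ ℝ).hasFDerivAt.comp_hasDerivAt t hf

theorem HasDerivAt.plane_snd {f : ℝ → Plane} {d : Plane} {t : ℝ} (hf : HasDerivAt f d t) :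
    HasDerivAt (fun t => (f t).2) d.2 t :=
  (ContinuousLinearMap.snd ℝ ℝ ℝ).hasFDerivAt.comp_hasDerivAt t hf

/-- The tangent line to the Legendrian lift of a curve that has the `2`-jet `y = s x²` in the chart
`ψ`: its slope is an affine function of `s`, with coefficients that depend on the chart only. -/
theorem IsLegendrianTangent.eq_span {ψ : Plane → Plane} {g v₀ v₁ : Plane}
    (hψ : SmoothNear ψ g) (hψg : ψ g = 0) (hL : IsDualFrame (fderiv ℝ ψ g) v₀ v₁)
    {h : ℝ → ℝ} (hh : SmoothNear h 0) {s : ℝ}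
    (hs : (fun x => h x - s * x ^ 2) =o[𝓝 0] fun x => x ^ 2) {γ : ℝ → Plane}
    (hγ : SmoothNear γ 0) (hγ0 : γ 0 = g) (hγd : deriv γ 0 ≠ 0)
    (hγh : ∀ᶠ t in 𝓝 0, (ψ (γ t)).2 = h (ψ (γ t)).1) {α₀ : Plane →L[ℝ] ℝ} (hα₀ : α₀ ≠ 0)
    {ℓ : Submodule ℝ (ContactTangent α₀)} (hℓ : IsLegendrianTangent γ α₀ ℓ) :
    α₀ v₀ = 0 ∧ α₀ v₁ ≠ 0 ∧ ℓ = Submodule.span ℝ {ContactTangent.mk α₀ (v₀, 0) +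
      (-α₀ v₁ * (2 * s - (fderiv ℝ (fderiv ℝ ψ) g v₀ v₀).2)) •
        ContactTangent.mk α₀ (0, IsDualFrame.covector (fderiv ℝ ψ g))} := by
  obtain ⟨α, hα, hα0, hαγ, rfl⟩ := hℓ
  obtain ⟨hh0, hhd, -⟩ := hh.derivs_of_isLittleO hs
  have hψγ : SmoothNear (fun t => ψ (γ t)) 0 := SmoothNear.comp 0 (by rwa [hγ0]) hγ
  have hd1 : ∀ᶠ t in 𝓝 0, HasDerivAt (fun t => ψ (γ t)) (fderiv ℝ ψ (γ t) (deriv γ t)) t := by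
    have hγt : Tendsto γ (𝓝 0) (𝓝 g) := hγ0 ▸ hγ.continuousAt.tendsto
    filter_upwards [hγt.eventually hψ.eventually_differentiableAt, hγ.eventually_differentiableAt]
      with t h₁ h₂ using h₁.hasFDerivAt.comp_hasDerivAt t h₂.hasDerivAt
  have hd2 : HasDerivAt (fun t => fderiv ℝ ψ (γ t) (deriv γ t))
      (fderiv ℝ (fderiv ℝ ψ) g (deriv γ 0) (deriv γ 0) +
        fderiv ℝ ψ g (deriv (deriv γ) 0)) 0 := by
    have h₁ : HasFDerivAt (fderiv ℝ ψ) (fderiv ℝ (fderiv ℝ ψ) g) (γ 0) := by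
      rw [hγ0]; exact hψ.fderiv.differentiableAt.hasFDerivAt
    have h₂ := (h₁.comp_hasDerivAt (0 : ℝ) hγ.differentiableAt.hasDerivAt).clm_apply
      hγ.deriv.differentiableAt.hasDerivAt
    simpa [Function.comp, hγ0] using h₂
  let X : ℝ → ℝ := fun t => (ψ (γ t)).1
  let Y : ℝ → ℝ := fun t => (ψ (γ t)).2
  have hX : SmoothNear X 0 := SmoothNear.comp 0 (g := Prod.fst) (contDiff_fst.smoothNear _) hψγ
  have hY : SmoothNear Y 0 := SmoothNear.comp 0 (g := Prod.snd) (contDiff_snd.smoothNear _) hψγ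
  have hX0 : X 0 = 0 := by simp [X, hγ0, hψg]
  have hXt : Tendsto X (𝓝 0) (𝓝 0) := by
    have := hX.continuousAt.tendsto
    rwa [hX0] at this
  set k := deriv X 0 with hk
  -- Substitute X = kt + o(t) in Y = sX² + o(X²).
  have hYo : (fun t => Y t - s * k ^ 2 * t ^ 2) =o[𝓝 0] fun t : ℝ => t ^ 2 := by
    have hXO : X =O[𝓝 0] fun t : ℝ => t := hX.isBigO_id hX0
    have h₁ := (hs.comp_tendsto hXt).trans_isBigO (hXO.pow 2)
    have h₂ : (fun t => X t - k * t) =o[𝓝 0] fun t : ℝ => t :=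
      hX.taylor_one.congr_left fun t => by rw [hX0]; ring
    have h₃ : (fun t => (X t - k * t) * (X t + k * t)) =o[𝓝 0] fun t : ℝ => t ^ 2 :=
      (h₂.mul_isBigO (hXO.add ((isBigO_refl (fun t : ℝ => t) _).const_mul_left k))).congr_right
        fun t => by ring
    refine (h₁.add (h₃.const_mul_left s)).congr' ?_ EventuallyEq.rfl
    filter_upwards [hγh] with t ht
    change (h (ψ (γ t)).1 - s * X t ^ 2) + _ = (ψ (γ t)).2 - _
    rw [ht]
    ring
  obtain ⟨-, hYd, hYdd⟩ := hY.derivs_of_isLittleO hYo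
  have hXd : ∀ᶠ t in 𝓝 0, deriv X t = (fderiv ℝ ψ (γ t) (deriv γ t)).1 :=
    hd1.mono fun t ht => ht.plane_fst.deriv
  have hYd' : deriv Y =ᶠ[𝓝 0] fun t => (fderiv ℝ ψ (γ t) (deriv γ t)).2 :=
    hd1.mono fun t ht => ht.plane_snd.deriv
  have hLγ : fderiv ℝ ψ g (deriv γ 0) = (k, 0) := by
    have h₁ := hXd.self_of_nhds
    have h₂ := hYd'.self_of_nhds
    simp only [hγ0] at h₁ h₂
    exact Prod.ext h₁.symm (h₂.symm.trans hYd)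
  have hγv : deriv γ 0 = k • v₀ := by
    rw [hL.decompose (deriv γ 0), hLγ]; simp
  have hk0 : k ≠ 0 := fun h0 => hγd (by rw [hγv, h0, zero_smul])
  -- Y''(0) computed twice: from the 2-jet of the curve, and by the chain rule through ψ. The second
  -- derivative of ψ enters only through a term common to all curves in the direction v₀.
  have hcurv : 2 * (s * k ^ 2) = k ^ 2 * (fderiv ℝ (fderiv ℝ ψ) g v₀ v₀).2 +
      (fderiv ℝ ψ g (deriv (deriv γ) 0)).2 := by
    rw [← hYdd, hYd'.deriv_eq, hd2.plane_snd.deriv, hγv]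
    simp
    ring
  have hα0v : α₀ v₀ = 0 := by
    have := hαγ.self_of_nhds
    rw [hα0, hγv, map_smul] at this
    exact (smul_eq_zero.1 this).resolve_left hk0
  have hα1 : α₀ v₁ ≠ 0 := by
    intro h0
    apply hα₀
    refine ContinuousLinearMap.ext fun w => ?_
    rw [hL.eq_smul_of_apply_eq_zero hα0v w, h0, zero_mul]
    rfl
  -- Differentiating α(γ') = 0 ties the rotation of the contact element to γ''(0), which is
  -- eliminated by `hcurv`.
  have hαd : deriv α 0 (deriv γ 0) + α₀ (deriv (deriv γ) 0) = 0 := by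
    have h₁ := hα.differentiableAt.hasDerivAt.clm_apply hγ.deriv.differentiableAt.hasDerivAt
    rw [hα0] at h₁
    exact h₁.unique ((hasDerivAt_const (0 : ℝ) (0 : ℝ)).congr_of_eventuallyEq hαγ)
  refine ⟨hα0v, hα1, ?_⟩
  have hβ : deriv α 0 v₀ =
      k * (-α₀ v₁ * (2 * s - (fderiv ℝ (fderiv ℝ ψ) g v₀ v₀).2)) := by
    rw [hL.eq_smul_of_apply_eq_zero hα0v, hγv, map_smul, smul_eq_mul] at hαd
    refine mul_left_cancel₀ hk0 ?_
    linear_combination hαd + (α₀ v₁) * hcurv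
  rw [hγv, hL.mk_eq hα0v hα1, hβ, mul_smul, ← smul_add]
  exact Submodule.span_singleton_smul_eq (isUnit_iff_ne_zero.2 hk0) _

/-- Pull back the form dy - h'(x) dx by ψ. As h'(0) = 0, its value at t = 0 does not depend on h, so
curves with this property share the same contact element. -/
theorem exists_isLegendrianTangent {ψ : Plane → Plane} {g : Plane} (hψ : SmoothNear ψ g)
    {h : ℝ → ℝ} (hh : SmoothNear h 0) (hhd : deriv h 0 = 0) {γ : ℝ → Plane}
    (hγ : SmoothNear γ 0) (hγ0 : γ 0 = g) (hψγ : ∀ᶠ t in 𝓝 0, ψ (γ t) = (t, h t)) :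
    ∃ ℓ, IsLegendrianTangent γ (ContinuousLinearMap.snd ℝ ℝ ℝ ∘L fderiv ℝ ψ g) ℓ := by
  let α : ℝ → (Plane →L[ℝ] ℝ) := fun t =>
    (ContinuousLinearMap.snd ℝ ℝ ℝ - deriv h t • ContinuousLinearMap.fst ℝ ℝ ℝ) ∘L
      fderiv ℝ ψ (γ t)
  refine ⟨_, α, ?_, ?_, ?_, rfl⟩
  · have h₁ : SmoothNear (fun t => fderiv ℝ ψ (γ t)) 0 :=
      SmoothNear.comp 0 (by rw [hγ0]; exact hψ.fderiv) hγ
    have h₂ : SmoothNear (fun t => ContinuousLinearMap.snd ℝ ℝ ℝ -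
        deriv h t • ContinuousLinearMap.fst ℝ ℝ ℝ) 0 :=
      (contDiff_const.smoothNear 0).sub (hh.deriv.smul (contDiff_const.smoothNear 0))
    filter_upwards [h₁, h₂] with t e₁ e₂ using e₂.clm_comp e₁
  · simp [α, hhd, hγ0]
  · have hγt : Tendsto γ (𝓝 0) (𝓝 g) := hγ0 ▸ hγ.continuousAt.tendsto
    filter_upwards [hγt.eventually hψ.eventually_differentiableAt, hγ.eventually_differentiableAt,
      hh.eventually_differentiableAt, hψγ.eventually_nhds] with t h₁ h₂ h₃ h₄
    have e₁ := h₁.hasFDerivAt.comp_hasDerivAt t h₂.hasDerivAt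
    have e₂ : HasDerivAt (fun t : ℝ => ((t, h t) : Plane)) (1, deriv h t) t :=
      (hasDerivAt_id t).prodMk h₃.hasDerivAt
    have e₃ := e₁.unique (e₂.congr_of_eventuallyEq h₄)
    simp [α, e₃]

/-! ### The cr-invariant from the 2-jets of the three curves -/

theorem IsParabolaGerm.pullback {C : Set Plane} {s : ℝ} (h : IsParabolaGerm C s) {ψ : Plane → Plane}
    {g : Plane} (hψ : Tendsto ψ (𝓝 g) (𝓝 0)) {C' : Set Plane}
    (hC : ∀ᶠ u in 𝓝 g, u ∈ C' ↔ ψ u ∈ C) :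
    ∃ h : ℝ → ℝ, SmoothNear h 0 ∧ ((fun x => h x - s * x ^ 2) =o[𝓝 0] fun x => x ^ 2) ∧
      ∀ᶠ u in 𝓝 g, u ∈ C' ↔ (ψ u).2 = h (ψ u).1 := by
  obtain ⟨h, hh, hs, hiff⟩ := h
  refine ⟨h, hh, hs, ?_⟩
  filter_upwards [hC, hψ.eventually hiff] with u h₁ h₂ using h₁.trans h₂

theorem ParametrisesGerm.eventually_graph {γ : ℝ → Plane} {C : Set Plane} {g : Plane}
    (hγ : ParametrisesGerm γ C g) {ψ : Plane → Plane} {h : ℝ → ℝ}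
    (hC : ∀ᶠ u in 𝓝 g, u ∈ C ↔ (ψ u).2 = h (ψ u).1) :
    ∀ᶠ t in 𝓝 0, (ψ (γ t)).2 = h (ψ (γ t)).1 := by
  have hγt : Tendsto γ (𝓝 0) (𝓝 g) := hγ.2.1 ▸ hγ.1.continuousAt.tendsto
  filter_upwards [hγ.eventually_mem, hγt.eventually hC] with t h₁ h₂ using h₂.1 h₁

/-- The cross-ratio of curves whose `2`-jets in a chart are `y = c x²`. -/
theorem isCrossRatio_of_parabolas {ψ : Plane → Plane} {g : Plane} (hψ : SmoothNear ψ g)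
    (hψg : ψ g = 0) (hinj : ∀ w, fderiv ℝ ψ g w = 0 → w = 0) {h : Fin 3 → ℝ → ℝ}
    {c : Fin 3 → ℝ} (hh : ∀ i, SmoothNear (h i) 0)
    (ho : ∀ i, (fun x => h i x - c i * x ^ 2) =o[𝓝 0] fun x => x ^ 2) (hc : c 1 ≠ c 2)
    {γ : Fin 3 → ℝ → Plane} (hγ : ∀ i, SmoothNear (γ i) 0) (hγ0 : ∀ i, γ i 0 = g)
    (hγd : ∀ i, deriv (γ i) 0 ≠ 0) (hγh : ∀ i, ∀ᶠ t in 𝓝 0, (ψ (γ i t)).2 = h i (ψ (γ i t)).1)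
    {α₀ : Plane →L[ℝ] ℝ} (hα₀ : α₀ ≠ 0) {ℓ : Fin 3 → Submodule ℝ (ContactTangent α₀)}
    (hℓ : ∀ i, IsLegendrianTangent (γ i) α₀ (ℓ i)) :
    IsCrossRatio (contactPlane α₀) (ℓ 0) (ℓ 1) (ℓ 2) (fibreLine α₀)
      ((c 0 - c 2) / (c 1 - c 2)) := by
  have hsurj := (LinearMap.injective_iff_surjective (f := (fderiv ℝ ψ g).toLinearMap)).1
    ((injective_iff_map_eq_zero _).2 hinj)
  obtain ⟨v₀, hv₀⟩ := hsurj (1, 0)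
  obtain ⟨v₁, hv₁⟩ := hsurj (0, 1)
  have hL : IsDualFrame (fderiv ℝ ψ g) v₀ v₁ := ⟨hv₀, hv₁, hinj⟩
  have key := fun i => (hℓ i).eq_span hψ hψg hL (hh i) (ho i) (hγ i) (hγ0 i) (hγd i) (hγh i) hα₀
  obtain ⟨hα, hα1, -⟩ := key 0
  set d := (fderiv ℝ (fderiv ℝ ψ) g v₀ v₀).2
  have hne : c 1 - c 2 ≠ 0 := sub_ne_zero.2 hc
  have := hL.isCrossRatio hα hα1 (fun he => ?_) (key 0).2.2 (key 1).2.2 (key 2).2.2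
  · convert this using 1
    -- In differences of slopes the curvature d of the chart cancels; in their quotient the scale
    -- -2α₀(v₁) does.
    rw [show -α₀ v₁ * (2 * c 0 - d) - -α₀ v₁ * (2 * c 2 - d) = (-2 * α₀ v₁) * (c 0 - c 2) by ring,
      show -α₀ v₁ * (2 * c 1 - d) - -α₀ v₁ * (2 * c 2 - d) = (-2 * α₀ v₁) * (c 1 - c 2) by ring,
      mul_div_mul_left _ _ (mul_ne_zero (by norm_num) hα1)]
  · have : -α₀ v₁ * 2 * (c 1 - c 2) = 0 := by linear_combination he
    exact mul_ne_zero (mul_ne_zero (neg_ne_zero.2 hα1) two_ne_zero) hne this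

/-- The cross-ratio is computed for arbitrary parametrisations and an arbitrary common covector.
Uniqueness of the cross-ratio then gives one direction, and the parametrisations t ↦ θ(t, h(t)) give
the other. -/
theorem ProjSurface.hasCrInvariant_iff_of_parabolas {S : ProjSurface} {ψ θ : Plane → Plane}
    {g : Plane} (hψ : SmoothNear ψ g) (hψg : ψ g = 0) (hinj : ∀ w, fderiv ℝ ψ g w = 0 → w = 0)
    (hθ : SmoothNear θ 0) (hθ0 : θ 0 = g) (hθψ : ∀ᶠ u in 𝓝 g, θ (ψ u) = u)
    (hψθ : ∀ᶠ p in 𝓝 0, ψ (θ p) = p) {hF hP hD : ℝ → ℝ} {sF sP sD : ℝ}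
    (hFs : SmoothNear hF 0) (hPs : SmoothNear hP 0) (hDs : SmoothNear hD 0)
    (hFo : (fun x => hF x - sF * x ^ 2) =o[𝓝 0] fun x => x ^ 2)
    (hPo : (fun x => hP x - sP * x ^ 2) =o[𝓝 0] fun x => x ^ 2)
    (hDo : (fun x => hD x - sD * x ^ 2) =o[𝓝 0] fun x => x ^ 2)
    (hFC : ∀ᶠ u in 𝓝 g, u ∈ S.flecnodalCurve ↔ (ψ u).2 = hF (ψ u).1)
    (hPC : ∀ᶠ u in 𝓝 g, u ∈ S.parabolicCurve ↔ (ψ u).2 = hP (ψ u).1)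
    (hDC : ∃ N ∈ 𝓝 g, ∀ V ∈ 𝓝 g, V ⊆ N →
      ∀ᶠ u in 𝓝 g, u ∈ S.conodalCurve V ↔ (ψ u).2 = hD (ψ u).1)
    (hPD : sP ≠ sD) (ρ : ℝ) : S.HasCrInvariant g ρ ↔ ρ = (sF - sD) / (sP - sD) := by
  have cross : ∀ {γF γP γD : ℝ → Plane} {N' : Set Plane}, N' ∈ 𝓝 g →
      ParametrisesGerm γF S.flecnodalCurve g → ParametrisesGerm γP S.parabolicCurve g →
      (∀ V ∈ 𝓝 g, V ⊆ N' → ParametrisesGerm γD (S.conodalCurve V) g) →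
      ∀ {α₀ : Plane →L[ℝ] ℝ}, α₀ ≠ 0 → ∀ {ℓF ℓP ℓD : Submodule ℝ (ContactTangent α₀)},
      IsLegendrianTangent γF α₀ ℓF → IsLegendrianTangent γP α₀ ℓP → IsLegendrianTangent γD α₀ ℓD →
      IsCrossRatio (contactPlane α₀) ℓF ℓP ℓD (fibreLine α₀) ((sF - sD) / (sP - sD)) := by
    intro γF γP γD N' hN' gF gP gD α₀ hα₀ ℓF ℓP ℓD lF lP lD
    obtain ⟨N, hN, hDC⟩ := hDC
    -- One piece of surface small enough both for the given parametrisation of D and for its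
    -- description as a graph.
    have hV := inter_mem hN hN'
    have gD' := gD _ hV inter_subset_right
    have hDC' := hDC _ hV inter_subset_left
    refine isCrossRatio_of_parabolas hψ hψg hinj (h := ![hF, hP, hD]) (c := ![sF, sP, sD])
      ?_ ?_ hPD (γ := ![γF, γP, γD]) ?_ ?_ ?_ ?_ hα₀ (ℓ := ![ℓF, ℓP, ℓD]) ?_
    all_goals intro i; fin_cases i
    exacts [hFs, hPs, hDs, hFo, hPo, hDo, gF.1, gP.1, gD'.1, gF.2.1, gP.2.1, gD'.2.1, gF.2.2.1,
      gP.2.2.1, gD'.2.2.1, gF.eventually_graph hFC, gP.eventually_graph hPC,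
      gD'.eventually_graph hDC', lF, lP, lD]
  constructor
  · rintro ⟨γF, γP, γD, gF, gP, ⟨N, hN, gD⟩, α₀, hα₀, ℓF, ℓP, ℓD, lF, lP, lD, hρ⟩
    exact hρ.unique (cross hN gF gP gD hα₀ lF lP lD)
  · rintro rfl
    obtain ⟨hF0, hFd, -⟩ := hFs.derivs_of_isLittleO hFo
    obtain ⟨hP0, hPd, -⟩ := hPs.derivs_of_isLittleO hPo
    obtain ⟨hD0, hDd, -⟩ := hDs.derivs_of_isLittleO hDo
    obtain ⟨gF, eF⟩ := parametrisesGerm_of_graph hψ hψg hθ hθ0 hθψ hψθ hFs hF0 hFC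
    obtain ⟨gP, eP⟩ := parametrisesGerm_of_graph hψ hψg hθ hθ0 hθψ hψθ hPs hP0 hPC
    obtain ⟨N, hN, hDC'⟩ := hDC
    have gD := fun V hV hVN =>
      parametrisesGerm_of_graph hψ hψg hθ hθ0 hθψ hψθ hDs hD0 (hDC' V hV hVN)
    have gD1 := fun V hV hVN => (gD V hV hVN).1
    obtain ⟨gDN, eD⟩ := gD N hN Subset.rfl
    obtain ⟨ℓF, lF⟩ := exists_isLegendrianTangent hψ hFs hFd gF.1 gF.2.1 eF
    obtain ⟨ℓP, lP⟩ := exists_isLegendrianTangent hψ hPs hPd gP.1 gP.2.1 eP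
    obtain ⟨ℓD, lD⟩ := exists_isLegendrianTangent hψ hDs hDd gDN.1 gDN.2.1 eD
    have hα₀ : ContinuousLinearMap.snd ℝ ℝ ℝ ∘L fderiv ℝ ψ g ≠ 0 := by
      intro h0
      obtain ⟨w, hw⟩ := (LinearMap.injective_iff_surjective
        (f := (fderiv ℝ ψ g).toLinearMap)).1 ((injective_iff_map_eq_zero _).2 hinj) (0, 1)
      have h₁ : (fderiv ℝ ψ g w).2 = 0 := congrArg (fun L : Plane →L[ℝ] ℝ => L w) h0
      have h₂ : (fderiv ℝ ψ g w).2 = 1 := congrArg Prod.snd hw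
      exact one_ne_zero (h₂.symm.trans h₁)
    exact ⟨_, _, _, gF, gP, ⟨N, hN, gD1⟩, _, hα₀, ℓF, ℓP, ℓD, lF, lP, lD,
      cross hN gF gP gD1 hα₀ lF lP lD⟩

/-- Let `g` be a godron of a smooth surface which some projective transformation `T` puts in the
normal form `z = y²/2 - x² y + lam x⁴ + φ(x, y)`, with `lam ≠ 0, 1/2` and with `φ` smooth of order
greater than four. Then the cr-invariant of `g` is defined, and it is `ρ` exactly if
`lam = ρ/2`. -/
theorem theorem4 (S : ProjSurface) (g : Plane) (hg : S.IsGodron g)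
    (lam : ℝ) (hlam0 : lam ≠ 0) (hlam1 : lam ≠ 1 / 2)
    (φ : Plane → ℝ) (hφ : SmoothNear φ 0)
    (hφjet : ∀ k : ℕ, k ≤ 4 → iteratedFDeriv ℝ k φ 0 = 0)
    (T : HomCoord ≃ₗ[ℝ] HomCoord)
    (hT : S.SentToGraph g T
      (fun p => p.2 ^ 2 / 2 - p.1 ^ 2 * p.2 + lam * p.1 ^ 4 + φ p))
    (ρ : ℝ) :
    S.HasCrInvariant g ρ ↔ lam = ρ / 2 := by
  -- Only the germ of φ at the origin matters, so φ is replaced by a globally smooth function with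
  -- the same germ.
  obtain ⟨φ', hφ', heq⟩ := exists_isFlat_representative hφ hφjet
  have hgdom : g ∈ S.dom := hg.1.1
  have hψg : S.affineProjection T g = 0 := by
    simp [ProjSurface.affineProjection, hT.1, hT.2.1]
  have hψt : Tendsto (S.affineProjection T) (𝓝 g) (𝓝 0) := by
    have hr : ContinuousAt S.r g :=
      (S.smooth.contDiffAt (S.isOpen_dom.mem_nhds hgdom)).continuousAt
    have hTr : ∀ i, ContinuousAt (fun u => T (S.r u) i) g := fun i =>
      (((ContinuousLinearMap.proj (R := ℝ) (φ := fun _ : Fin 4 => ℝ) i) ∘L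
        (T.toContinuousLinearEquiv : HomCoord →L[ℝ] HomCoord)).continuous.continuousAt).comp hr
    have h0 : T (S.r g) 0 ≠ 0 := hT.2.2.2.self_of_nhds.1
    have hc : ContinuousAt (S.affineProjection T) g :=
      ((hTr 1).div (hTr 0) h0).prodMk ((hTr 2).div (hTr 0) h0)
    exact hψg ▸ hc.tendsto
  have hT' : S.SentToGraph g T (platonova lam φ') := by
    refine ⟨hT.1, hT.2.1, hT.2.2.1, ?_⟩
    filter_upwards [hT.2.2.2, hψt.eventually heq] with u hu he
    refine ⟨hu.1, hu.2.trans ?_⟩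
    simp only [platonova, ProjSurface.affineProjection] at he ⊢
    rw [he]
  have hchart := hT'.eventually_isGraphChart hgdom (contDiff_platonova hφ')
  set ψ := S.affineProjection T
  have hψ := hchart.self_of_nhds.smooth
  have hinj := hchart.self_of_nhds.injective
  obtain ⟨θ, hθ, hθ0, hθψ, hψθ⟩ := hψ.exists_inverse rfl hinj
  rw [hψg] at hθ hθ0 hψθ
  have hyy : ∀ᶠ u in 𝓝 g, partialY (partialY (platonova lam φ')) (ψ u) ≠ 0 := by
    refine hψt.eventually (((contDiff_platonova hφ').partialY.partialY.continuous.continuousAt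
      (x := 0)).eventually_ne ?_)
    simp [partialYY_platonova hφ', (hφ'.partialY.partialY : IsFlat 2 _).apply_zero]
  obtain ⟨hF, hFs, hFo, hFC⟩ := (isParabolaGerm_flecnodal (lam := lam) hφ').pullback hψt
    (hchart.mono fun u hu => hu.mem_flecnodalCurve_iff)
  obtain ⟨hP, hPs, hPo, hPC⟩ := (isParabolaGerm_hessianDet (lam := lam) hφ').pullback hψt
    ((hchart.and hyy).mono fun u hu => hu.1.mem_parabolicCurve_iff hu.2)
  obtain ⟨hD, hDs, hDo, hcon, σ, hσ, hmate⟩ := exists_conodal_graph hφ' hlam1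
  obtain ⟨hD0, -, -⟩ := hDs.derivs_of_isLittleO hDo
  have hDC := conodalCurve_eq_graph hchart hψg hθ hθ0 hθψ hψθ hDs hD0 hcon hσ hmate
  have hne : 2 * lam - 1 ≠ 0 := fun h => hlam1 (by linarith)
  rw [S.hasCrInvariant_iff_of_parabolas hψ hψg hinj hθ hθ0 hθψ hψθ hFs hPs hDs hFo hPo hDo hFC hPC
    hDC (fun h => hne (by linarith)) ρ]
  -- Both differences contain 2λ - 1: the numerator is 4λ(2λ - 1) and the denominator 2(2λ - 1).
  have hval : (8 * lam ^ 2 - 2 * lam - 2 * lam) / (6 * lam - 2 - 2 * lam) = 2 * lam := by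
    rw [div_eq_iff (fun h => hne (by linarith))]
    ring
  rw [hval]
  constructor
  · rintro rfl
    ring
  · rintro rfl
    ring
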